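/- Let $k$ be an algebraically closed field of characteristic $p>0$, let $A=k[x_0,\dots,x_N]$ be graded by $\deg x_i=q_i\in\mathbb Z_{>0}$, and put $d=q_0+\cdots+q_N$. Let $M_1,\dots,M_m$ be all monomials of degree $d$ (with coefficient $1$), let $V$ be their $k$-span, let $0\neq f=\sum_{i=1}^m b_iM_i\in V$, and let $X=\operatorname{Proj}(A/fA)$. Write $F$ for the Frobenius (applied entrywise to vectors over $k$) and * $v_f=(b_1,\dots,b_m)^{t}$, * $\Delta(f)=\sum \frac1p\binom{p}{\beta_1,\dots,\beta_m}(b_1M_1)^{\beta_1}\cdots(b_mM_m)^{\beta_m}$, the sum being over $0\le\beta_1,\dots,\beta_m\le p-1$ with $\beta_1+\cdots+\beta_m=p$, * $u\colon F_*A\to A$ for the $A$-linear map dual to $F_*((x_0\cdots x_N)^{p-1})$ with respect to the basis $\{F_*(x_0^{i_0}\cdots x_N^{i_N}) : 0\le i_j\le p-1\}$ of $F_*A$, * $\lambda=\bigl(u(F_*(f^{p-2}M_1)),\dots,u(F_*(f^{p-2}M_m))\bigr)\in k^{1\times m}$, * $T\in k^{m\times m}$ for the matrix of the $k$-linear map $F_*V\to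 V$, $F_*h\mapsto u(F_*(\Delta(f)f^{p-2}h))$, with respect to the bases $F_*M_1,\dots,F_*M_m$ and $M_1,\dots,M_m$ (the $i$-th column of $T$ consists of the coordinates of the image of $F_*M_i$). Define row vectors $R_n\in k^{1\times m}$ by $R_1=F(\lambda)$ and $R_{n+1}=F(R_nT)$ for $n\ge1$. For $n\ge 1$, $X$ is called $n$-quasi-$F$-split if there is a homomorphism of $W_n\mathcal O_X$-modules $\varphi\colon F_*W_n\mathcal O_X\to\mathcal O_X$ such that $\varphi\circ F$ is the restriction $W_n\mathcal O_X\to\mathcal O_X$; the quasi-$F$-split height $\operatorname{ht}(X)$ is the infimum of all such $n$. For a $\mathbb Q$-divisor $D$ on $\operatorname{Spec}A$ let $W_n(A)(D)\subseteq W_n(\operatorname{Frac}A)$ be the set of Witt vectors $(a_0,\dots,a_{n-1})$ with $a_i\in A(\lfloor p^iD\rfloor)$ for all $i$; for $D\ge 0$ the pair $(A,D)$ is $n$-quasi-$F$-split if there is a homomorphism of $W_n(A)$-modules $\varphi\colon F_*W_n(A)(pD)\to A$ such that the composite $W_n(A)\xrightarrow{F}F_*W_n(A)(pD)\xrightarrow{\varphi}A$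 is the restriction. Let $\mathrm{ns}(f)$ be the infimum of all $n\ge1$ for which $(A,(1-\frac2{p^n})\operatorname{div}(f))$ is not $n$-quasi-$F$-split. (Throughout, $\inf\emptyset=\infty$.) Then $$\operatorname{ht}(X)=\inf\{\,n\ge1\mid R_nv_f\ne0\,\}.$$ Furthermore, if $R_nv_f=0$ for every $n\ge1$, then $$\mathrm{ns}(f)=\inf\left\{\,n\ge1\ \middle|\ \operatorname{rank}\begin{pmatrix}R_1\\ \vdots\\ R_n\end{pmatrix}\le n-1\right\}.$$ -/

import Mathlib

open MvPolynomial AlgebraicGeometry CategoryTheory Opposite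

noncomputable section

namespace QFS

/-- The least integer `n ≥ 1` with `P n`, and `∞` if there is none. -/
def leastIndex (P : ℕ → Prop) : ℕ∞ :=
  sInf {x : ℕ∞ | ∃ n : ℕ, 1 ≤ n ∧ P n ∧ x = (n : ℕ∞)}

/-! ### Truncated Witt vectors -/

section Witt

variable (p : ℕ) {n : ℕ} {R S : Type*} [CommRing R] [CommRing S]

/-- The map `W_n(R) → W_n(S)` induced by a ring homomorphism `R → S`. -/
def wittMap (g : R →+* S) (a : TruncatedWittVector p n R) : TruncatedWittVector p n S :=
  TruncatedWittVector.mk p fun i => g (a.coeff i)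

/-- The Frobenius `F : W_n(R) → W_n(R)` of a ring `R` of characteristic `p`. -/
def wittFrob (a : TruncatedWittVector p n R) : TruncatedWittVector p n R :=
  TruncatedWittVector.mk p fun i => a.coeff i ^ p

end Witt

/-! ### Quasi-`F`-splitting of schemes -/

/-- A scheme `X` of characteristic `p` is `n`-quasi-`F`-split if there is a homomorphism
`φ : F_* W_n 𝒪_X → 𝒪_X` of sheaves of `W_n 𝒪_X`-modules whose composition with
`F : W_n 𝒪_X → F_* W_n 𝒪_X` is the restriction `W_n 𝒪_X → 𝒪_X`.  On an open `U`, a Witt vector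
`a` acts on `F_* W_n 𝒪_X(U) = W_n(𝒪_X(U))` by `F a` and on `𝒪_X(U)` by its zeroth component. -/
def IsQuasiFSplit (p : ℕ) [Fact p.Prime] (X : Scheme) (n : ℕ) : Prop :=
  ∃ (hn : 0 < n) (φ : ∀ U : X.Opens, TruncatedWittVector p n Γ(X, U) →+ Γ(X, U)),
    (∀ (U V : X.Opens) (h : V ≤ U) (a : TruncatedWittVector p n Γ(X, U)),
      φ V (wittMap p (X.presheaf.map (homOfLE h).op).hom a) =
        (X.presheaf.map (homOfLE h).op).hom (φ U a)) ∧
    (∀ (U : X.Opens) (a b : TruncatedWittVector p n Γ(X, U)),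
      φ U (wittFrob p a * b) = a.coeff ⟨0, hn⟩ * φ U b) ∧
    (∀ (U : X.Opens) (a : TruncatedWittVector p n Γ(X, U)),
      φ U (wittFrob p a) = a.coeff ⟨0, hn⟩)

/-- The quasi-`F`-split height of a scheme of characteristic `p`. -/
def quasiFSplitHeight (p : ℕ) [Fact p.Prime] (X : Scheme) : ℕ∞ :=
  leastIndex (IsQuasiFSplit p X)

/-! ### Quasi-`F`-splitting of the pairs `(A, r · div f)` and the non-splitting index -/

section Pair

variable {A : Type*} [CommRing A] [IsDomain A] [UniqueFactorizationMonoid A]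

/-- The order of a nonzero fraction `a` along the prime divisor `div(π)`. -/
def ordAlong (π : A) (a : FractionRing A) : ℤ :=
  (multiplicity π (IsFractionRing.num A a) : ℤ) -
    (multiplicity π (IsFractionRing.den A a : A) : ℤ)

/-- `A(r · div f) = {a ∈ Frac A | a = 0 or div(a) + ⌊r · div f⌋ ≥ 0}`. -/
def divSections (r : ℚ) (f : A) : Set (FractionRing A) :=
  {a | a = 0 ∨ ∀ π : A, Prime π → 0 ≤ ordAlong π a + ⌊r * (multiplicity π f : ℚ)⌋}

/-- `W_n(A)(D)` for `D = r · div f`: the Witt vectors `(a_0, …, a_{n-1}) ∈ W_n(Frac A)`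
with `a_i ∈ A(p^i D)`. -/
def wittDivSections (p n : ℕ) (r : ℚ) (f : A) :
    Set (TruncatedWittVector p n (FractionRing A)) :=
  {a | ∀ i : Fin n, a.coeff i ∈ divSections ((p : ℚ) ^ (i : ℕ) * r) f}

/-- The pair `(A, D)`, `D = r · div f`, is `n`-quasi-`F`-split if there is a homomorphism
`φ : F_* W_n(A)(pD) → A` of `W_n(A)`-modules whose composition with
`F : W_n(A) → F_* W_n(A)(pD)` is the restriction `W_n(A) → A`.  The map `φ` is given as a function
on `W_n(Frac A)` whose values outside the submodule `W_n(A)(pD)` are irrelevant. -/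
def IsQuasiFSplitPair (p : ℕ) [Fact p.Prime] (r : ℚ) (f : A) (n : ℕ) : Prop :=
  ∃ (hn : 0 < n) (φ : TruncatedWittVector p n (FractionRing A) → A),
    (∀ a ∈ wittDivSections p n (p * r) f, ∀ b ∈ wittDivSections p n (p * r) f,
      φ (a + b) = φ a + φ b) ∧
    (∀ a : TruncatedWittVector p n A, ∀ b ∈ wittDivSections p n (p * r) f,
      φ (wittMap p (algebraMap A (FractionRing A)) (wittFrob p a) * b) =
        a.coeff ⟨0, hn⟩ * φ b) ∧
    (∀ a : TruncatedWittVector p n A,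
      φ (wittMap p (algebraMap A (FractionRing A)) (wittFrob p a)) = a.coeff ⟨0, hn⟩)

/-- The non-splitting index: the least `n ≥ 1` for which `(A, (1 - 2 / p ^ n) div f)` is not
`n`-quasi-`F`-split. -/
def nonSplittingIndex (p : ℕ) [Fact p.Prime] (f : A) : ℕ∞ :=
  leastIndex fun n => ¬ IsQuasiFSplitPair p (1 - 2 / (p : ℚ) ^ n) f n

end Pair

/-! ### `Proj` of a weighted hypersurface -/

section Quotient

variable {k A : Type*} [CommRing k] [CommRing A] [Algebra k A]

/-- The grading induced on a quotient ring. -/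
def quotGrading (𝒜 : ℕ → Submodule k A) (I : Ideal A) (i : ℕ) : Submodule k (A ⧸ I) :=
  (𝒜 i).map (Ideal.Quotient.mkₐ k I).toLinearMap

theorem mk_mem_quotGrading {𝒜 : ℕ → Submodule k A} {I : Ideal A} {i : ℕ} {a : A}
    (ha : a ∈ 𝒜 i) : Ideal.Quotient.mk I a ∈ quotGrading 𝒜 I i :=
  ⟨a, ha, rfl⟩

/-- The quotient map in degree `i`. -/
def quotGradingMap (𝒜 : ℕ → Submodule k A) (I : Ideal A) (i : ℕ) :
    𝒜 i →ₗ[k] quotGrading 𝒜 I i :=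
  ((Ideal.Quotient.mkₐ k I).toLinearMap.domRestrict (𝒜 i)).codRestrict _
    fun a => mk_mem_quotGrading a.2

/-- The quotient of a graded algebra by a homogeneous ideal is graded. -/
@[reducible]
def quotGradedAlgebra (𝒜 : ℕ → Submodule k A) [GradedAlgebra 𝒜] (I : Ideal A)
    (hI : I.IsHomogeneous 𝒜) : GradedAlgebra (quotGrading 𝒜 I) where
  one_mem := ⟨1, SetLike.GradedOne.one_mem, rfl⟩
  mul_mem := by
    rintro i j _ _ ⟨a, ha, rfl⟩ ⟨b, hb, rfl⟩
    exact ⟨a * b, SetLike.mul_mem_graded ha hb, rfl⟩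
  toDecomposition := by
    let g : A →ₗ[k] DirectSum ℕ fun i => quotGrading 𝒜 I i :=
      (DFinsupp.mapRange.linearMap (quotGradingMap 𝒜 I)).comp
        (DirectSum.decomposeLinearEquiv 𝒜).toLinearMap
    have hg : ∀ a ∈ I, g a = 0 := by
      intro a ha
      refine DFinsupp.ext fun i => Subtype.ext ?_
      exact Ideal.Quotient.eq_zero_iff_mem.2 (hI i ha)
    let G : (A ⧸ I) →ₗ[k] DirectSum ℕ fun i => quotGrading 𝒜 I i :=
      { toFun := Quotient.lift (fun a => g a) (by
          intro a b hab
          have h1 : a - b ∈ I := (Submodule.quotientRel_def I).1 hab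
          have h2 := hg _ h1
          rw [map_sub, sub_eq_zero] at h2
          exact h2)
        map_add' := by
          rintro ⟨a⟩ ⟨b⟩
          exact map_add g a b
        map_smul' := by
          rintro c ⟨a⟩
          exact map_smul g c a }
    have hof : ∀ (i : ℕ) (a : 𝒜 i), g (a : A) =
        DirectSum.of (fun i => quotGrading 𝒜 I i) i (quotGradingMap 𝒜 I i a) := by
      intro i a
      have : g (a : A) = DFinsupp.mapRange.linearMap (quotGradingMap 𝒜 I)
        (DirectSum.decompose 𝒜 (a : A)) := rfl
      rw [this, DirectSum.decompose_coe]
      exact DFinsupp.mapRange_single (hf := fun i => map_zero (quotGradingMap 𝒜 I i))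
    refine DirectSum.Decomposition.ofLinearMap _ G ?_ ?_
    · refine LinearMap.ext fun x => ?_
      obtain ⟨a, rfl⟩ := Ideal.Quotient.mk_surjective x
      change DirectSum.coeLinearMap (quotGrading 𝒜 I) (g a) = Ideal.Quotient.mk I a
      classical
      induction a using DirectSum.Decomposition.inductionOn 𝒜 with
      | zero => simp
      | homogeneous a =>
        rw [hof]
        exact DirectSum.coeLinearMap_of _ _ _
      | add a b ha hb => rw [map_add, map_add, map_add, ha, hb]
    · refine DirectSum.linearMap_ext k fun i => LinearMap.ext fun y => ?_
      obtain ⟨_, a, ha, rfl⟩ := y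
      change G (DirectSum.coeLinearMap (quotGrading 𝒜 I) (DirectSum.of _ i _)) = _
      rw [DirectSum.coeLinearMap_of]
      exact hof i ⟨a, ha⟩

end Quotient

section Hypersurface

variable {k : Type*} [Field k] {N : ℕ}

theorem isHomogeneous_span (q : Fin (N + 1) → ℕ) {f : MvPolynomial (Fin (N + 1)) k} {d : ℕ}
    (hf : f.IsWeightedHomogeneous q d) :
    letI := weightedGradedAlgebra k q
    (Ideal.span {f}).IsHomogeneous (weightedHomogeneousSubmodule k q) := by
  let _ := weightedGradedAlgebra k q
  refine Ideal.homogeneous_span _ _ ?_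
  rintro x rfl
  exact ⟨d, hf⟩

/-- `Proj (A / fA)` for `A = k[x_0, …, x_N]`, `deg x_i = q_i`, and `f` homogeneous of
degree `d`. -/
def hypersurface (q : Fin (N + 1) → ℕ) (f : MvPolynomial (Fin (N + 1)) k) (d : ℕ)
    (hf : f.IsWeightedHomogeneous q d) : Scheme :=
  letI := weightedGradedAlgebra k q
  letI := quotGradedAlgebra (weightedHomogeneousSubmodule k q) (Ideal.span {f})
    (isHomogeneous_span q hf)
  Proj (quotGrading (weightedHomogeneousSubmodule k q) (Ideal.span {f}))

end Hypersurface

/-! ### The vectors and the matrix attached to a polynomial -/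

section Explicit

variable (p : ℕ) [Fact p.Prime] {k : Type*} [Field k] [CharP k p] [PerfectRing k p] {N m : ℕ}

/-- The generator `u : F_* A → A` dual to `F_* (x_0 ⋯ x_N)^(p-1)` in the monomial basis of `F_* A`:
since `F_* (c x^(pb + r)) = c^(1/p) x^b · F_* x^r`, it sends `F_* (c x^a)` to `c^(1/p) x^b` if
`a = pb + (p-1, …, p-1)`, and to `0` if `a` is not of this form. -/
def traceU (g : MvPolynomial (Fin (N + 1)) k) : MvPolynomial (Fin (N + 1)) k :=
  ∑ a ∈ g.support,
    if ∀ i, a i % p = p - 1 then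
      monomial (a.mapRange (· / p) (Nat.zero_div p)) ((frobeniusEquiv k p).symm (g.coeff a))
    else 0

/-- `Δ(f)`, computed from the list `M` of exponents of monomials; the coefficients
`(1 / p) * multinomial` are integers. -/
def delta (M : Fin m → Fin (N + 1) →₀ ℕ) (f : MvPolynomial (Fin (N + 1)) k) :
    MvPolynomial (Fin (N + 1)) k :=
  ∑ β ∈ (Finset.univ.piAntidiag p : Finset (Fin m → ℕ)) with ∀ i, β i ≤ p - 1,
    ((Nat.multinomial Finset.univ β / p : ℕ) : MvPolynomial (Fin (N + 1)) k) *
      ∏ i, monomial (M i) (f.coeff (M i)) ^ β i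

/-- The column vector `v_f` of coefficients of `f`. -/
def coeffVec (M : Fin m → Fin (N + 1) →₀ ℕ) (f : MvPolynomial (Fin (N + 1)) k) : Fin m → k :=
  fun i => f.coeff (M i)

/-- The row vector `λ` with entries `u(F_*(f^(p-2) M_i))`, which are constants if `f` and the
`M_i` have degree `d = q_0 + ⋯ + q_N`. -/
def lambdaVec (M : Fin m → Fin (N + 1) →₀ ℕ) (f : MvPolynomial (Fin (N + 1)) k) : Fin m → k :=
  fun i => (traceU p (f ^ (p - 2) * monomial (M i) 1)).coeff 0

/-- The matrix `T` of the `k`-linear map `F_* V → V`, `F_* h ↦ u(F_*(Δ(f) f^(p-2) h))`: its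
`i`-th column contains the coefficients of the image of `F_* M_i`. -/
def matT (M : Fin m → Fin (N + 1) →₀ ℕ) (f : MvPolynomial (Fin (N + 1)) k) :
    Matrix (Fin m) (Fin m) k :=
  Matrix.of fun j i =>
    (traceU p (delta p M f * f ^ (p - 2) * monomial (M i) 1)).coeff (M j)

/-- The row vectors `R_1 = F(λ)`, `R_{n+1} = F(R_n T)`, where `F` raises all entries to the `p`-th
power; the value at `0` is not used. -/
def rowR (M : Fin m → Fin (N + 1) →₀ ℕ) (f : MvPolynomial (Fin (N + 1)) k) : ℕ → Fin m → k
  | 0 => 0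
  | 1 => fun i => lambdaVec p M f i ^ p
  | n + 2 => fun i => (Matrix.vecMul (rowR M f (n + 1)) (matT p M f)) i ^ p

/-- The matrix with rows `R_1, …, R_n`. -/
def matR (M : Fin m → Fin (N + 1) →₀ ℕ) (f : MvPolynomial (Fin (N + 1)) k) (n : ℕ) :
    Matrix (Fin n) (Fin m) k :=
  Matrix.of fun i => rowR p M f (i + 1)

end Explicit

end QFS

end

open MvPolynomial AlgebraicGeometry CategoryTheory Opposite
noncomputable section
namespace QFS

/-! ### Witt vectors with prescribed components -/

section WittComponents

open WittVector

variable {p : ℕ} [Fact p.Prime] {R : Type*} [CommRing R]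

/-! Write ξ = x_0 ⋯ x_N and T h = u(Δ(f) f^(p-2) h). Everything is governed by the pairing of R_n
with coefficient vectors: R_n v_c is the p^n-th power of the constant u(f^(p-2) T^(n-1) c)
(`rowR_dotProduct_coeffVec`). By `leastIndex_eq`, both equalities reduce to constructing or
obstructing a splitting at length n+1, knowing that the right-hand condition failed at all smaller
lengths.

Origin of Δ. In W(A) write [f] = f~ + V D, where f~ is the sum of the Teichmüller lifts of the terms
of f. Then D agrees with Dt = (f~^p - F f~)/p up to [f]^(p-1) V D and multiples of p
(`exists_eq_add_teichmuller_pow_mul_verschiebung`), and the zeroth component of Dt is Δ(f).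

Construction. For c of degree d, `wittForm` is a form Ψ on W_n(A). It is additive and F-semilinear
as soon as u(f^(p-2) T^j c) = 0 for j < n-1, that is, R_l v_c = 0 for l < n, and Ψ(1) = u(f^(p-2)
T^(n-1) c). By `dvd_wittForm` it sends to fA every Witt vector whose components lie in fA, the last
one in (f^2 : c). Taking c = f, a multiple of Ψ descends to A/fA, extends to localizations and glues
to a splitting of X (`isQuasiFSplit_proj_of_form`). If the rows R_1, …, R_n are independent, some c
is killed by R_1, …, R_(n-1) but not by R_n, and a ↦ Ψ([f]^p a)/f, normalized, splits the pair
(`isQuasiFSplitPair_of_form`); for n > 1 this also uses that f is squarefree, which the independence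
of R_1 and R_2 forces.

Obstruction. Put f' = f/ξ, a Laurent polynomial of degree zero. Iterating
`exists_teichmuller_pow_mul_eq` gives F[f'] = ± V^j([f']^p g_j) up to error terms: p times a Witt
vector divisible by f', and Witt vectors whose components are multiples of f' by Laurent polynomials
of positive exponent in some x_i. The step from j to j+1 needs the constant coefficient of f'^(p-1)
g_j to vanish. That coefficient is R_(j+1) v_f, since R_(j+1) consists of the coefficients of
f'^(p-2) g_j at ξ/M_i (`coeff_coreSeq`).

If R_(n+1) is a combination of the earlier rows, F[f'] is itself an error term of length n+1
(`frobenius_teichmuller_shiftPoly_mem`). Clearing denominators and applying a splitting of the pair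
puts ξ^L into the ideal of the x_i^(L+1), which is impossible (`prod_X_pow_ne_sum`): the class of
1/ξ in top local cohomology is nonzero.

If only R_l v_f = 0 for l ≤ n, then F[f'] is a sum, in length n, of parts that vanish on X over the
charts where all variables but one are inverted. Decomposing [f'] along these charts and applying a
splitting of X shows that f' is a Čech coboundary plus multiples of f, and the same contradiction
results (`not_isQuasiFSplit_proj`). -/

theorem exists_eq_teichmuller_add_verschiebung (x : WittVector p R) :
    ∃ y, x = teichmuller p (x.coeff 0) + verschiebung y := by
  refine ⟨x.shift 1, ?_⟩
  ext t
  rw [coeff_add_of_disjoint]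
  · rcases t with _ | t
    · simp [teichmuller_coeff_zero]
    · simp [teichmuller_coeff_pos, verschiebung_coeff_succ, shift_coeff, add_comm]
  · rintro (_ | t)
    · exact .inr (by simp)
    · exact .inl (teichmuller_coeff_pos _ _ _ t.succ_pos)

theorem exists_eq_add_verschiebung {x y : WittVector p R} (h : x.coeff 0 = y.coeff 0) :
    ∃ z, x = y + verschiebung z := by
  obtain ⟨x', hx⟩ := exists_eq_teichmuller_add_verschiebung x
  obtain ⟨y', hy⟩ := exists_eq_teichmuller_add_verschiebung y
  refine ⟨x' - y', ?_⟩
  rw [hx, hy, map_sub, ← h]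
  simp [teichmuller_coeff_zero]

theorem exists_eq_verschiebung {x : WittVector p R} (h : x.coeff 0 = 0) :
    ∃ z, x = verschiebung z := by
  obtain ⟨z, hz⟩ := exists_eq_add_verschiebung (x := x) (y := 0) (by simpa using h)
  exact ⟨z, by simpa using hz⟩

theorem coeff_teichmuller_add_verschiebung (a : R) (y : WittVector p R) (t : ℕ) :
    (teichmuller p a + verschiebung y).coeff (t + 1) = y.coeff t := by
  rw [coeff_add_of_disjoint]
  · simp [teichmuller_coeff_pos, verschiebung_coeff_succ]
  · rintro (_ | t)
    · exact .inr (by simp)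
    · exact .inl (teichmuller_coeff_pos _ _ _ t.succ_pos)

theorem add_coeff_zero (x y : WittVector p R) : (x + y).coeff 0 = x.coeff 0 + y.coeff 0 :=
  map_add WittVector.constantCoeff x y

theorem mul_verschiebung (x y : WittVector p R) :
    x * verschiebung y = verschiebung (frobenius x * y) := by
  rw [mul_comm, ← verschiebung_mul_frobenius, mul_comm]

variable [CharP R p]

theorem frobenius_teichmuller (a : R) :
    frobenius (teichmuller p a) = teichmuller p a ^ p := by
  rw [← map_pow]
  ext t
  rw [coeff_frobenius_charP]
  rcases t with _ | t
  · rw [teichmuller_coeff_zero, teichmuller_coeff_zero]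
  · rw [teichmuller_coeff_pos _ _ _ t.succ_pos, teichmuller_coeff_pos _ _ _ t.succ_pos,
      zero_pow (Fact.out : p.Prime).ne_zero]

theorem teichmuller_mul_coeff (a : R) (y : WittVector p R) (t : ℕ) :
    (teichmuller p a * y).coeff t = a ^ p ^ t * y.coeff t := by
  induction t generalizing a y with
  | zero => simp [mul_coeff_zero, teichmuller_coeff_zero]
  | succ t ih =>
    obtain ⟨z, hz⟩ := exists_eq_teichmuller_add_verschiebung y
    rw [hz, mul_add, ← map_mul, mul_verschiebung, coeff_teichmuller_add_verschiebung,
      coeff_teichmuller_add_verschiebung, frobenius_teichmuller, ← map_pow, ih, ← pow_mul,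
      pow_succ']

theorem verschiebung_frobenius' (x : WittVector p R) :
    verschiebung (frobenius x) = p * x := by
  rw [verschiebung_frobenius, mul_comm]

variable {k : Type*} [CommRing k] [Algebra k R]

/-- The polynomials whose `i`-th coefficient lies in `J ^ i`. -/
def reesSubring (J : Submodule k R) : Subring (Polynomial R) where
  carrier := {P | ∀ i, P.coeff i ∈ J ^ i}
  zero_mem' := by intro i; simp
  one_mem' := by
    intro i
    rw [Polynomial.coeff_one]
    split_ifs with h
    · subst h; exact Submodule.one_le.1 le_rfl
    · simp
  add_mem' := by
    intro P Q hP hQ i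
    rw [Polynomial.coeff_add]
    exact add_mem (hP i) (hQ i)
  neg_mem' := by
    intro P hP i
    rw [Polynomial.coeff_neg]
    exact neg_mem (hP i)
  mul_mem' := by
    intro P Q hP hQ i
    rw [Polynomial.coeff_mul]
    refine sum_mem fun x hx => ?_
    rw [← Finset.HasAntidiagonal.mem_antidiagonal.1 hx, pow_add]
    exact Submodule.mul_mem_mul (hP _) (hQ _)

/-- Witt vector addition is homogeneous: multiplying by [X] scales the t-th component by X^(p^t).
Computing [aX] + [bX] inside the Rees ring therefore exhibits the component as the
X^(p^t)-coefficient of an element of that ring. -/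
theorem coeff_teichmuller_add_teichmuller_mem {J : Submodule k R} {a b : R} (ha : a ∈ J)
    (hb : b ∈ J) (t : ℕ) : (teichmuller p a + teichmuller p b).coeff t ∈ J ^ p ^ t := by
  have key : ∀ c ∈ J, Polynomial.X * Polynomial.C c ∈ reesSubring J := by
    intro c hc i
    rw [mul_comm, Polynomial.coeff_C_mul_X]
    split_ifs with h
    · subst h; simpa using hc
    · simp
  have h1 : WittVector.map (reesSubring J).subtype
      (teichmuller p ⟨_, key a ha⟩ + teichmuller p ⟨_, key b hb⟩) =
      teichmuller p Polynomial.X *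
        WittVector.map Polynomial.C (teichmuller p a + teichmuller p b) := by
    simp only [map_add, map_teichmuller, mul_add, ← map_mul]
    rfl
  have h2 := congrArg (fun x => x.coeff t) h1
  simp only [map_coeff, teichmuller_mul_coeff] at h2
  have h3 := (((teichmuller p ⟨_, key a ha⟩ +
    teichmuller p ⟨_, key b hb⟩ : WittVector p (reesSubring J))).coeff t).2 (p ^ t)
  rw [Subring.subtype_apply] at h2
  rw [h2] at h3
  simpa [Polynomial.coeff_X_pow_mul'] using h3

/-- A sequence of submodules is admissible if the `p`-fold products of elements of each of them
lie in the next one. -/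
def Admissible (p : ℕ) (J : ℕ → Submodule k R) : Prop := ∀ t, J t ^ p ≤ J (t + 1)

theorem Admissible.tail {J : ℕ → Submodule k R} (hJ : Admissible p J) :
    Admissible p fun t => J (t + 1) := fun t => hJ (t + 1)

theorem Admissible.pow_le {J : ℕ → Submodule k R} (hJ : Admissible p J) (t : ℕ) :
    J 0 ^ p ^ t ≤ J t := by
  induction t with
  | zero => simp
  | succ t ih =>
    rw [pow_succ, pow_mul]
    exact (pow_le_pow_left' ih p).trans (hJ t)

/-- Split off Teichmüller parts. The carry of [x_0] + [y_0] has components in J_0^(p^t) ≤ J_t, and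
the two tails are governed by the shifted sequence, which is again admissible. -/
theorem add_coeff_mem {J : ℕ → Submodule k R} (hJ : Admissible p J) {x y : WittVector p R}
    (t : ℕ) (hx : ∀ s ≤ t, x.coeff s ∈ J s) (hy : ∀ s ≤ t, y.coeff s ∈ J s) :
    (x + y).coeff t ∈ J t := by
  induction t using Nat.strong_induction_on generalizing J x y with
  | _ t ih =>
  rcases t with _ | t
  · rw [add_coeff_zero]
    exact add_mem (hx 0 le_rfl) (hy 0 le_rfl)
  · obtain ⟨x', hx'⟩ := exists_eq_teichmuller_add_verschiebung x
    obtain ⟨y', hy'⟩ := exists_eq_teichmuller_add_verschiebung y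
    obtain ⟨e, he⟩ := exists_eq_teichmuller_add_verschiebung
      (teichmuller p (x.coeff 0) + teichmuller p (y.coeff 0))
    have e1 : x + y = teichmuller p ((teichmuller p (x.coeff 0) +
        teichmuller p (y.coeff 0)).coeff 0) + verschiebung (e + (x' + y')) := by
      rw [map_add, ← add_assoc, ← he, map_add]
      conv_lhs => rw [hx', hy']
      ring
    have hx1 : ∀ s ≤ t, x'.coeff s ∈ J (s + 1) := fun s hs => by
      have := hx (s + 1) (by omega)
      rwa [hx', coeff_teichmuller_add_verschiebung] at this
    have hy1 : ∀ s ≤ t, y'.coeff s ∈ J (s + 1) := fun s hs => by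
      have := hy (s + 1) (by omega)
      rwa [hy', coeff_teichmuller_add_verschiebung] at this
    have he1 : ∀ s ≤ t, e.coeff s ∈ J (s + 1) := fun s hs => by
      have := coeff_teichmuller_add_teichmuller_mem (p := p) (hx 0 (by omega))
        (hy 0 (by omega)) (s + 1)
      rw [he, coeff_teichmuller_add_verschiebung] at this
      exact hJ.pow_le _ this
    rw [e1, coeff_teichmuller_add_verschiebung]
    exact ih t (by omega) hJ.tail he1 fun s hs => ih s (by omega) hJ.tail
      (fun r hr => hx1 r (by omega)) fun r hr => hy1 r (by omega)

theorem mul_coeff_mem {J J' J'' : ℕ → Submodule k R} (hJ : Admissible p J)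
    (hJ' : Admissible p J') (hJ'' : Admissible p J'') (h : ∀ t, J t * J' t ≤ J'' t)
    {x y : WittVector p R} (t : ℕ) (hx : ∀ s ≤ t, x.coeff s ∈ J s)
    (hy : ∀ s ≤ t, y.coeff s ∈ J' s) : (x * y).coeff t ∈ J'' t := by
  induction t using Nat.strong_induction_on generalizing J J' J'' x y with
  | _ t ih =>
  obtain ⟨x', hx'⟩ := exists_eq_teichmuller_add_verschiebung x
  have e : x * y = teichmuller p (x.coeff 0) * y + verschiebung (x' * frobenius y) := by
    conv_lhs => rw [hx']
    rw [add_mul, mul_comm (verschiebung x'), mul_verschiebung, mul_comm x']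
  rw [e]
  refine add_coeff_mem hJ'' t (fun s hs => ?_) fun s hs => ?_
  · rw [teichmuller_mul_coeff]
    exact h s (Submodule.mul_mem_mul
      (hJ.pow_le s (Submodule.pow_mem_pow _ (hx 0 (by omega)) _)) (hy s hs))
  · rcases s with _ | s
    · simp
    · rw [verschiebung_coeff_succ]
      refine ih s (by omega) hJ.tail hJ'.tail hJ''.tail (fun t => h (t + 1))
        (fun r hr => ?_) fun r hr => ?_
      · have := hx (r + 1) (by omega)
        rwa [hx', coeff_teichmuller_add_verschiebung] at this
      · rw [coeff_frobenius_charP]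
        exact hJ' r (Submodule.pow_mem_pow _ (hy r (by omega)) _)

theorem admissible_const_one : Admissible p (fun _ => (1 : Submodule k R)) := fun _ => by simp

/-- The additive subgroup of Witt vectors whose components lie in an admissible sequence of
submodules. -/
def wittSubgroup (J : ℕ → Submodule k R) (hJ : Admissible p J) : AddSubgroup (WittVector p R) where
  carrier := {x | ∀ t, x.coeff t ∈ J t}
  zero_mem' := fun t => by simp
  add_mem' := fun hx hy t => add_coeff_mem hJ t (fun s _ => hx s) fun s _ => hy s
  neg_mem' := by
    intro x hx t
    -- Negation is not componentwise for p = 2, but the components of -1 come from k, so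
    -- multiplication by -1 preserves the condition.
    have h1 : ∀ t, (-1 : WittVector p R).coeff t ∈ (1 : Submodule k R) := by
      intro t
      have : (-1 : WittVector p R) = WittVector.map (algebraMap k R) (-1) := by simp
      rw [this, map_coeff]
      exact Submodule.algebraMap_mem _
    rw [← neg_one_mul]
    exact mul_coeff_mem admissible_const_one hJ hJ (fun t => by simp) t
      (fun s _ => h1 s) fun s _ => hx s

theorem mem_wittSubgroup {J : ℕ → Submodule k R} {hJ : Admissible p J} {x : WittVector p R} :
    x ∈ wittSubgroup J hJ ↔ ∀ t, x.coeff t ∈ J t := Iff.rfl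

theorem mul_mem_wittSubgroup {J J' J'' : ℕ → Submodule k R} {hJ : Admissible p J}
    {hJ' : Admissible p J'} {hJ'' : Admissible p J''} (h : ∀ t, J t * J' t ≤ J'' t)
    {x y : WittVector p R} (hx : x ∈ wittSubgroup J hJ) (hy : y ∈ wittSubgroup J' hJ') :
    x * y ∈ wittSubgroup J'' hJ'' :=
  fun t => mul_coeff_mem hJ hJ' hJ'' h t (fun s _ => hx s) fun s _ => hy s

theorem map_mul_mem_wittSubgroup {J : ℕ → Submodule k R} {hJ : Admissible p J}
    (w : WittVector p k) {x : WittVector p R} (hx : x ∈ wittSubgroup J hJ) :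
    WittVector.map (algebraMap k R) w * x ∈ wittSubgroup J hJ :=
  mul_mem_wittSubgroup (hJ := admissible_const_one) (fun t => by simp)
    (fun t => by rw [map_coeff]; exact Submodule.algebraMap_mem _) hx

end WittComponents
end QFS
end

open MvPolynomial AlgebraicGeometry CategoryTheory Opposite
noncomputable section
namespace QFS

/-! ### Expansion of a Teichmüller lift -/

section Expansion

open WittVector

/-- Separates the linear term in b from the rest. It is applied with b = ± V y, where b^2 is itself
divisible by p, so that the third summand lies in p^2 a. -/
theorem exists_add_pow_prime {S : Type*} [CommRing S] {p : ℕ} (hp : p.Prime) (a b : S) :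
    ∃ c, (a + b) ^ p = a ^ p + p * a ^ (p - 1) * b + p * a * b ^ 2 * c + b ^ p := by
  have h := add_pow_prime_eq hp a b
  obtain ⟨q, rfl⟩ : ∃ q, p = q + 2 := ⟨p - 2, by have := hp.two_le; omega⟩
  have hs : Finset.Ioo 0 (q + 2) = insert (q + 1) (Finset.Ioo 0 (q + 1)) := by
    ext i; simp; omega
  have hc : ∃ c, ∑ i ∈ Finset.Ioo 0 (q + 1),
      a ^ (i - 1) * b ^ (q + 2 - i - 1) * ↑((q + 2).choose i / (q + 2)) = b * c := by
    refine Finset.dvd_sum fun i hi => ?_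
    have hi' := Finset.mem_Ioo.1 hi
    obtain ⟨e, he⟩ : ∃ e, q + 2 - i - 1 = e + 1 := ⟨q + 2 - i - 2, by omega⟩
    exact ⟨a ^ (i - 1) * b ^ e * ↑((q + 2).choose i / (q + 2)), by rw [he]; ring⟩
  obtain ⟨c, hc⟩ := hc
  refine ⟨c, ?_⟩
  rw [h, hs, Finset.sum_insert (by simp), hc]
  have h1 : (q + 2).choose (q + 1) / (q + 2) = 1 := by
    rw [Nat.choose_succ_self_right, Nat.div_self (by omega)]
  rw [h1]
  have h2 : q + 2 - (q + 1) - 1 = 0 := by omega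
  rw [h2]
  simp only [Nat.add_sub_cancel, Nat.cast_one, pow_zero, mul_one]
  have : q + 2 - 1 = q + 1 := by omega
  rw [this]
  ring

variable {p : ℕ} [Fact p.Prime] {R : Type*} [CommRing R]

theorem verschiebung_p_mul (x : WittVector p R) : verschiebung ((p : WittVector p R) * x) = p * verschiebung x := by
  rw [← nsmul_eq_mul, map_nsmul, nsmul_eq_mul]

theorem verschiebung_mul_verschiebung (x y : WittVector p R) :
    verschiebung x * verschiebung y = p * verschiebung (x * y) := by
  rw [mul_verschiebung, frobenius_verschiebung, ← verschiebung_p_mul]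
  congr 1
  ring

theorem verschiebung_pow (x : WittVector p R) {n : ℕ} (hn : n ≠ 0) :
    verschiebung x ^ n = p ^ (n - 1) * verschiebung (x ^ n) := by
  obtain ⟨n, rfl⟩ := Nat.exists_eq_succ_of_ne_zero hn
  simp only [Nat.succ_eq_add_one, Nat.add_sub_cancel]
  clear hn
  induction n with
  | zero => simp
  | succ n ih =>
    rw [pow_succ, ih, mul_assoc, verschiebung_mul_verschiebung, ← pow_succ, ← mul_assoc,
      ← pow_succ]

variable [CharP R p]

theorem exists_frobenius_eq_pow_add (x : WittVector p R) :
    ∃ y, frobenius x = x ^ p + p * y := by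
  obtain ⟨x', hx⟩ := exists_eq_teichmuller_add_verschiebung x
  set a := teichmuller p (x.coeff 0)
  obtain ⟨c, hc⟩ := exists_add_pow_prime (Fact.out : p.Prime) a (verschiebung x')
  have hF : frobenius x = a ^ p + p * x' := by
    rw [hx, map_add, frobenius_teichmuller, frobenius_verschiebung, mul_comm x']
  have hpp : p - 1 = p - 2 + 1 := by have := (Fact.out : p.Prime).two_le; omega
  have hV : ∃ e, verschiebung x' ^ p = p * e := by
    refine ⟨p ^ (p - 2) * verschiebung (x' ^ p), ?_⟩
    rw [verschiebung_pow x' (Fact.out : p.Prime).ne_zero, hpp, pow_succ']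
    ring
  obtain ⟨e, he⟩ := hV
  refine ⟨x' - a ^ (p - 1) * verschiebung x' - a * verschiebung x' ^ 2 * c - e, ?_⟩
  rw [hF]
  conv_rhs => rw [hx, hc, he]
  ring

/-- Since F V = p, one has p D = [f]^p - F(ft). Subtracting p Dt = ft^p - F(ft) leaves [f]^p - ([f]
- V D)^p, which equals p [f]^(p-1) V D modulo p^2. Now p may be cancelled, as W(R) is p-torsion
free. -/
theorem exists_eq_add_teichmuller_pow_mul_verschiebung [IsDomain R] {f : R}
    {ft D Dt : WittVector p R} (h : teichmuller p f = ft + verschiebung D)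
    (hDt : (p : WittVector p R) * Dt = ft ^ p - frobenius ft) :
    ∃ E, D = Dt + teichmuller p f ^ (p - 1) * verschiebung D + p * E := by
  set a := teichmuller p f with ha
  obtain ⟨c, hc⟩ := exists_add_pow_prime (Fact.out : p.Prime) a (-verschiebung D)
  obtain ⟨y, hy⟩ := exists_frobenius_eq_pow_add D
  have hft : ft = a + -verschiebung D := by rw [h]; ring
  have hF : frobenius ft = a ^ p - p * D := by
    rw [hft, map_add, map_neg, frobenius_teichmuller, frobenius_verschiebung]; ring
  have hpp : p - 1 = p - 2 + 1 := by have := (Fact.out : p.Prime).two_le; omega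
  -- For p = 2 the factor p^(p-1) provides only one p; the other comes from V(D^p), which is V F D =
  -- p D up to a multiple of p.
  have hV : ∃ e, (-verschiebung D) ^ p = (p : WittVector p R) * (p * e) := by
    refine ⟨(-1) ^ p * (p ^ (p - 2) * (D - verschiebung y)), ?_⟩
    have e2 : verschiebung (D ^ p) = p * (D - verschiebung y) := by
      have : D ^ p = frobenius D - p * y := by rw [hy]; ring
      rw [this, map_sub, verschiebung_frobenius', verschiebung_p_mul]
      ring
    rw [neg_pow, verschiebung_pow D (Fact.out : p.Prime).ne_zero, e2, hpp, pow_succ']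
    ring
  obtain ⟨e, he⟩ := hV
  have h2 : (-verschiebung D) ^ 2 = (p : WittVector p R) * verschiebung (D ^ 2) := by
    rw [neg_sq, sq, verschiebung_mul_verschiebung, sq]
  refine ⟨-(a * verschiebung (D ^ 2) * c + e), ?_⟩
  have hp0 : (p : WittVector p R) ≠ 0 := p_nonzero p R
  apply mul_left_cancel₀ hp0
  have hD : (p : WittVector p R) * D = a ^ p - frobenius ft := by rw [hF]; ring
  have : ft ^ p = a ^ p + (p : WittVector p R) * a ^ (p - 1) * (-verschiebung D) +
      (p : WittVector p R) * a * ((p : WittVector p R) * verschiebung (D ^ 2)) * c +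
        (p : WittVector p R) * ((p : WittVector p R) * e) := by
    rw [hft, hc, h2, he]
  rw [mul_add, mul_add, hDt, this, hD]
  ring

theorem teichmuller_pow_mul_verschiebung (f : R) (n : ℕ) (y : WittVector p R) :
    teichmuller p f ^ n * verschiebung y = verschiebung (teichmuller p f ^ (p * n) * y) := by
  rw [mul_verschiebung, map_pow, frobenius_teichmuller, pow_mul]

theorem exists_teichmuller_pow_pred_mul_eq {f : R} {ft D : WittVector p R}
    (h : teichmuller p f = ft + verschiebung D) (g : WittVector p R) :
    ∃ z, teichmuller p f ^ (p - 1) * g = ft ^ (p - 1) * g + verschiebung z := by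
  obtain ⟨c, hc⟩ := sub_dvd_pow_sub_pow (teichmuller p f) ft (p - 1)
  have hV : teichmuller p f - ft = verschiebung D := by rw [h]; ring
  rw [hV] at hc
  refine ⟨frobenius (c * g) * D, ?_⟩
  rw [← mul_verschiebung, ← sub_eq_iff_eq_add', ← sub_mul, hc]
  ring

/-- Splitting off the leading term of `[f] ^ p * g`, up to multiples of `p [f]`. -/
theorem exists_teichmuller_pow_mul_eq [IsDomain R] {f : R}
    {ft D Dt : WittVector p R} (h : teichmuller p f = ft + verschiebung D)
    (hDt : (p : WittVector p R) * Dt = ft ^ p - frobenius ft) (g : WittVector p R) :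
    ∃ E, teichmuller p f ^ p * g = teichmuller p f * (ft ^ (p - 1) * g) -
      verschiebung (teichmuller p f ^ p * (frobenius ft ^ (p - 2) * Dt * frobenius g)) -
      verschiebung (verschiebung (teichmuller p f ^ (p * (p - 1)) * D *
        frobenius (frobenius (teichmuller p f ^ (p - 1) * g)))) +
      p * (teichmuller p f * E) := by
  obtain ⟨E₁, hE₁⟩ := exists_eq_add_teichmuller_pow_mul_verschiebung h hDt
  set a := teichmuller p f with ha
  have hft : ft = a + -verschiebung D := by rw [h]; ring
  have hFa : frobenius a = a ^ p := frobenius_teichmuller f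
  have h2p := (Fact.out : p.Prime).two_le
  obtain ⟨k, hk⟩ := Polynomial.powAddExpansion a (-verschiebung D) (p - 1)
  have h2 : (-verschiebung D) ^ 2 = (p : WittVector p R) * verschiebung (D ^ 2) := by
    rw [neg_sq, sq, verschiebung_mul_verschiebung, sq]
  rw [← hft, h2] at hk
  have hpc : ((p - 1 : ℕ) : WittVector p R) = p - 1 := by
    rw [Nat.cast_sub (Fact.out : p.Prime).one_le, Nat.cast_one]
  have hp1 : p - 1 - 1 = p - 2 := by omega
  rw [hpc, hp1] at hk
  obtain ⟨E₂, hE₂⟩ : ∃ E₂, (a ^ p) ^ (p - 2) = frobenius ft ^ (p - 2) + p * E₂ := by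
    have hF : a ^ p - frobenius ft = p * D := by
      rw [hft, map_add, map_neg, frobenius_teichmuller, frobenius_verschiebung]; ring
    obtain ⟨c, hc⟩ := sub_dvd_pow_sub_pow (a ^ p) (frobenius ft) (p - 2)
    rw [hF] at hc
    exact ⟨D * c, by rw [← sub_eq_iff_eq_add', hc]; ring⟩
  -- First order: expand ft^(p-1) = ([f] - V D)^(p-1), where (V D)^2 = p V(D^2). The coefficient p -
  -- 1 counts as -1, up to a multiple of p [f].
  have hA : a ^ p * g = a * (ft ^ (p - 1) * g) - a ^ (p - 1) * verschiebung D * g +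
      (p : WittVector p R) * (a * (a ^ (p - 2) * verschiebung D * g - k * verschiebung (D ^ 2) * g)) := by
    have e1 : a ^ p = a * a ^ (p - 1) := by rw [← pow_succ']; congr 1; omega
    have e2 : a ^ (p - 1) = a * a ^ (p - 2) := by rw [← pow_succ']; congr 1; omega
    rw [e1, hk, e2]
    ring
  have hB : a ^ (p - 1) * verschiebung D * g =
      verschiebung (a ^ (p * (p - 1)) * D * frobenius g) := by
    rw [teichmuller_pow_mul_verschiebung, mul_comm, mul_verschiebung]
    congr 1
    ring
  -- Second order: replace D by Dt + [f]^(p-1) V D + p E. The middle summand becomes the doubly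
  -- shifted term.
  have hC : a ^ (p * (p - 1)) * D * frobenius g =
      a ^ p * (frobenius ft ^ (p - 2) * Dt * frobenius g) +
      verschiebung (a ^ (p * (p - 1)) * D * frobenius (frobenius (a ^ (p - 1) * g))) +
      (p : WittVector p R) * (a ^ p * (E₂ * Dt * frobenius g) + a ^ (p * (p - 1)) * (E₁ * frobenius g)) := by
    have e1 : a ^ (p * (p - 1)) = a ^ p * (a ^ p) ^ (p - 2) := by
      rw [← pow_mul, ← pow_add]
      congr 1
      have : p - 1 = p - 2 + 1 := by omega
      rw [this]
      ring
    have e2 : a ^ (p * (p - 1)) * (a ^ (p - 1) * verschiebung D) * frobenius g =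
        verschiebung (a ^ (p * (p - 1)) * D * frobenius (frobenius (a ^ (p - 1) * g))) := by
      have e3 : a ^ (p * (p - 1)) * (a ^ (p - 1) * verschiebung D) * frobenius g =
          (a ^ (p * (p - 1)) * a ^ (p - 1) * frobenius g) * verschiebung D := by ring
      rw [e3, mul_verschiebung]
      congr 1
      simp only [map_mul, map_pow, hFa]
      have e4 : ((a ^ p) ^ p) ^ (p - 1) = (a ^ p) ^ (p * (p - 1)) := by
        rw [← pow_mul (a ^ p)]
      have e5 : (a ^ p) ^ (p - 1) = a ^ (p * (p - 1)) := by rw [← pow_mul]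
      rw [e4, e5]
      ring
    rw [← e2]
    conv_lhs => rw [hE₁, mul_add, mul_add, add_mul, add_mul]
    have e6 : a ^ (p * (p - 1)) * Dt * frobenius g =
        a ^ p * (frobenius ft ^ (p - 2) * Dt * frobenius g) +
        (p : WittVector p R) * (a ^ p * (E₂ * Dt * frobenius g)) := by
      rw [e1, hE₂]; ring
    rw [e6]
    ring
  have hD : verschiebung ((p : WittVector p R) * (a ^ p * (E₂ * Dt * frobenius g) +
      a ^ (p * (p - 1)) * (E₁ * frobenius g))) =
      (p : WittVector p R) * (a * (verschiebung (E₂ * Dt * frobenius g) +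
        a ^ (p - 2) * verschiebung (E₁ * frobenius g))) := by
    rw [verschiebung_p_mul, map_add, ← teichmuller_pow_mul_verschiebung]
    have : a ^ p * (E₂ * Dt * frobenius g) = a ^ (p * 1) * (E₂ * Dt * frobenius g) := by
      rw [mul_one]
    rw [this, ← teichmuller_pow_mul_verschiebung, ← ha]
    have e2 : a ^ (p - 1) = a * a ^ (p - 2) := by rw [← pow_succ']; congr 1; omega
    rw [e2]
    ring
  refine ⟨a ^ (p - 2) * verschiebung D * g - k * verschiebung (D ^ 2) * g -
    (verschiebung (E₂ * Dt * frobenius g) + a ^ (p - 2) * verschiebung (E₁ * frobenius g)), ?_⟩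
  rw [hA, hB, hC, map_add, map_add, hD]
  ring

end Expansion
end QFS
end

open MvPolynomial AlgebraicGeometry CategoryTheory Opposite
noncomputable section
namespace QFS

/-! ### Lifts of elements of monoid algebras to Witt vectors -/

section MonomialLift

open WittVector

variable (p : ℕ) [Fact p.Prime] {k : Type*} [Field k] [CharP k p] {Λ : Type*} [AddCommMonoid Λ]

instance charP_addMonoidAlgebra : CharP (AddMonoidAlgebra k Λ) p :=
  charP_of_injective_algebraMap (algebraMap k (AddMonoidAlgebra k Λ)).injective p

/-- The ring homomorphism `W(k)[Λ] → W(k[Λ])` which sends `x ^ a` to its Teichmüller lift. -/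
def monomialLift : AddMonoidAlgebra (WittVector p k) Λ →+* WittVector p (AddMonoidAlgebra k Λ) :=
  AddMonoidAlgebra.liftNCRingHom
    (WittVector.map (algebraMap k (AddMonoidAlgebra k Λ)))
    ((teichmuller p).comp (AddMonoidAlgebra.of k Λ)) fun _ _ => Commute.all _ _

theorem monomialLift_single (a : Λ) (w : WittVector p k) :
    monomialLift p (AddMonoidAlgebra.single a w) =
      WittVector.map (algebraMap k (AddMonoidAlgebra k Λ)) w *
        teichmuller p (AddMonoidAlgebra.single a 1) := by
  simp [monomialLift]

theorem monomialLift_single_teichmuller (a : Λ) (c : k) :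
    monomialLift p (AddMonoidAlgebra.single a (teichmuller p c)) =
      teichmuller p (AddMonoidAlgebra.single a c) := by
  rw [monomialLift_single, map_teichmuller, ← map_mul]
  simp

theorem monomialLift_coeff_zero (z : AddMonoidAlgebra (WittVector p k) Λ) :
    (monomialLift p z).coeff 0 = AddMonoidAlgebra.mapRingHom Λ WittVector.constantCoeff z := by
  change WittVector.constantCoeff _ = _
  induction z using AddMonoidAlgebra.induction_linear with
  | zero => simp
  | add x y hx hy => rw [map_add, map_add, map_add, hx, hy]
  | single a w =>
    rw [monomialLift_single, map_mul]
    change (algebraMap k (AddMonoidAlgebra k Λ)) (w.coeff 0) * (teichmuller p _).coeff 0 = _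
    rw [teichmuller_coeff_zero]
    simp

theorem exists_frobenius_monomialLift (z : AddMonoidAlgebra (WittVector p k) Λ) :
    ∃ z', frobenius (monomialLift p z) = monomialLift p z' := by
  induction z using AddMonoidAlgebra.induction_linear with
  | zero => exact ⟨0, by simp⟩
  | add x y hx hy =>
    obtain ⟨x', hx⟩ := hx
    obtain ⟨y', hy⟩ := hy
    exact ⟨x' + y', by rw [map_add, map_add, hx, hy, map_add]⟩
  | single a w =>
    refine ⟨AddMonoidAlgebra.single (p • a) (frobenius w), ?_⟩
    rw [monomialLift_single, monomialLift_single, map_mul, frobenius_teichmuller, ← map_pow]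
    congr 1
    · ext t
      simp [coeff_frobenius_charP]
    · congr 1
      simp [AddMonoidAlgebra.single_pow]

/-- The Witt vectors of the form `∑ w_a [x ^ a]`. -/
def liftSubring : Subring (WittVector p (AddMonoidAlgebra k Λ)) := (monomialLift p).range

variable {p}

theorem frobenius_mem_liftSubring {z : WittVector p (AddMonoidAlgebra k Λ)}
    (hz : z ∈ liftSubring p) : frobenius z ∈ liftSubring p := by
  obtain ⟨z, rfl⟩ := hz
  obtain ⟨z', hz'⟩ := exists_frobenius_monomialLift p z
  exact ⟨z', hz'.symm⟩

theorem teichmuller_single_mem_liftSubring (a : Λ) (c : k) :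
    teichmuller p (AddMonoidAlgebra.single a c) ∈ liftSubring p :=
  ⟨_, monomialLift_single_teichmuller p a c⟩

theorem exists_eq_p_mul_of_coeff_zero [PerfectRing k p]
    {w : WittVector p k} (hw : w.coeff 0 = 0) : ∃ w', w = p * w' := by
  obtain ⟨y, hy⟩ := exists_eq_verschiebung hw
  obtain ⟨w', rfl⟩ := (frobenius_bijective p k).2 y
  exact ⟨w', by rw [hy, verschiebung_frobenius']⟩

/-- For perfect k, a Witt vector over k with zeroth component 0 is a multiple of p, and this can be
applied to each coefficient w_a. So two lifts in `liftSubring` of the same element differ by p = V F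
times something, rather than by an arbitrary V. -/
theorem exists_eq_p_mul_of_mem_liftSubring [PerfectRing k p]
    {z : WittVector p (AddMonoidAlgebra k Λ)} (hz : z ∈ liftSubring p) (h0 : z.coeff 0 = 0) :
    ∃ z' ∈ liftSubring p, z = (p : WittVector p (AddMonoidAlgebra k Λ)) * z' := by
  obtain ⟨y, rfl⟩ := hz
  rw [monomialLift_coeff_zero] at h0
  have h1 : ∀ a, ∃ w', y.coeff a = p * w' := fun a => by
    refine exists_eq_p_mul_of_coeff_zero ?_
    have := congrArg (fun b => b.coeff a) h0
    simpa using this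
  choose w hw using h1
  refine ⟨∑ a ∈ y.coeff.support, monomialLift p (AddMonoidAlgebra.single a (w a)),
    sum_mem fun a _ => ⟨_, rfl⟩, ?_⟩
  conv_lhs => rw [← AddMonoidAlgebra.sum_coeff_single y]
  rw [Finsupp.sum, map_sum, Finset.mul_sum]
  refine Finset.sum_congr rfl fun a _ => ?_
  rw [hw a, monomialLift_single, monomialLift_single, map_mul, map_natCast]
  ring

/-- The lift of an element of a monoid algebra obtained by taking the Teichmüller lifts of its
terms. -/
def termwiseLift (p : ℕ) [Fact p.Prime] (b : AddMonoidAlgebra k Λ) :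
    WittVector p (AddMonoidAlgebra k Λ) :=
  ∑ a ∈ b.coeff.support, teichmuller p (AddMonoidAlgebra.single a (b.coeff a))

theorem termwiseLift_mem_liftSubring (b : AddMonoidAlgebra k Λ) :
    termwiseLift p b ∈ liftSubring p :=
  sum_mem fun _ _ => teichmuller_single_mem_liftSubring _ _

theorem sum_teichmuller_coeff_zero {R ι : Type*} [CommRing R] (s : Finset ι) (g : ι → R) :
    (∑ i ∈ s, teichmuller p (g i)).coeff 0 = ∑ i ∈ s, g i := by
  change WittVector.constantCoeff _ = _
  rw [map_sum]
  rfl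

theorem termwiseLift_coeff_zero (b : AddMonoidAlgebra k Λ) : (termwiseLift p b).coeff 0 = b := by
  rw [termwiseLift, sum_teichmuller_coeff_zero]
  exact AddMonoidAlgebra.sum_coeff_single b

theorem exists_delta_lift [PerfectRing k p] {z : WittVector p (AddMonoidAlgebra k Λ)}
    (hz : z ∈ liftSubring p) : ∃ d ∈ liftSubring p,
      z ^ p - frobenius z = (p : WittVector p (AddMonoidAlgebra k Λ)) * d := by
  refine exists_eq_p_mul_of_mem_liftSubring
    (sub_mem (pow_mem hz _) (frobenius_mem_liftSubring hz)) ?_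
  change WittVector.constantCoeff (z ^ p - frobenius z) = 0
  rw [map_sub, map_pow]
  change _ - (frobenius z).coeff 0 = _
  rw [coeff_frobenius_charP]
  exact sub_self _

end MonomialLift

/-! ### The multinomial expansion of a `p`-th power -/

/-- The exponent vectors excluded by β_i ≤ p - 1 are those concentrated in one index, giving the
p-th powers. For the others p divides p! but no β_i!, so the multinomial coefficient is divisible by
p. -/
theorem sum_pow_prime_eq {S : Type*} [CommRing S] {p : ℕ} (hp : p.Prime) {m : ℕ} (y : Fin m → S) :
    (∑ i, y i) ^ p = ∑ i, y i ^ p +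
      p * ∑ β ∈ (Finset.univ.piAntidiag p : Finset (Fin m → ℕ)) with ∀ i, β i ≤ p - 1,
        ((Nat.multinomial Finset.univ β / p : ℕ) : S) * ∏ i, y i ^ β i := by
  classical
  rw [Finset.sum_pow_eq_sum_piAntidiag, ← Finset.sum_filter_add_sum_filter_not _
    (fun β : Fin m → ℕ => ∀ i, β i ≤ p - 1), add_comm, Finset.mul_sum]
  congr 1
  · have hs : ((Finset.univ.piAntidiag p : Finset (Fin m → ℕ)).filter
        fun β => ¬ ∀ i, β i ≤ p - 1) = Finset.univ.image fun i => Pi.single i p := by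
      ext β
      simp only [Finset.mem_filter, Finset.mem_piAntidiag, Finset.mem_univ, implies_true,
        and_true, Finset.mem_image, true_and, not_forall, not_le]
      constructor
      · rintro ⟨hs, i, hi⟩
        refine ⟨i, ?_⟩
        have h1 := Finset.add_sum_erase Finset.univ β (Finset.mem_univ i)
        have h0 := hp.pos
        have hs' : ∑ x, β x = p := hs
        have h2 : β i = p := by omega
        have h3 : ∑ j ∈ Finset.univ.erase i, β j = 0 := by omega
        rw [Finset.sum_eq_zero_iff] at h3
        ext j
        by_cases hj : j = i
        · subst hj; simp [h2]
        · rw [Pi.single_eq_of_ne hj]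
          exact (h3 j (by simp [hj])).symm
      · rintro ⟨i, rfl⟩
        refine ⟨by simp, i, ?_⟩
        have := hp.pos
        simp
        omega
    rw [hs, Finset.sum_image]
    · refine Finset.sum_congr rfl fun i _ => ?_
      have h1 : Nat.multinomial Finset.univ (Pi.single i p : Fin m → ℕ) = 1 := by
        have h := Nat.multinomial_spec Finset.univ (Pi.single i p : Fin m → ℕ)
        have h2 : ∏ j, ((Pi.single i p : Fin m → ℕ) j).factorial = p.factorial := by
          rw [Finset.prod_eq_single i]
          · simp
          · intro j _ hj
            simp [Pi.single_eq_of_ne hj]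
          · simp
        rw [h2, Finset.sum_pi_single' i p Finset.univ, if_pos (Finset.mem_univ i)] at h
        exact Nat.eq_of_mul_eq_mul_left p.factorial_pos (by rw [h, mul_one])
      rw [h1, Finset.prod_eq_single i]
      · simp
      · intro j _ hj
        simp [Pi.single_eq_of_ne hj]
      · simp
    · intro i _ j _ hij
      by_contra hne
      have := congrFun hij i
      simp only [Pi.single_eq_same] at this
      rw [Pi.single_eq_of_ne hne] at this
      exact hp.ne_zero this
  · refine Finset.sum_congr rfl fun β hβ => ?_
    rw [Finset.mem_filter, Finset.mem_piAntidiag] at hβ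
    have hd : p ∣ Nat.multinomial Finset.univ β := by
      have h := Nat.multinomial_spec Finset.univ β
      rw [hβ.1.1] at h
      have h1 : p ∣ (∏ i, (β i).factorial) * Nat.multinomial Finset.univ β := by
        rw [h]
        exact hp.dvd_factorial.2 le_rfl
      refine (hp.dvd_mul.1 h1).resolve_left fun h2 => ?_
      obtain ⟨i, -, hi⟩ := (Prime.dvd_finsetProd_iff hp.prime _).1 h2
      have h3 := hp.dvd_factorial.1 hi
      have h4 := hβ.2 i
      have h5 := hp.pos
      omega
    rw [← mul_assoc, ← Nat.cast_mul, Nat.mul_div_cancel' hd]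

end QFS
end

open MvPolynomial AlgebraicGeometry CategoryTheory Opposite
noncomputable section
namespace QFS

/-! ### The trace -/

section Trace

variable {p : ℕ} [Fact p.Prime] {k : Type*} [Field k] [CharP k p] [PerfectRing k p] {N : ℕ}

/-- The working description of u: additivity, semilinearity and the effect on degrees are all read
off coefficientwise from it. -/
theorem coeff_traceU (g : MvPolynomial (Fin (N + 1)) k) (b : Fin (N + 1) →₀ ℕ) :
    (traceU p g).coeff b = (frobeniusEquiv k p).symm
      (g.coeff (p • b + (p - 1) • Finsupp.equivFunOnFinite.symm fun _ => 1)) := by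
  classical
  have hp := (Fact.out : p.Prime).pos
  set a₀ : Fin (N + 1) →₀ ℕ := p • b + (p - 1) • Finsupp.equivFunOnFinite.symm fun _ => 1
  have h₀ : ∀ i, a₀ i = p * b i + (p - 1) := fun i => by simp [a₀]
  rw [traceU, coeff_sum, Finset.sum_eq_single a₀]
  · rw [if_pos, coeff_monomial, if_pos]
    · ext i
      rw [Finsupp.mapRange_apply, h₀, Nat.mul_add_div hp, Nat.div_eq_of_lt (by omega), add_zero]
    · intro i
      rw [h₀, Nat.mul_add_mod, Nat.mod_eq_of_lt (by omega)]
  · intro a _ ha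
    split_ifs with h
    · rw [coeff_monomial, if_neg]
      rintro rfl
      refine ha (Finsupp.ext fun i => ?_)
      rw [h₀, Finsupp.mapRange_apply, ← h i, Nat.div_add_mod]
    · simp
  · intro h
    rw [notMem_support_iff.1 h]
    split_ifs <;> simp

theorem traceU_add (g h : MvPolynomial (Fin (N + 1)) k) :
    traceU p (g + h) = traceU p g + traceU p h := by
  ext b
  simp [coeff_traceU]

theorem traceU_zero : traceU p (0 : MvPolynomial (Fin (N + 1)) k) = 0 := by
  ext b
  simp [coeff_traceU]

theorem traceU_neg (g : MvPolynomial (Fin (N + 1)) k) : traceU p (-g) = -traceU p g := by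
  ext b
  simp [coeff_traceU]

theorem traceU_sub (g h : MvPolynomial (Fin (N + 1)) k) :
    traceU p (g - h) = traceU p g - traceU p h := by
  ext b
  simp [coeff_traceU]

theorem traceU_pow_mul (g h : MvPolynomial (Fin (N + 1)) k) :
    traceU p (g ^ p * h) = g * traceU p h := by
  have hp := (Fact.out : p.Prime).pos
  induction g using MvPolynomial.induction_on' with
  | add g₁ g₂ h₁ h₂ => rw [add_pow_char, add_mul, traceU_add, h₁, h₂, add_mul]
  | monomial a c =>
    ext b
    rw [monomial_pow, coeff_traceU, coeff_monomial_mul', coeff_monomial_mul']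
    have hle : p • a ≤ p • b + (p - 1) • (Finsupp.equivFunOnFinite.symm fun _ => 1) ↔ a ≤ b := by
      simp only [Finsupp.le_def, Finsupp.add_apply, Finsupp.smul_apply, smul_eq_mul,
        Finsupp.equivFunOnFinite_symm_apply_apply, mul_one]
      refine forall_congr' fun i => ⟨fun h => ?_, fun h => ?_⟩
      · by_contra hlt
        have : p * (b i + 1) ≤ p * a i := Nat.mul_le_mul_left p (by omega)
        rw [mul_add] at this
        omega
      · have := Nat.mul_le_mul_left p h
        omega
    by_cases hab : a ≤ b
    · rw [if_pos (hle.2 hab), if_pos hab, coeff_traceU, map_mul]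
      congr 1
      · rw [map_pow, frobeniusEquiv_symm_pow_p]
      · congr 2
        ext i
        simp only [Finsupp.tsub_apply, Finsupp.add_apply, Finsupp.smul_apply, smul_eq_mul,
          Finsupp.equivFunOnFinite_symm_apply_apply, mul_one]
        have := Nat.mul_le_mul_left p (hab i)
        rw [Nat.mul_sub]
        omega
    · rw [if_neg (fun h => hab (hle.1 h)), if_neg hab, map_zero]

theorem traceU_mem {q : Fin (N + 1) → ℕ} {e : ℕ} {g : MvPolynomial (Fin (N + 1)) k}
    (hg : g.IsWeightedHomogeneous q ((p - 1) * ∑ i, q i + p * e)) :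
    (traceU p g).IsWeightedHomogeneous q e := by
  intro b hb
  rw [coeff_traceU] at hb
  have h1 := hg (fun h => hb (by rw [h, map_zero]))
  rw [map_add, map_nsmul, map_nsmul] at h1
  have h2 : Finsupp.weight q (Finsupp.equivFunOnFinite.symm fun _ => 1) = ∑ i, q i := by
    rw [Finsupp.weight_apply, Finsupp.sum_fintype]
    · simp
    · simp
  rw [h2, smul_eq_mul, smul_eq_mul] at h1
  exact Nat.eq_of_mul_eq_mul_left (Fact.out : p.Prime).pos (by omega)

end Trace

/-! ### Semilinear forms on Witt vectors of polynomial rings -/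

section Form

open WittVector

variable {p : ℕ} [Fact p.Prime] {k : Type*} [Field k] [CharP k p] [PerfectRing k p] {N : ℕ}

variable (p) in
/-- The remainder `b` in the decomposition `a = ∑ [t] + V b`, where `t` runs over the terms of the
zeroth component of `a`. -/
def liftRest (a : WittVector p (MvPolynomial (Fin (N + 1)) k)) :
    WittVector p (MvPolynomial (Fin (N + 1)) k) :=
  (a - termwiseLift p (a.coeff 0)).shift 1

theorem eq_termwiseLift_add (a : WittVector p (MvPolynomial (Fin (N + 1)) k)) :
    a = termwiseLift p (a.coeff 0) + verschiebung (liftRest p a) := by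
  have h0 : (a - termwiseLift p (a.coeff 0)).coeff 0 = 0 := by
    change WittVector.constantCoeff (a - termwiseLift p (a.coeff 0)) = 0
    rw [map_sub]
    change a.coeff 0 - (termwiseLift p (a.coeff 0)).coeff 0 = 0
    rw [termwiseLift_coeff_zero, sub_self]
  obtain ⟨z, hz⟩ := exists_eq_verschiebung h0
  have : liftRest p a = z := by
    rw [liftRest, hz]
    refine WittVector.ext fun t => ?_
    rw [shift_coeff, add_comm 1 t, verschiebung_coeff_succ]
  rw [this, ← hz]
  ring

/-- z and the termwise lift of z_0 differ by p y = V F y. Hence a form built recursively on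
`liftRest` is additive only if it ignores Frobenius images. -/
theorem exists_liftRest_eq {z b : WittVector p (MvPolynomial (Fin (N + 1)) k)}
    (hz : z ∈ liftSubring p) :
    ∃ y, liftRest p (z + verschiebung b) = b + frobenius y := by
  have h0 : (z + verschiebung b).coeff 0 = z.coeff 0 := by
    rw [add_coeff_zero, verschiebung_coeff_zero, add_zero]
  obtain ⟨y, -, hy⟩ := exists_eq_p_mul_of_mem_liftSubring
    (sub_mem hz (termwiseLift_mem_liftSubring (p := p) (z.coeff 0))) (by
      change WittVector.constantCoeff (z - termwiseLift p (z.coeff 0)) = 0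
      rw [map_sub]
      change z.coeff 0 - (termwiseLift p (z.coeff 0)).coeff 0 = 0
      rw [termwiseLift_coeff_zero, sub_self])
  refine ⟨y, verschiebung_injective p _ ?_⟩
  have h1 := eq_termwiseLift_add (z + verschiebung b)
  rw [h0] at h1
  rw [map_add, verschiebung_frobenius', ← hy]
  linear_combination -h1

variable (p) in
/-- The form `a ↦ ∑ ± u ^ (i + 1) (f ^ (p ^ (i + 1) - 2) * T ^ (n - 1 - i) c * a_i)` on Witt vectors
`a = ∑ V ^ i (a_i)` of length `n`, where `T h = u (δ * f ^ (p - 2) * h)`. -/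
def wittForm (f δ c : MvPolynomial (Fin (N + 1)) k) :
    ℕ → WittVector p (MvPolynomial (Fin (N + 1)) k) → MvPolynomial (Fin (N + 1)) k
  | 0, _ => 0
  | n + 1, a => traceU p (f ^ (p - 2) * (fun h => traceU p (δ * f ^ (p - 2) * h))^[n] c *
      a.coeff 0 - f ^ (p - 1) * wittForm f δ c n (liftRest p a))

variable {f δ c : MvPolynomial (Fin (N + 1)) k}

/-- A simultaneous induction. Additivity at length n+1 needs vanishing on Frobenius images at length
n, because remainders are determined only up to F y. Vanishing on F y at length n+1 follows from
u(f^(p-2) T^n c · y_0^p) = y_0 u(f^(p-2) T^n c) = 0. It costs one more vanishing condition than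
additivity, which is why the two ranges of j differ. -/
theorem wittForm_add_and_frobenius (n : ℕ) :
    ((∀ j, j + 1 < n →
        traceU p (f ^ (p - 2) * (fun h => traceU p (δ * f ^ (p - 2) * h))^[j] c) = 0) →
      ∀ a b, wittForm p f δ c n (a + b) = wittForm p f δ c n a + wittForm p f δ c n b) ∧
    ((∀ j, j < n →
        traceU p (f ^ (p - 2) * (fun h => traceU p (δ * f ^ (p - 2) * h))^[j] c) = 0) →
      ∀ y, wittForm p f δ c n (frobenius y) = 0) := by
  induction n with
  | zero => exact ⟨fun _ a b => by simp [wittForm], fun _ y => rfl⟩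
  | succ n ih =>
    have key : (∀ j, j < n →
        traceU p (f ^ (p - 2) * (fun h => traceU p (δ * f ^ (p - 2) * h))^[j] c) = 0) →
      ∀ z ∈ liftSubring p, ∀ b, wittForm p f δ c (n + 1) (z + verschiebung b) =
        traceU p (f ^ (p - 2) * (fun h => traceU p (δ * f ^ (p - 2) * h))^[n] c * z.coeff 0 -
          f ^ (p - 1) * wittForm p f δ c n b) := by
      intro h z hz b
      obtain ⟨y, hy⟩ := exists_liftRest_eq (b := b) hz
      rw [wittForm, hy, ih.1 (fun j hj => h j (by omega)), ih.2 h, add_zero, add_coeff_zero,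
        verschiebung_coeff_zero, add_zero]
    constructor
    · intro h a b
      have h' : ∀ j, j < n →
        traceU p (f ^ (p - 2) * (fun h => traceU p (δ * f ^ (p - 2) * h))^[j] c) = 0 :=
        fun j hj => h j (by omega)
      have e : a + b = (termwiseLift p (a.coeff 0) + termwiseLift p (b.coeff 0)) +
          verschiebung (liftRest p a + liftRest p b) := by
        rw [map_add]
        conv_lhs => rw [eq_termwiseLift_add a, eq_termwiseLift_add b]
        ring
      rw [e, key h' _ (add_mem (termwiseLift_mem_liftSubring _) (termwiseLift_mem_liftSubring _)),
        ih.1 (fun j hj => h' j (by omega)), add_coeff_zero, termwiseLift_coeff_zero,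
        termwiseLift_coeff_zero, wittForm, wittForm, ← traceU_add]
      congr 1
      ring
    · intro h y
      have h' : ∀ j, j < n →
        traceU p (f ^ (p - 2) * (fun h => traceU p (δ * f ^ (p - 2) * h))^[j] c) = 0 :=
        fun j hj => h j (by omega)
      have e : frobenius y = frobenius (termwiseLift p (y.coeff 0)) +
          verschiebung (frobenius (liftRest p y)) := by
        conv_lhs => rw [eq_termwiseLift_add y]
        rw [map_add, frobenius_verschiebung, verschiebung_frobenius]
      rw [e, key h' _ (frobenius_mem_liftSubring (termwiseLift_mem_liftSubring _)), ih.2 h',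
        coeff_frobenius_charP, termwiseLift_coeff_zero, mul_zero, sub_zero, mul_comm,
        traceU_pow_mul, h n (by omega), mul_zero]

theorem wittForm_add {n : ℕ} (h : ∀ j, j + 1 < n →
      traceU p (f ^ (p - 2) * (fun h => traceU p (δ * f ^ (p - 2) * h))^[j] c) = 0)
    (a b : WittVector p (MvPolynomial (Fin (N + 1)) k)) :
    wittForm p f δ c n (a + b) = wittForm p f δ c n a + wittForm p f δ c n b :=
  (wittForm_add_and_frobenius n).1 h a b

theorem wittForm_frobenius {n : ℕ} (h : ∀ j, j < n →
      traceU p (f ^ (p - 2) * (fun h => traceU p (δ * f ^ (p - 2) * h))^[j] c) = 0)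
    (y : WittVector p (MvPolynomial (Fin (N + 1)) k)) :
    wittForm p f δ c n (frobenius y) = 0 :=
  (wittForm_add_and_frobenius n).2 h y

theorem wittForm_lift_add_verschiebung {n : ℕ} (h : ∀ j, j + 1 < n + 1 →
      traceU p (f ^ (p - 2) * (fun h => traceU p (δ * f ^ (p - 2) * h))^[j] c) = 0)
    {z : WittVector p (MvPolynomial (Fin (N + 1)) k)} (hz : z ∈ liftSubring p)
    (b : WittVector p (MvPolynomial (Fin (N + 1)) k)) :
    wittForm p f δ c (n + 1) (z + verschiebung b) =
      traceU p (f ^ (p - 2) * (fun h => traceU p (δ * f ^ (p - 2) * h))^[n] c * z.coeff 0 -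
        f ^ (p - 1) * wittForm p f δ c n b) := by
  obtain ⟨y, hy⟩ := exists_liftRest_eq (b := b) hz
  rw [wittForm, hy, wittForm_add (fun j hj => h j (by omega)),
    wittForm_frobenius (fun j hj => h j (by omega)), add_zero, add_coeff_zero,
    verschiebung_coeff_zero, add_zero]

theorem wittForm_zero_right {n : ℕ} (h : ∀ j, j + 1 < n →
      traceU p (f ^ (p - 2) * (fun h => traceU p (δ * f ^ (p - 2) * h))^[j] c) = 0) :
    wittForm p f δ c n 0 = 0 := by
  have := wittForm_add h 0 0
  rw [add_zero] at this
  exact left_eq_add.1 this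

theorem wittForm_verschiebung {n : ℕ} (h : ∀ j, j + 1 < n + 1 →
      traceU p (f ^ (p - 2) * (fun h => traceU p (δ * f ^ (p - 2) * h))^[j] c) = 0)
    (b : WittVector p (MvPolynomial (Fin (N + 1)) k)) :
    wittForm p f δ c (n + 1) (verschiebung b) =
      -traceU p (f ^ (p - 1) * wittForm p f δ c n b) := by
  have := wittForm_lift_add_verschiebung h (zero_mem _) b
  rw [zero_add] at this
  rw [this, ← traceU_neg]
  congr 1
  simp

theorem wittForm_p_mul {n : ℕ} (h : ∀ j, j + 1 < n →
      traceU p (f ^ (p - 2) * (fun h => traceU p (δ * f ^ (p - 2) * h))^[j] c) = 0)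
    (a : WittVector p (MvPolynomial (Fin (N + 1)) k)) :
    wittForm p f δ c n (p * a) = 0 := by
  rcases n with _ | n
  · rfl
  · rw [← verschiebung_frobenius', wittForm_verschiebung h,
      wittForm_frobenius (fun j hj => h j (by omega)), mul_zero, traceU_zero, neg_zero]

/-- Replacing x by the termwise lift of x_0 changes F x by a multiple of p, which the form kills.
For a termwise lift, F x stays in `liftSubring`, so the recursion applies and u(x_0^p h) = x_0 u(h)
finishes. -/
theorem wittForm_frobenius_mul {n : ℕ} (h : ∀ j, j + 1 < n →
      traceU p (f ^ (p - 2) * (fun h => traceU p (δ * f ^ (p - 2) * h))^[j] c) = 0)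
    (x a : WittVector p (MvPolynomial (Fin (N + 1)) k)) :
    wittForm p f δ c n (frobenius x * a) = x.coeff 0 * wittForm p f δ c n a := by
  induction n generalizing x a with
  | zero => simp [wittForm]
  | succ n ih =>
    have e : frobenius x * a = frobenius (termwiseLift p (x.coeff 0)) * a +
        p * (liftRest p x * a) := by
      conv_lhs => rw [eq_termwiseLift_add x]
      rw [map_add, frobenius_verschiebung]
      ring
    have e2 : frobenius (termwiseLift p (x.coeff 0)) * a =
        frobenius (termwiseLift p (x.coeff 0)) * termwiseLift p (a.coeff 0) +
        verschiebung (frobenius (frobenius (termwiseLift p (x.coeff 0))) * liftRest p a) := by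
      conv_lhs => rw [eq_termwiseLift_add a]
      rw [mul_add, mul_verschiebung]
    rw [e, wittForm_add h, wittForm_p_mul h, add_zero, e2, wittForm_lift_add_verschiebung h
      (mul_mem (frobenius_mem_liftSubring (termwiseLift_mem_liftSubring _))
        (termwiseLift_mem_liftSubring _)), ih (fun j hj => h j (by omega)), mul_coeff_zero,
      coeff_frobenius_charP, termwiseLift_coeff_zero, termwiseLift_coeff_zero, wittForm, ← traceU_pow_mul]
    congr 1
    ring

theorem wittForm_eq_of_coeff_eq {n : ℕ} (h : ∀ j, j + 1 < n →
      traceU p (f ^ (p - 2) * (fun h => traceU p (δ * f ^ (p - 2) * h))^[j] c) = 0)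
    {a b : WittVector p (MvPolynomial (Fin (N + 1)) k)} (hab : ∀ t < n, a.coeff t = b.coeff t) :
    wittForm p f δ c n a = wittForm p f δ c n b := by
  have h1 : ∀ (n : ℕ), (∀ j, j + 1 < n →
      traceU p (f ^ (p - 2) * (fun h => traceU p (δ * f ^ (p - 2) * h))^[j] c) = 0) →
      ∀ y, wittForm p f δ c n (verschiebung^[n] y) = 0 := by
    intro n
    induction n with
    | zero => intro _ y; rfl
    | succ n ih =>
      intro h y
      rw [Function.iterate_succ_apply', wittForm_verschiebung h,
        ih (fun j hj => h j (by omega)), mul_zero, traceU_zero, neg_zero]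
  obtain ⟨y, hy⟩ : ∃ y, a = b + verschiebung^[n] y := by
    have h2 : WittVector.truncate n (a - b) = 0 := by
      rw [map_sub, sub_eq_zero]
      refine TruncatedWittVector.ext fun i => ?_
      simpa using hab i i.2
    have h3 := (WittVector.mem_ker_truncate n (a - b)).1 h2
    obtain hy := eq_iterate_verschiebung h3
    exact ⟨_, by rw [← hy]; ring⟩
  rw [hy, wittForm_add h, h1 n h, add_zero]

theorem wittForm_one {n : ℕ} (h : ∀ j, j + 1 < n + 1 →
      traceU p (f ^ (p - 2) * (fun h => traceU p (δ * f ^ (p - 2) * h))^[j] c) = 0) :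
    wittForm p f δ c (n + 1) 1 =
      traceU p (f ^ (p - 2) * (fun h => traceU p (δ * f ^ (p - 2) * h))^[n] c) := by
  have := wittForm_lift_add_verschiebung h (one_mem _) 0
  rw [map_zero, add_zero] at this
  rw [this, wittForm_zero_right (fun j hj => h j (by omega)), mul_zero, sub_zero]
  simp

end Form
end QFS
end

open MvPolynomial AlgebraicGeometry CategoryTheory Opposite
noncomputable section
namespace QFS

/-! ### Divisibility by f and degrees of the values of the form -/

section FormIdeal

open WittVector

variable {p : ℕ} [Fact p.Prime] {k : Type*} [Field k] [CharP k p] [PerfectRing k p] {N : ℕ}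
  {f δ c : MvPolynomial (Fin (N + 1)) k}

theorem dvd_traceU_of_pow_dvd {g h : MvPolynomial (Fin (N + 1)) k} (H : g ^ p ∣ h) :
    g ∣ traceU p h := by
  obtain ⟨e, rfl⟩ := H
  rw [traceU_pow_mul]
  exact dvd_mul_right _ _

/-- This is where Δ(f) enters: D may be replaced by Dt, on which the form equals u(f^(p-2) T^n c ·
δ) = T^(n+1) c. The correction [f]^(p-1) V D contributes a multiple of f, and multiples of p
contribute nothing. -/
theorem dvd_wittForm_lift {D Dt : WittVector p (MvPolynomial (Fin (N + 1)) k)}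
    (h : teichmuller p f = termwiseLift p f + verschiebung D)
    (hDt : (p : WittVector p (MvPolynomial (Fin (N + 1)) k)) * Dt =
      termwiseLift p f ^ p - frobenius (termwiseLift p f))
    (hDtmem : Dt ∈ liftSubring p) (hDt0 : Dt.coeff 0 = δ) {n : ℕ} (hc : ∀ j, j + 1 < n + 1 →
      traceU p (f ^ (p - 2) * (fun h => traceU p (δ * f ^ (p - 2) * h))^[j] c) = 0) :
    f ∣ (fun h => traceU p (δ * f ^ (p - 2) * h))^[n + 1] c - wittForm p f δ c (n + 1) D := by
  have h2 := (Fact.out : p.Prime).two_le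
  obtain ⟨E, hE⟩ := exists_eq_add_teichmuller_pow_mul_verschiebung h hDt
  have e1 : wittForm p f δ c (n + 1) Dt =
      (fun h => traceU p (δ * f ^ (p - 2) * h))^[n + 1] c := by
    have := wittForm_lift_add_verschiebung hc hDtmem 0
    rw [map_zero, add_zero] at this
    rw [this, wittForm_zero_right (fun j hj => hc j (by omega)), mul_zero, sub_zero, hDt0,
      Function.iterate_succ_apply']
    congr 1
    ring
  have e2 : f ∣ wittForm p f δ c (n + 1) (teichmuller p f ^ (p - 1) * verschiebung D) := by
    rw [teichmuller_pow_mul_verschiebung, wittForm_verschiebung hc]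
    have : teichmuller p f ^ (p * (p - 1)) * D = frobenius (teichmuller p f ^ (p - 1)) * D := by
      rw [map_pow, frobenius_teichmuller, pow_mul]
    rw [this, wittForm_frobenius_mul (fun j hj => hc j (by omega)), ← map_pow,
      teichmuller_coeff_zero, dvd_neg]
    apply dvd_traceU_of_pow_dvd
    rw [← mul_assoc, ← pow_add]
    exact (pow_dvd_pow f (by omega)).trans (dvd_mul_right _ _)
  have e3 : wittForm p f δ c (n + 1) D = (fun h => traceU p (δ * f ^ (p - 2) * h))^[n + 1] c +
      wittForm p f δ c (n + 1) (teichmuller p f ^ (p - 1) * verschiebung D) := by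
    conv_lhs => rw [hE]
    rw [wittForm_add hc, wittForm_add hc, wittForm_p_mul hc, e1, add_zero]
  rw [e3, sub_add_cancel_left, dvd_neg]
  exact e2

/-- The sequence of ideals `fA, …, fA, (f ^ 2 A : c), A, …`. -/
def colonSeq (f c : MvPolynomial (Fin (N + 1)) k) (n t : ℕ) :
    Ideal (MvPolynomial (Fin (N + 1)) k) :=
  if t + 1 < n then Ideal.span {f} else if t + 1 = n then
    (Ideal.span {f ^ 2}).colon (Ideal.span {c}) else ⊤

theorem mem_colonSeq {f c : MvPolynomial (Fin (N + 1)) k} {n t : ℕ}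
    {a : MvPolynomial (Fin (N + 1)) k} : a ∈ colonSeq f c n t ↔
      (t + 1 < n → f ∣ a) ∧ (t + 1 = n → f ^ 2 ∣ a * c) := by
  rw [colonSeq]
  split_ifs with h1 h2
  · simp [Ideal.mem_span_singleton, h1, h1.ne]
  · rw [Ideal.mem_colon_span_singleton, Ideal.mem_span_singleton]
    simp [h2]
  · simp [h1, h2]

theorem pow_mem_colonSeq {f c a : MvPolynomial (Fin (N + 1)) k} (n t : ℕ) {l : ℕ} (hl : 2 ≤ l)
    (h : f ∣ a) : a ^ l ∈ colonSeq f c n t := by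
  rw [mem_colonSeq]
  refine ⟨fun _ => h.trans (dvd_pow_self _ (by omega)), fun _ => ?_⟩
  exact ((pow_dvd_pow_of_dvd h 2).trans (pow_dvd_pow a hl)).trans (dvd_mul_right _ _)

theorem admissible_colonSeq (n : ℕ) : Admissible p (colonSeq f c n) := by
  have h2 := (Fact.out : p.Prime).two_le
  intro t
  by_cases h1 : t + 1 < n
  · have : colonSeq f c n t = Ideal.span {f} := if_pos h1
    rw [this, Ideal.span_singleton_pow, Ideal.span_singleton_le_iff_mem]
    exact pow_mem_colonSeq _ _ h2 dvd_rfl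
  · have : colonSeq f c n (t + 1) = ⊤ := by rw [colonSeq, if_neg (by omega), if_neg (by omega)]
    rw [this]
    exact le_top

/-- Write a = [f] s + V a' and induct on a'. As [f] s = ft · s + V(F(s) D), the form on [f] s is
u(f^(p-1) s_0 (T^(n+1) c - Ψ(D))), and the bracket is divisible by f by `dvd_wittForm_lift`. The
last component gets the colon condition because it enters only through u(f^(p-2) c a_t). -/
theorem dvd_wittForm {D Dt : WittVector p (MvPolynomial (Fin (N + 1)) k)}
    (h : teichmuller p f = termwiseLift p f + verschiebung D)
    (hDt : (p : WittVector p (MvPolynomial (Fin (N + 1)) k)) * Dt =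
      termwiseLift p f ^ p - frobenius (termwiseLift p f))
    (hDtmem : Dt ∈ liftSubring p) (hDt0 : Dt.coeff 0 = δ) {n : ℕ} (hc : ∀ j, j + 1 < n →
      traceU p (f ^ (p - 2) * (fun h => traceU p (δ * f ^ (p - 2) * h))^[j] c) = 0)
    {a : WittVector p (MvPolynomial (Fin (N + 1)) k)} (ha : ∀ t, t + 1 < n → f ∣ a.coeff t)
    (hac : ∀ t, t + 1 = n → f ^ 2 ∣ a.coeff t * c) : f ∣ wittForm p f δ c n a := by
  have h2 := (Fact.out : p.Prime).two_le
  induction n generalizing a with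
  | zero => exact dvd_zero f
  | succ n ih =>
    rcases n with _ | n
    · have h1 := hac 0 rfl
      rw [wittForm]
      apply dvd_traceU_of_pow_dvd
      simp only [Function.iterate_zero, id, wittForm, mul_zero, sub_zero]
      have : f ^ p = f ^ (p - 2) * f ^ 2 := by rw [← pow_add]; congr 1; omega
      rw [this, mul_assoc]
      exact mul_dvd_mul_left _ (by rwa [mul_comm])
    · obtain ⟨e, he⟩ := ha 0 (by omega)
      set s := termwiseLift p e with hs
      have hs0 : s.coeff 0 = e := termwiseLift_coeff_zero e
      obtain ⟨a', ha'⟩ := exists_eq_add_verschiebung (x := a) (y := teichmuller p f * s) (by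
        rw [mul_coeff_zero, teichmuller_coeff_zero, hs0, he])
      -- Subtraction mixes components, so the conditions pass from a to V a' only because they form
      -- an admissible sequence of ideals.
      have hmem : ∀ t, (verschiebung a').coeff t ∈ colonSeq f c (n + 2) t := by
        have h1 : a ∈ wittSubgroup _ (admissible_colonSeq (f := f) (c := c) (n + 2)) := fun t =>
          mem_colonSeq.2 ⟨ha t, hac t⟩
        have h2 : teichmuller p f * s ∈
            wittSubgroup _ (admissible_colonSeq (f := f) (c := c) (n + 2)) := fun t => by
          rw [teichmuller_mul_coeff]
          refine Ideal.mul_mem_right _ _ ?_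
          rcases t with _ | t
          · exact mem_colonSeq.2 ⟨fun _ => by simp, fun h => by omega⟩
          · refine pow_mem_colonSeq _ _ ?_ dvd_rfl
            calc 2 ≤ p := h2
              _ ≤ p ^ (t + 1) := Nat.le_self_pow (by omega) p
        have h3 : verschiebung a' = a - teichmuller p f * s := by rw [ha']; ring
        rw [h3]
        exact sub_mem h1 h2
      have h3 : f ∣ wittForm p f δ c (n + 1) a' := by
        refine ih (fun j hj => hc j (by omega)) (fun t ht => ?_) (fun t ht => ?_)
        · have := (mem_colonSeq.1 (hmem (t + 1))).1 (by omega)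
          rwa [verschiebung_coeff_succ] at this
        · have := (mem_colonSeq.1 (hmem (t + 1))).2 (by omega)
          rwa [verschiebung_coeff_succ] at this
      have h4 : f ∣ wittForm p f δ c (n + 2) (teichmuller p f * s) := by
        have e1 : teichmuller p f * s = termwiseLift p f * s +
            verschiebung (frobenius s * D) := by
          rw [← mul_verschiebung, h]
          ring
        rw [e1, wittForm_lift_add_verschiebung hc (mul_mem (termwiseLift_mem_liftSubring _)
          (termwiseLift_mem_liftSubring _)), wittForm_frobenius_mul (fun j hj => hc j (by omega)),
          mul_coeff_zero, termwiseLift_coeff_zero, hs0]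
        apply dvd_traceU_of_pow_dvd
        obtain ⟨r, hr⟩ := dvd_wittForm_lift h hDt hDtmem hDt0 (n := n) (c := c)
          (fun j hj => hc j (by omega))
        have e2 : f ^ (p - 1) = f ^ (p - 2) * f := by rw [← pow_succ]; congr 1; omega
        have e3 : f ^ p = f ^ (p - 2) * f * f := by
          rw [← pow_succ, ← pow_succ]; congr 1; omega
        rw [sub_eq_iff_eq_add] at hr
        refine ⟨e * r, ?_⟩
        rw [hr, e2, e3]
        ring
      rw [ha', wittForm_add hc, wittForm_verschiebung hc]
      refine dvd_add h4 ((dvd_neg).2 (dvd_traceU_of_pow_dvd ?_))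
      have e3 : f ^ p = f ^ (p - 1) * f := by rw [← pow_succ]; congr 1; omega
      rw [e3]
      exact mul_dvd_mul_left _ h3

theorem teichmuller_sum_mem_wittSubgroup {R ι : Type*} [CommRing R] [CharP R p] [Algebra k R]
    {J : ℕ → Submodule k R} (hJ : Admissible p J) (s : Finset ι) {g : ι → R}
    (hg : ∀ i ∈ s, g i ∈ J 0) : ∑ i ∈ s, teichmuller p (g i) ∈ wittSubgroup J hJ := by
  refine sum_mem fun i hi t => ?_
  rcases t with _ | t
  · rw [teichmuller_coeff_zero]
    exact hg i hi
  · rw [teichmuller_coeff_pos _ _ _ (by omega)]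
    exact zero_mem _

theorem admissible_weightedHomogeneousSubmodule (q : Fin (N + 1) → ℕ) (e : ℕ) :
    Admissible p fun t => weightedHomogeneousSubmodule k q (p ^ t * e) := by
  intro t
  have : ∀ n, weightedHomogeneousSubmodule k q (p ^ t * e) ^ n ≤
      weightedHomogeneousSubmodule k q (n * (p ^ t * e)) := by
    intro n
    induction n with
    | zero => 
      rw [pow_zero, zero_mul, Submodule.one_le]
      exact isWeightedHomogeneous_one k q
    | succ n ih =>
      rw [pow_succ, add_mul, one_mul]
      refine (Submodule.mul_le.2 fun a ha b hb => ?_)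
      exact IsWeightedHomogeneous.mul (ih ha) hb
  refine (this p).trans (le_of_eq ?_)
  congr 1
  ring

theorem termwiseLift_mem_wittSubgroup {q : Fin (N + 1) → ℕ} {e : ℕ}
    {g : MvPolynomial (Fin (N + 1)) k} (hg : g.IsWeightedHomogeneous q e) :
    termwiseLift p g ∈ wittSubgroup _ (admissible_weightedHomogeneousSubmodule (k := k) q e) := by
  refine teichmuller_sum_mem_wittSubgroup _ _ fun a ha => ?_
  rw [pow_zero, one_mul]
  exact isWeightedHomogeneous_monomial q a _ (hg (Finsupp.mem_support_iff.1 ha))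

theorem isWeightedHomogeneous_pow_mul {q : Fin (N + 1) → ℕ} {d e : ℕ}
    {g h : MvPolynomial (Fin (N + 1)) k} (hg : g.IsWeightedHomogeneous q d)
    (hh : h.IsWeightedHomogeneous q e) (l : ℕ) : (g ^ l * h).IsWeightedHomogeneous q (l * d + e) := by
  have := (hg.pow l).mul hh
  rwa [smul_eq_mul] at this

/-- With d = ∑ q_i, the degree p d + (p-2) d + d of δ f^(p-2) h equals (p-1) d + p d, so u returns
degree d. This is the Calabi–Yau condition at work. -/
theorem iterate_traceU_mem {q : Fin (N + 1) → ℕ} (hf : f.IsWeightedHomogeneous q (∑ i, q i))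
    (hδ : δ.IsWeightedHomogeneous q (p * ∑ i, q i)) (hc : c.IsWeightedHomogeneous q (∑ i, q i))
    (n : ℕ) : ((fun h => traceU p (δ * f ^ (p - 2) * h))^[n] c).IsWeightedHomogeneous q
      (∑ i, q i) := by
  have h2 := (Fact.out : p.Prime).two_le
  induction n with
  | zero => exact hc
  | succ n ih =>
    rw [Function.iterate_succ_apply']
    refine traceU_mem ?_
    rw [mul_assoc]
    have := hδ.mul (isWeightedHomogeneous_pow_mul hf ih (p - 2))
    convert this using 1
    obtain ⟨r, rfl⟩ : ∃ r, p = r + 2 := ⟨p - 2, by omega⟩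
    simp only [Nat.add_sub_cancel, Nat.add_succ_sub_one]
    ring

theorem wittForm_mem {q : Fin (N + 1) → ℕ} (hf : f.IsWeightedHomogeneous q (∑ i, q i))
    (hδ : δ.IsWeightedHomogeneous q (p * ∑ i, q i)) (hc : c.IsWeightedHomogeneous q (∑ i, q i))
    {n e : ℕ} {a : WittVector p (MvPolynomial (Fin (N + 1)) k)}
    (ha : ∀ t, (a.coeff t).IsWeightedHomogeneous q (p ^ (t + 1) * e)) :
    (wittForm p f δ c n a).IsWeightedHomogeneous q e := by
  have h2 := (Fact.out : p.Prime).two_le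
  induction n generalizing a e with
  | zero => exact isWeightedHomogeneous_zero k q e
  | succ n ih =>
    rw [wittForm]
    refine traceU_mem ?_
    have h0 := ha 0
    rw [zero_add, pow_one] at h0
    have h1 : ∀ t, ((liftRest p a).coeff t).IsWeightedHomogeneous q (p ^ (t + 1) * (p * e)) := by
      have h3 : verschiebung (liftRest p a) ∈
          wittSubgroup _ (admissible_weightedHomogeneousSubmodule (k := k) (p := p) q (p * e)) := by
        have : verschiebung (liftRest p a) = a - termwiseLift p (a.coeff 0) := by
          have := eq_termwiseLift_add a
          exact (sub_eq_iff_eq_add'.2 this).symm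
        rw [this]
        refine sub_mem (fun t => ?_) (termwiseLift_mem_wittSubgroup h0)
        have := ha t
        rwa [pow_succ, mul_assoc] at this
      intro t
      have := h3 (t + 1)
      rwa [verschiebung_coeff_succ] at this
    have e1 := isWeightedHomogeneous_pow_mul hf ((iterate_traceU_mem hf hδ hc n).mul h0) (p - 2)
    have e2 := isWeightedHomogeneous_pow_mul hf (ih h1) (p - 1)
    refine (weightedHomogeneousSubmodule k q _).sub_mem ?_ e2
    rw [mul_assoc]
    convert e1 using 1
    obtain ⟨r, rfl⟩ : ∃ r, p = r + 2 := ⟨p - 2, by omega⟩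
    simp only [Nat.add_sub_cancel, Nat.add_succ_sub_one]
    rw [mem_weightedHomogeneousSubmodule]
    congr! 1
    ring

end FormIdeal
end QFS
end

open MvPolynomial AlgebraicGeometry CategoryTheory Opposite
noncomputable section
namespace QFS

/-! ### Termwise lifts and Δ in a monoid algebra -/

section GeneralDelta

open WittVector

variable {p : ℕ} [Fact p.Prime] {k : Type*} [Field k] [CharP k p] {m : ℕ} {Λ : Type*}
  [AddCommMonoid Λ] {M : Fin m → Λ}

theorem sum_single_eq (hM : Function.Injective M) {c : AddMonoidAlgebra k Λ}
    (hc : ∀ a, c.coeff a ≠ 0 → a ∈ Set.range M) :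
    ∑ i, AddMonoidAlgebra.single (M i) (c.coeff (M i)) = c := by
  classical
  have h1 : ∑ i, AddMonoidAlgebra.single (M i) (c.coeff (M i)) =
      ∑ a ∈ Finset.univ.image M, AddMonoidAlgebra.single a (c.coeff a) := by
    rw [Finset.sum_image fun i _ j _ h => hM h]
  conv_rhs => rw [← AddMonoidAlgebra.sum_coeff_single c]
  rw [h1, Finsupp.sum]
  refine (Finset.sum_subset (fun a ha => ?_) fun a _ ha => ?_).symm
  · obtain ⟨i, rfl⟩ := hc a (Finsupp.mem_support_iff.1 ha)
    exact Finset.mem_image_of_mem _ (Finset.mem_univ i)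
  · rw [Finsupp.notMem_support_iff.1 ha, AddMonoidAlgebra.single_zero]

theorem termwiseLift_eq_sum (hM : Function.Injective M) {c : AddMonoidAlgebra k Λ}
    (hc : ∀ a, c.coeff a ≠ 0 → a ∈ Set.range M) :
    termwiseLift p c = ∑ i, teichmuller p (AddMonoidAlgebra.single (M i) (c.coeff (M i))) := by
  classical
  have h1 : ∑ i, teichmuller p (AddMonoidAlgebra.single (M i) (c.coeff (M i))) =
      ∑ a ∈ Finset.univ.image M, teichmuller p (AddMonoidAlgebra.single a (c.coeff a)) := by
    rw [Finset.sum_image fun i _ j _ h => hM h]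
  rw [h1, termwiseLift]
  refine Finset.sum_subset (fun a ha => ?_) fun a _ ha => ?_
  · obtain ⟨i, rfl⟩ := hc a (Finsupp.mem_support_iff.1 ha)
    exact Finset.mem_image_of_mem _ (Finset.mem_univ i)
  · rw [Finsupp.notMem_support_iff.1 ha, AddMonoidAlgebra.single_zero, teichmuller_zero]

/-- The explicit Dt is the multinomial expression of Δ evaluated at Teichmüller lifts. A general
exponent monoid is allowed so that the result covers both polynomials and Laurent polynomials. -/
theorem exists_termwiseLift_delta_single (hM : Function.Injective M) {f : AddMonoidAlgebra k Λ}
    (hf : ∀ a, f.coeff a ≠ 0 → a ∈ Set.range M) :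
    ∃ D Dt : WittVector p (AddMonoidAlgebra k Λ),
      teichmuller p f = termwiseLift p f + verschiebung D ∧
      (p : WittVector p (AddMonoidAlgebra k Λ)) * Dt =
        termwiseLift p f ^ p - frobenius (termwiseLift p f) ∧
      Dt ∈ liftSubring p ∧ Dt.coeff 0 =
        ∑ β ∈ (Finset.univ.piAntidiag p : Finset (Fin m → ℕ)) with ∀ i, β i ≤ p - 1,
          ((Nat.multinomial Finset.univ β / p : ℕ) : AddMonoidAlgebra k Λ) *
            ∏ i, AddMonoidAlgebra.single (M i) (f.coeff (M i)) ^ β i := by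
  obtain ⟨D, hD⟩ := exists_eq_add_verschiebung (x := teichmuller p f) (y := termwiseLift p f)
    (by rw [teichmuller_coeff_zero, termwiseLift_coeff_zero])
  refine ⟨D, ∑ β ∈ (Finset.univ.piAntidiag p : Finset (Fin m → ℕ)) with ∀ i, β i ≤ p - 1,
      ((Nat.multinomial Finset.univ β / p : ℕ) : WittVector p (AddMonoidAlgebra k Λ)) *
        ∏ i, teichmuller p (AddMonoidAlgebra.single (M i) (f.coeff (M i))) ^ β i, hD, ?_, ?_, ?_⟩
  · rw [termwiseLift_eq_sum hM hf, sum_pow_prime_eq (Fact.out : p.Prime), map_sum]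
    simp only [frobenius_teichmuller]
    ring
  · refine sum_mem fun β _ => mul_mem (natCast_mem _ _) (prod_mem fun i _ => pow_mem ?_ _)
    exact teichmuller_single_mem_liftSubring _ _
  · change WittVector.constantCoeff _ = _
    rw [map_sum]
    refine Finset.sum_congr rfl fun β _ => ?_
    rw [map_mul, map_natCast, map_prod]
    congr 1
    refine Finset.prod_congr rfl fun i _ => ?_
    rw [map_pow]
    congr 1

end GeneralDelta

/-! ### The rows R_n as functionals on polynomials of degree d -/

section Rows

open WittVector

variable {p : ℕ} [Fact p.Prime] {k : Type*} [Field k] [CharP k p] [PerfectRing k p] {N m : ℕ}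
  {M : Fin m → Fin (N + 1) →₀ ℕ}

theorem sum_monomial_eq (hM : Function.Injective M) {c : MvPolynomial (Fin (N + 1)) k}
    (hc : ∀ a, c.coeff a ≠ 0 → a ∈ Set.range M) :
    ∑ i, monomial (M i) (c.coeff (M i)) = c :=
  sum_single_eq hM hc

theorem exists_termwiseLift_delta (hM : Function.Injective M) {f : MvPolynomial (Fin (N + 1)) k}
    (hf : ∀ a, f.coeff a ≠ 0 → a ∈ Set.range M) :
    ∃ D Dt : WittVector p (MvPolynomial (Fin (N + 1)) k),
      teichmuller p f = termwiseLift p f + verschiebung D ∧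
      (p : WittVector p (MvPolynomial (Fin (N + 1)) k)) * Dt =
        termwiseLift p f ^ p - frobenius (termwiseLift p f) ∧
      Dt ∈ liftSubring p ∧ Dt.coeff 0 = delta p M f :=
  exists_termwiseLift_delta_single hM hf

theorem delta_mem {q : Fin (N + 1) → ℕ} {d : ℕ} (hM : ∀ i, Finsupp.weight q (M i) = d)
    (f : MvPolynomial (Fin (N + 1)) k) : (delta p M f).IsWeightedHomogeneous q (p * d) := by
  rw [delta]
  refine IsWeightedHomogeneous.sum _ _ _ fun β hβ => ?_
  rw [Finset.mem_filter, Finset.mem_piAntidiag] at hβ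
  have h1 : (∏ i, monomial (M i) (f.coeff (M i)) ^ β i).IsWeightedHomogeneous q
      (∑ i, β i • d) := by
    refine IsWeightedHomogeneous.prod _ _ _ fun i _ => ?_
    exact (isWeightedHomogeneous_monomial q (M i) _ (hM i)).pow _
  rw [← Finset.sum_smul, hβ.1.1, smul_eq_mul] at h1
  have h2 := (isWeightedHomogeneous_C q
    ((Nat.multinomial Finset.univ β / p : ℕ) : k)).mul h1
  rwa [zero_add, map_natCast] at h2

theorem coeff_traceU_mul_eq_sum (hM : Function.Injective M) {c : MvPolynomial (Fin (N + 1)) k}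
    (hc : ∀ a, c.coeff a ≠ 0 → a ∈ Set.range M) (g : MvPolynomial (Fin (N + 1)) k)
    (b : Fin (N + 1) →₀ ℕ) :
    (traceU p (g * c)).coeff b ^ p =
      ∑ i, c.coeff (M i) * (traceU p (g * monomial (M i) 1)).coeff b ^ p := by
  have h : ∀ x : k, (frobeniusEquiv k p).symm x ^ p = x := fun x =>
    frobeniusEquiv_symm_pow_p k p x ▸ by simp
  simp only [coeff_traceU, h]
  conv_lhs => rw [← sum_monomial_eq hM hc, Finset.mul_sum, coeff_sum]
  refine Finset.sum_congr rfl fun i _ => ?_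
  rw [← coeff_C_mul]
  congr 1
  rw [mul_left_comm, C_mul_monomial, mul_one]

/-- The p-th power of a coefficient of u(g c) is linear in the coefficients of c. Moving one
application of T from c to the row vector therefore costs one Frobenius, exactly as in the recursion
for R_n. -/
theorem rowR_dotProduct_coeffVec (hM : Function.Injective M) {q : Fin (N + 1) → ℕ}
    (hMq : ∀ a, a ∈ Set.range M ↔ Finsupp.weight q a = ∑ i, q i)
    {f c : MvPolynomial (Fin (N + 1)) k} (hf : f.IsWeightedHomogeneous q (∑ i, q i))
    (hc : c.IsWeightedHomogeneous q (∑ i, q i)) (n : ℕ) :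
    rowR p M f (n + 1) ⬝ᵥ coeffVec M c =
      (traceU p (f ^ (p - 2) * (fun h => traceU p (delta p M f * f ^ (p - 2) * h))^[n] c)).coeff 0
        ^ p ^ (n + 1) := by
  induction n generalizing c with
  | zero =>
    rw [zero_add, pow_one, Function.iterate_zero, id,
      coeff_traceU_mul_eq_sum hM fun a ha => (hMq a).2 (hc ha), dotProduct]
    refine Finset.sum_congr rfl fun i _ => ?_
    rw [rowR, mul_comm]
    rfl
  | succ n ih =>
    have hδ : (delta p M f).IsWeightedHomogeneous q (p * ∑ i, q i) :=
      delta_mem (fun i => (hMq _).1 ⟨i, rfl⟩) f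
    have hTc := iterate_traceU_mem hf hδ hc 1
    rw [Function.iterate_one] at hTc
    rw [Function.iterate_succ_apply, pow_succ _ (n + 1), pow_mul, ← ih hTc, dotProduct, dotProduct,
      sum_pow_char]
    simp only [mul_pow, coeffVec, coeff_traceU_mul_eq_sum hM fun a ha => (hMq a).2 (hc ha)]
    simp only [Finset.mul_sum]
    rw [Finset.sum_comm]
    refine Finset.sum_congr rfl fun i _ => ?_
    change (∑ j, rowR p M f (n + 1) j * matT p M f j i) ^ p * _ = _
    rw [sum_pow_char, Finset.sum_mul]
    refine Finset.sum_congr rfl fun j _ => ?_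
    rw [mul_pow, matT, Matrix.of_apply]
    ring

theorem eq_C_of_isWeightedHomogeneous_zero {q : Fin (N + 1) → ℕ} (hq : ∀ i, 0 < q i)
    {g : MvPolynomial (Fin (N + 1)) k} (hg : g.IsWeightedHomogeneous q 0) :
    g = C (g.coeff 0) := by
  classical
  ext a
  rw [coeff_C]
  split_ifs with h
  · rw [h]
  · by_contra h0
    have h1 := hg h0
    rw [Finsupp.weight_apply, Finsupp.sum_fintype _ _ (by simp)] at h1
    refine h (Finsupp.ext fun i => ?_)
    have h2 := (Finset.sum_eq_zero_iff.1 h1) i (Finset.mem_univ i)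
    rw [smul_eq_mul, mul_eq_zero] at h2
    have := hq i
    simp only [Finsupp.coe_zero, Pi.zero_apply]
    omega

theorem traceU_iterate_eq_C (hM : Function.Injective M) {q : Fin (N + 1) → ℕ} (hq : ∀ i, 0 < q i)
    (hMq : ∀ a, a ∈ Set.range M ↔ Finsupp.weight q a = ∑ i, q i)
    {f c : MvPolynomial (Fin (N + 1)) k} (hf : f.IsWeightedHomogeneous q (∑ i, q i))
    (hc : c.IsWeightedHomogeneous q (∑ i, q i)) (n : ℕ) :
    ∃ r : k, traceU p (f ^ (p - 2) * (fun h => traceU p (delta p M f * f ^ (p - 2) * h))^[n] c) =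
      C r ∧ r ^ p ^ (n + 1) = rowR p M f (n + 1) ⬝ᵥ coeffVec M c := by
  have h2 := (Fact.out : p.Prime).two_le
  have hδ : (delta p M f).IsWeightedHomogeneous q (p * ∑ i, q i) :=
    delta_mem (fun i => (hMq _).1 ⟨i, rfl⟩) f
  refine ⟨_, eq_C_of_isWeightedHomogeneous_zero hq (traceU_mem ?_),
    (rowR_dotProduct_coeffVec hM hMq hf hc n).symm⟩
  convert isWeightedHomogeneous_pow_mul hf (iterate_traceU_mem hf hδ hc n) (p - 2) using 1
  obtain ⟨r, rfl⟩ : ∃ r, p = r + 2 := ⟨p - 2, by omega⟩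
  simp only [Nat.add_sub_cancel, Nat.add_succ_sub_one]
  ring

end Rows
end QFS
end

open MvPolynomial AlgebraicGeometry CategoryTheory Opposite
noncomputable section
namespace QFS

/-! ### Truncated Witt vectors and Frobenius -/

section Truncated

open WittVector

variable {p : ℕ} [Fact p.Prime] {n : ℕ} {R S : Type*} [CommRing R] [CommRing S]

theorem wittMap_truncate (g : R →+* S) (a : WittVector p R) :
    wittMap p g (truncate n a) = truncate n (WittVector.map g a) :=
  TruncatedWittVector.ext fun i => by simp [wittMap]

theorem truncate_out (a : TruncatedWittVector p n R) : truncate n a.out = a :=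
  TruncatedWittVector.ext fun i => by simp

theorem wittFrob_truncate [CharP R p] (a : WittVector p R) :
    wittFrob p (truncate n a) = truncate n (frobenius a) :=
  TruncatedWittVector.ext fun i => by simp [wittFrob, coeff_frobenius_charP]

theorem truncate_eq_iff {a b : WittVector p R} :
    truncate n a = truncate n b ↔ ∀ t < n, a.coeff t = b.coeff t := by
  refine ⟨fun h t ht => ?_, fun h => TruncatedWittVector.ext fun i => by simp [h i i.2]⟩
  have := congrArg (fun x => x.coeff ⟨t, ht⟩) h
  simpa using this

theorem coeff_teichmuller_pow_mul [CharP R p] (g : R) (a : WittVector p R) (t : ℕ) :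
    (teichmuller p g ^ p * a).coeff t = g ^ p ^ (t + 1) * a.coeff t := by
  rw [← map_pow, teichmuller_mul_coeff, ← pow_mul, pow_succ']

end Truncated

/-! ### Sections of `ℚ`-divisors -/

section Divisor

variable {A : Type*} [CommRing A] [IsDomain A] [UniqueFactorizationMonoid A]

theorem ordAlong_div {π x y : A} (hπ : Prime π) (hx : x ≠ 0) (hy : y ≠ 0) :
    ordAlong π (algebraMap A (FractionRing A) x / algebraMap A (FractionRing A) y) =
      multiplicity π x - multiplicity π y := by
  set a := algebraMap A (FractionRing A) x / algebraMap A (FractionRing A) y with ha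
  have hinj := IsFractionRing.injective A (FractionRing A)
  have hy' : algebraMap A (FractionRing A) y ≠ 0 := (map_ne_zero_iff _ hinj).2 hy
  have hx' : algebraMap A (FractionRing A) x ≠ 0 := (map_ne_zero_iff _ hinj).2 hx
  have hd : (IsFractionRing.den A a : A) ≠ 0 := nonZeroDivisors.ne_zero (IsFractionRing.den A a).2
  have hd' : algebraMap A (FractionRing A) (IsFractionRing.den A a) ≠ 0 :=
    (map_ne_zero_iff _ hinj).2 hd
  have hn : IsFractionRing.num A a ≠ 0 := fun h =>
    div_ne_zero hx' hy' (IsFractionRing.eq_zero_of_num_eq_zero h)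
  have h1 : IsFractionRing.num A a * y = x * IsFractionRing.den A a := by
    apply hinj
    have h2 := IsFractionRing.mk'_num_den' A a
    rw [ha, div_eq_div_iff hd' hy', ← ha] at h2
    rw [map_mul, map_mul, h2]
  have h3 := congrArg (multiplicity π) h1
  rw [multiplicity_mul hπ (FiniteMultiplicity.of_prime_left hπ (mul_ne_zero hn hy)),
    multiplicity_mul hπ (FiniteMultiplicity.of_prime_left hπ (mul_ne_zero hx hd))] at h3
  rw [ordAlong]
  omega

/-- Divisibility of f^m · numerator by the denominator is checked one prime at a time, by unique
factorization. -/
theorem exists_eq_pow_mul_of_mem_divSections {r : ℚ} {f : A} (hf : f ≠ 0) {m : ℕ}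
    (hm : ∀ π : A, Prime π → ⌊r * (multiplicity π f : ℚ)⌋ ≤ m * multiplicity π f)
    {a : FractionRing A} (ha : a ∈ divSections r f) :
    ∃ b, algebraMap A (FractionRing A) b = algebraMap A (FractionRing A) f ^ m * a := by
  rcases ha with rfl | ha
  · exact ⟨0, by simp⟩
  have hinj := IsFractionRing.injective A (FractionRing A)
  have hd : (IsFractionRing.den A a : A) ≠ 0 := nonZeroDivisors.ne_zero (IsFractionRing.den A a).2
  have hd' : algebraMap A (FractionRing A) (IsFractionRing.den A a) ≠ 0 :=
    (map_ne_zero_iff _ hinj).2 hd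
  by_cases hn : IsFractionRing.num A a = 0
  · exact ⟨0, by rw [IsFractionRing.eq_zero_of_num_eq_zero hn]; simp⟩
  have h1 : (IsFractionRing.den A a : A) ∣ f ^ m * IsFractionRing.num A a := by
    have h0 : f ^ m * IsFractionRing.num A a ≠ 0 := mul_ne_zero (pow_ne_zero m hf) hn
    rw [UniqueFactorizationMonoid.dvd_iff_emultiplicity_le hd]
    intro π hπ
    rw [(FiniteMultiplicity.of_prime_left hπ hd).emultiplicity_eq_multiplicity,
      (FiniteMultiplicity.of_prime_left hπ h0).emultiplicity_eq_multiplicity,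
      multiplicity_mul hπ (FiniteMultiplicity.of_prime_left hπ h0),
      FiniteMultiplicity.multiplicity_pow hπ (FiniteMultiplicity.of_prime_left hπ hf)]
    have h2 := ha π hπ
    have h3 := hm π hπ
    rw [ordAlong] at h2
    have h4 : multiplicity π (IsFractionRing.den A a : A) ≤
        m * multiplicity π f + multiplicity π (IsFractionRing.num A a) := by
      zify
      omega
    exact_mod_cast h4
  obtain ⟨b, hb⟩ := h1
  refine ⟨b, ?_⟩
  apply mul_left_cancel₀ hd'
  rw [← map_mul, ← hb, map_mul, map_pow, mul_left_comm]
  congr 1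
  have h3 := IsFractionRing.mk'_num_den' A a
  rw [div_eq_iff hd'] at h3
  rw [h3, mul_comm]

theorem div_pow_mem_divSections {r : ℚ} {f : A} (hf : f ≠ 0) {m : ℕ} (hm : (m : ℚ) ≤ r) (h : A) :
    algebraMap A (FractionRing A) h / algebraMap A (FractionRing A) f ^ m ∈ divSections r f := by
  by_cases h0 : h = 0
  · left
    rw [h0, map_zero, zero_div]
  right
  intro π hπ
  rw [← map_pow, ordAlong_div hπ h0 (pow_ne_zero m hf),
    FiniteMultiplicity.multiplicity_pow hπ (FiniteMultiplicity.of_prime_left hπ hf)]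
  have h1 : ((m * multiplicity π f : ℕ) : ℤ) ≤ ⌊r * (multiplicity π f : ℚ)⌋ := by
    rw [Int.le_floor]
    push_cast
    exact mul_le_mul_of_nonneg_right hm (by positivity)
  omega

end Divisor

/-! ### From a form on Witt vectors to a splitting of the pair -/

section PairSplitting

open WittVector

variable {p : ℕ} [Fact p.Prime] {A : Type*} [CommRing A] [IsDomain A] [UniqueFactorizationMonoid A]
  [CharP A p]

/-- The splitting is φ(a) = Ψ([f]^p a) / (f Ψ(1)). Multiplication by [f]^p = F[f] clears the poles
of the sections of pD, with a factor f to spare (f^2 in the last component), so Ψ takes values in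
fA. Moreover φ(F x) = Ψ(F(x [f])) / (f Ψ(1)) = x_0. -/
theorem isQuasiFSplitPair_of_form {f : A} (hf : f ≠ 0) {n : ℕ} (hn : 0 < n)
    (Ψ : WittVector p A →+ A) (hΨ : ∀ x a, Ψ (frobenius x * a) = x.coeff 0 * Ψ a)
    (hΨ1 : IsUnit (Ψ 1)) (hcongr : ∀ a b, (∀ t < n, a.coeff t = b.coeff t) → Ψ a = Ψ b)
    (hdvd : ∀ a, (∀ t, t + 1 < n → f ∣ a.coeff t) → (∀ t, t + 1 = n → f ^ 2 ∣ a.coeff t) → f ∣ Ψ a)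
    (hsq : 1 < n → ∀ π : A, Prime π → multiplicity π f ≤ 1) :
    IsQuasiFSplitPair p (1 - 2 / (p : ℚ) ^ n) f n := by
  classical
  have h2p := (Fact.out : p.Prime).two_le
  have hp0 : (0 : ℚ) < p := by exact_mod_cast (Fact.out : p.Prime).pos
  set K := FractionRing A
  have hinj : Function.Injective (algebraMap A K) := IsFractionRing.injective A K
  have : CharP K p := charP_of_injective_algebraMap hinj p
  set r : ℚ := 1 - 2 / (p : ℚ) ^ n with hr
  set θ : TruncatedWittVector p n K := truncate n (teichmuller p (algebraMap A K f) ^ p) with hθ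
  set W := wittDivSections p n (p * r) f with hW
  -- components of `[f] ^ p * a`
  have hrep : ∀ (a : TruncatedWittVector p n K) (b : WittVector p A),
      (∀ i : Fin n, algebraMap A K (b.coeff i) = algebraMap A K f ^ p ^ (i + 1 : ℕ) * a.coeff i) →
      truncate n (WittVector.map (algebraMap A K) b) = θ * a := by
    intro a b h
    rw [← truncate_out a, hθ, ← map_mul]
    rw [truncate_eq_iff]
    intro t ht
    rw [map_coeff, coeff_teichmuller_pow_mul, h ⟨t, ht⟩]
    congr 1
    exact (TruncatedWittVector.coeff_out a ⟨t, ht⟩).symm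
  have hex : ∀ a ∈ W, ∃ b : WittVector p A,
      truncate n (WittVector.map (algebraMap A K) b) = θ * a ∧ f ∣ Ψ b := by
    intro a ha
    have h1 : ∀ i : Fin n, (i : ℕ) + 1 < n → ∃ b, f ∣ b ∧
        algebraMap A K b = algebraMap A K f ^ p ^ (i + 1 : ℕ) * a.coeff i := by
      intro i hi
      have h3 := Nat.one_le_pow (i + 1) p (by omega)
      -- The defect 2 p^(i+1) / p^n is positive, so along a prime of multiplicity one the floor
      -- drops by at least one. Multiplicities above one could defeat this.
      obtain ⟨b, hb⟩ := exists_eq_pow_mul_of_mem_divSections hf (m := p ^ (i + 1 : ℕ) - 1)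
        (fun π hπ => by
          have h4 := hsq (by omega) π hπ
          rw [← Int.lt_add_one_iff, Int.floor_lt]
          rcases Nat.le_one_iff_eq_zero_or_eq_one.1 h4 with h5 | h5
          · simp [h5]
          · rw [h5]
            push_cast [h3]
            have h6 : (0 : ℚ) < (p : ℚ) ^ (i : ℕ) * (p * (2 / (p : ℚ) ^ n)) := by positivity
            rw [hr, pow_succ]
            linarith) (ha i)
      refine ⟨f * b, dvd_mul_right _ _, ?_⟩
      rw [map_mul, hb, ← mul_assoc, ← pow_succ', Nat.sub_add_cancel h3]
    have h2 : ∀ i : Fin n, (i : ℕ) + 1 = n → ∃ b, f ^ 2 ∣ b ∧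
        algebraMap A K b = algebraMap A K f ^ p ^ (i + 1 : ℕ) * a.coeff i := by
      intro i hi
      have h3 : 2 ≤ p ^ (i + 1 : ℕ) := h2p.trans (Nat.le_self_pow (by omega) p)
      -- In the last component the defect is exactly 2, so no bound on multiplicities is needed.
      obtain ⟨b, hb⟩ := exists_eq_pow_mul_of_mem_divSections hf (m := p ^ (i + 1 : ℕ) - 2)
        (fun π hπ => by
          rw [← Int.lt_add_one_iff, Int.floor_lt]
          push_cast [h3]
          have h6 : (p : ℚ) ^ (i : ℕ) * (p * r) = (p : ℚ) ^ (i + 1 : ℕ) - 2 := by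
            have h7 : (p : ℚ) ^ n = (p : ℚ) ^ (i + 1 : ℕ) := by rw [hi]
            rw [hr, h7, ← mul_assoc, ← pow_succ, mul_sub, mul_one, mul_div_cancel₀ _ (by positivity)]
          rw [h6]
          linarith) (ha i)
      refine ⟨f ^ 2 * b, dvd_mul_right _ _, ?_⟩
      rw [map_mul, map_pow, hb, ← mul_assoc, ← pow_add, Nat.add_sub_cancel' h3]
    have h3 : ∀ i : Fin n, ∃ b, ((i : ℕ) + 1 < n → f ∣ b) ∧ ((i : ℕ) + 1 = n → f ^ 2 ∣ b) ∧
        algebraMap A K b = algebraMap A K f ^ p ^ (i + 1 : ℕ) * a.coeff i := by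
      intro i
      by_cases hi : (i : ℕ) + 1 < n
      · obtain ⟨b, hb, hb'⟩ := h1 i hi
        exact ⟨b, fun _ => hb, fun h => by omega, hb'⟩
      · have := i.2
        obtain ⟨b, hb, hb'⟩ := h2 i (by omega)
        exact ⟨b, fun _ => by omega, fun _ => hb, hb'⟩
    choose b hb1 hb2 hb3 using h3
    have hb : ∀ i : Fin n, (WittVector.mk p fun t => if ht : t < n then b ⟨t, ht⟩ else 0).coeff i =
        b i := fun i => by simp
    refine ⟨WittVector.mk p fun t => if ht : t < n then b ⟨t, ht⟩ else 0, hrep _ _ fun i => ?_,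
      hdvd _ (fun t ht => ?_) fun t ht => ?_⟩
    · rw [hb, hb3]
    · have := hb1 ⟨t, by omega⟩ ht
      rwa [← hb] at this
    · have := hb2 ⟨t, by omega⟩ ht
      rwa [← hb] at this
  choose! num hnum hnumdvd using hex
  choose! e he using hnumdvd
  have hmul : ∀ (x : TruncatedWittVector p n A) (b : TruncatedWittVector p n K),
      wittMap p (algebraMap A K) (wittFrob p x) * b =
        truncate n (WittVector.map (algebraMap A K) (frobenius x.out)) * b := by
    intro x b
    conv_lhs => rw [← truncate_out x, wittFrob_truncate, wittMap_truncate]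
  -- the value of `φ` depends only on a representative of `[f] ^ p * a`
  let φ : TruncatedWittVector p n K → A := fun a =>
    if h : ∃ z : A × WittVector p A,
      truncate n (WittVector.map (algebraMap A K) z.2) = θ * a ∧ Ψ z.2 = f * z.1 then
        h.choose.1 * hΨ1.unit⁻¹.1 else 0
  have hφ : ∀ (a : TruncatedWittVector p n K) (b : WittVector p A) (e : A),
      truncate n (WittVector.map (algebraMap A K) b) = θ * a → Ψ b = f * e →
      φ a = e * hΨ1.unit⁻¹.1 := by
    intro a b e hb hbe
    have h : ∃ z : A × WittVector p A,
      truncate n (WittVector.map (algebraMap A K) z.2) = θ * a ∧ Ψ z.2 = f * z.1 :=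
      ⟨(e, b), hb, hbe⟩
    have h1 : φ a = h.choose.1 * hΨ1.unit⁻¹.1 := dif_pos h
    rw [h1]
    congr 1
    obtain ⟨h3, h4⟩ := h.choose_spec
    apply mul_left_cancel₀ hf
    rw [← h4, ← hbe]
    refine hcongr _ _ fun t ht => hinj ?_
    have := truncate_eq_iff.1 (h3.trans hb.symm) t ht
    rwa [map_coeff, map_coeff] at this
  refine ⟨hn, φ, fun a ha b hb => ?_, fun x b hb => ?_, fun x => ?_⟩
  · rw [hφ a _ _ (hnum a ha) (he a ha), hφ b _ _ (hnum b hb) (he b hb),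
      hφ (a + b) (num a + num b) (e a + e b), add_mul]
    · rw [map_add, map_add, hnum a ha, hnum b hb, mul_add]
    · rw [map_add, he a ha, he b hb, mul_add]
  · rw [hφ b _ _ (hnum b hb) (he b hb), hφ _ (frobenius x.out * num b) (x.coeff ⟨0, hn⟩ * e b),
      mul_assoc]
    · rw [map_mul, map_mul, hnum b hb, hmul]
      ring
    · rw [hΨ, he b hb, ← TruncatedWittVector.coeff_out x ⟨0, hn⟩]
      ring
  · have h1 := hmul x 1
    rw [mul_one, mul_one] at h1
    rw [hφ _ (frobenius (x.out * teichmuller p f)) (x.coeff ⟨0, hn⟩ * Ψ 1), mul_assoc,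
      IsUnit.mul_val_inv, mul_one]
    · rw [h1, map_mul, map_mul, map_mul, frobenius_teichmuller, map_pow, map_teichmuller, hθ]
      ring
    · have := hΨ (x.out * teichmuller p f) 1
      rw [mul_one] at this
      rw [this, mul_coeff_zero, teichmuller_coeff_zero, ← TruncatedWittVector.coeff_out x ⟨0, hn⟩]
      ring

end PairSplitting
end QFS
end

open MvPolynomial AlgebraicGeometry CategoryTheory Opposite
noncomputable section
namespace QFS

/-! ### Splitting the pair when the rows are independent -/

section PairExistence

open WittVector

variable {p : ℕ} [Fact p.Prime] {k : Type*} [Field k] [CharP k p] [PerfectRing k p] {N : ℕ}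
  {f δ c : MvPolynomial (Fin (N + 1)) k}

/-- The operation z ↦ (z^p - F z)/p obeys a Leibniz rule modulo p; apply it to P^2 G for termwise
lifts P, G of π and g. The termwise lift of π^2 g differs from P^2 G by p r, which accounts for the
p-th power. -/
theorem exists_delta_eq_of_sq_dvd {Dt : WittVector p (MvPolynomial (Fin (N + 1)) k)}
    (hDt : (p : WittVector p (MvPolynomial (Fin (N + 1)) k)) * Dt =
      termwiseLift p f ^ p - frobenius (termwiseLift p f)) (hDt0 : Dt.coeff 0 = δ)
    {π : MvPolynomial (Fin (N + 1)) k} (hπ : π ^ 2 ∣ f) :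
    ∃ α β r, δ = (π ^ 2) ^ p * α + 2 * (π ^ p * β) - r ^ p := by
  obtain ⟨g, rfl⟩ := hπ
  have h2p := (Fact.out : p.Prime).two_le
  set P := termwiseLift p π with hP
  set G := termwiseLift p g with hG
  have hP0 : P.coeff 0 = π := termwiseLift_coeff_zero π
  have hG0 : G.coeff 0 = g := termwiseLift_coeff_zero g
  have hPm : P ∈ liftSubring p := termwiseLift_mem_liftSubring π
  have hGm : G ∈ liftSubring p := termwiseLift_mem_liftSubring g
  obtain ⟨dP, -, hdP⟩ := exists_delta_lift hPm
  obtain ⟨dG, -, hdG⟩ := exists_delta_lift hGm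
  obtain ⟨r, -, hr⟩ := exists_eq_p_mul_of_mem_liftSubring
    (sub_mem (termwiseLift_mem_liftSubring (p := p) (π ^ 2 * g)) (mul_mem (pow_mem hPm 2) hGm)) (by
      change WittVector.constantCoeff (termwiseLift p (π ^ 2 * g) - P ^ 2 * G) = 0
      rw [map_sub, map_mul, map_pow]
      change (termwiseLift p (π ^ 2 * g)).coeff 0 - P.coeff 0 ^ 2 * G.coeff 0 = 0
      rw [termwiseLift_coeff_zero, hP0, hG0, sub_self])
  have hft : termwiseLift p (π ^ 2 * g) = P ^ 2 * G +
      (p : WittVector p (MvPolynomial (Fin (N + 1)) k)) * r := by rw [← hr]; ring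
  obtain ⟨e, he⟩ := exists_add_pow_prime (Fact.out : p.Prime) (P ^ 2 * G) ((p : WittVector p (MvPolynomial (Fin (N + 1)) k)) * r)
  have hpp : ((p : WittVector p (MvPolynomial (Fin (N + 1)) k)) * r) ^ p = (p : WittVector p (MvPolynomial (Fin (N + 1)) k)) * (p * ((p : WittVector p (MvPolynomial (Fin (N + 1)) k)) ^ (p - 2) * r ^ p)) := by
    have : (p : WittVector p (MvPolynomial (Fin (N + 1)) k)) ^ p = p * (p * (p : WittVector p (MvPolynomial (Fin (N + 1)) k)) ^ (p - 2)) := by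
      rw [← pow_succ', ← pow_succ']; congr 1; omega
    rw [mul_pow, this]
    ring
  have hp0 : (p : WittVector p (MvPolynomial (Fin (N + 1)) k)) ≠ 0 := p_nonzero p _
  have key : Dt = (P ^ 2) ^ p * dG + 2 * (P ^ p * (frobenius G * dP)) - frobenius r +
      p * (-(frobenius G * dP ^ 2) + (P ^ 2 * G) ^ (p - 1) * r + (P ^ 2 * G) * p * r ^ 2 * e +
        (p : WittVector p (MvPolynomial (Fin (N + 1)) k)) ^ (p - 2) * r ^ p) := by
    apply mul_left_cancel₀ hp0
    rw [hDt, hft, he, hpp]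
    have hFP : frobenius P = P ^ p - p * dP := by rw [← hdP]; ring
    have hFG : G ^ p = frobenius G + p * dG := by rw [← hdG]; ring
    rw [map_add, map_mul, map_mul, map_pow, map_natCast, hFP, mul_pow, hFG]
    ring
  have h0 := congrArg (WittVector.constantCoeff) key
  have c1 : ∀ x : WittVector p (MvPolynomial (Fin (N + 1)) k), WittVector.constantCoeff (frobenius x) = x.coeff 0 ^ p := fun x =>
    coeff_frobenius_charP p x 0
  have c2 : ∀ x : WittVector p (MvPolynomial (Fin (N + 1)) k), WittVector.constantCoeff x = x.coeff 0 := fun x => rfl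
  refine ⟨dG.coeff 0, g ^ p * dP.coeff 0, r.coeff 0, ?_⟩
  rw [map_add, map_sub, map_add, map_mul WittVector.constantCoeff (p : WittVector p (MvPolynomial (Fin (N + 1)) k)), map_natCast,
    CharP.cast_eq_zero, zero_mul, add_zero, map_mul, map_mul, map_mul, map_mul, map_ofNat,
    map_pow, map_pow, map_pow, c1, c1] at h0
  simp only [c2] at h0
  rw [hDt0, hP0, hG0] at h0
  exact h0

/-- If π^2 divided f, the formula for δ would make T c divisible by π: its r^p part contributes r
u(f^(p-2) c) = 0. Then π would divide the unit u(f^(p-2) T c). -/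
theorem multiplicity_le_one_of_traceU (hf : f ≠ 0)
    {Dt : WittVector p (MvPolynomial (Fin (N + 1)) k)}
    (hDt : (p : WittVector p (MvPolynomial (Fin (N + 1)) k)) * Dt =
      termwiseLift p f ^ p - frobenius (termwiseLift p f)) (hDt0 : Dt.coeff 0 = δ)
    (h1 : traceU p (f ^ (p - 2) * c) = 0)
    (h2 : IsUnit (traceU p (f ^ (p - 2) * traceU p (δ * f ^ (p - 2) * c))))
    {π : MvPolynomial (Fin (N + 1)) k} (hπ : Prime π) : multiplicity π f ≤ 1 := by
  have h2p := (Fact.out : p.Prime).two_le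
  by_contra hlt
  have hsq : π ^ 2 ∣ f := pow_dvd_of_le_multiplicity (by omega)
  obtain ⟨α, β, r, hδ⟩ := exists_delta_eq_of_sq_dvd hDt hDt0 hsq
  have hT : traceU p (δ * f ^ (p - 2) * c) = π ^ 2 * traceU p (α * f ^ (p - 2) * c) +
      π * traceU p (2 * (β * f ^ (p - 2) * c)) := by
    have : δ * f ^ (p - 2) * c = (π ^ 2) ^ p * (α * f ^ (p - 2) * c) +
        π ^ p * (2 * (β * f ^ (p - 2) * c)) - r ^ p * (f ^ (p - 2) * c) := by
      rw [hδ]; ring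
    rw [this, traceU_sub, traceU_add, traceU_pow_mul, traceU_pow_mul, traceU_pow_mul, h1, mul_zero,
      sub_zero]
  refine hπ.not_isUnit (isUnit_of_dvd_unit (dvd_traceU_of_pow_dvd (p := p) ?_) h2)
  -- For p > 2, f^(p-2) contributes π^(2p-4) and T c one more factor, in all 2p - 3 ≥ p. For p = 2
  -- the power of f is trivial, but the summand with the factor 2 vanishes and leaves π^2 = π^p.
  rcases h2p.eq_or_lt with h | h
  · have h20 : (2 : MvPolynomial (Fin (N + 1)) k) = 0 := by
      have := CharP.cast_eq_zero (MvPolynomial (Fin (N + 1)) k) p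
      rw [← h] at this
      exact_mod_cast this
    rw [hT, h20, zero_mul, traceU_zero, mul_zero, add_zero]
    refine Dvd.dvd.mul_left (Dvd.dvd.mul_right ?_ _) _
    rw [← h]
  · have : π ^ p ∣ (π ^ 2) ^ (p - 2) * π := by
      rw [← pow_mul, ← pow_succ]
      exact pow_dvd_pow π (by omega)
    refine this.trans (mul_dvd_mul (pow_dvd_pow_of_dvd hsq _) ?_)
    rw [hT]
    exact dvd_add (Dvd.dvd.mul_right (dvd_pow_self π two_ne_zero) _) (dvd_mul_right _ _)

variable {m : ℕ} {M : Fin m → Fin (N + 1) →₀ ℕ}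

theorem isQuasiFSplitPair_of_rowR (hM : Function.Injective M) {q : Fin (N + 1) → ℕ}
    (hq : ∀ i, 0 < q i) (hMq : ∀ a, a ∈ Set.range M ↔ Finsupp.weight q a = ∑ i, q i)
    (hf : f.IsWeightedHomogeneous q (∑ i, q i)) (hf0 : f ≠ 0)
    (hc : c.IsWeightedHomogeneous q (∑ i, q i)) {n : ℕ} 
    (h0 : ∀ l < n, rowR p M f (l + 1) ⬝ᵥ coeffVec M c = 0)
    (h1 : rowR p M f (n + 1) ⬝ᵥ coeffVec M c ≠ 0)
    (hsq : 0 < n → ∃ c' : MvPolynomial (Fin (N + 1)) k, c'.IsWeightedHomogeneous q (∑ i, q i) ∧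
      rowR p M f 1 ⬝ᵥ coeffVec M c' = 0 ∧ rowR p M f 2 ⬝ᵥ coeffVec M c' ≠ 0) :
    IsQuasiFSplitPair p (1 - 2 / (p : ℚ) ^ (n + 1)) f (n + 1) := by
  have hp := (Fact.out : p.Prime).ne_zero
  obtain ⟨D, Dt, hD, hDt, hDtm, hDt0⟩ := exists_termwiseLift_delta (p := p) hM
    fun a ha => (hMq a).2 (hf ha)
  have hzero : ∀ (c : MvPolynomial (Fin (N + 1)) k) (_ : c.IsWeightedHomogeneous q (∑ i, q i))
      (l : ℕ), rowR p M f (l + 1) ⬝ᵥ coeffVec M c = 0 →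
      traceU p (f ^ (p - 2) * (fun h => traceU p (delta p M f * f ^ (p - 2) * h))^[l] c) = 0 := by
    intro c hc l h
    obtain ⟨r, hr, hr'⟩ := traceU_iterate_eq_C hM hq hMq hf hc l
    rw [h] at hr'
    rw [hr, pow_eq_zero_iff (pow_ne_zero _ hp) |>.1 hr', C_0]
  have hunit : ∀ (c : MvPolynomial (Fin (N + 1)) k) (_ : c.IsWeightedHomogeneous q (∑ i, q i))
      (l : ℕ), rowR p M f (l + 1) ⬝ᵥ coeffVec M c ≠ 0 →
      IsUnit (traceU p
        (f ^ (p - 2) * (fun h => traceU p (delta p M f * f ^ (p - 2) * h))^[l] c)) := by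
    intro c hc l h
    obtain ⟨r, hr, hr'⟩ := traceU_iterate_eq_C hM hq hMq hf hc l
    rw [hr]
    refine (IsUnit.mk0 r fun h0 => h ?_).map C
    rw [← hr', h0, zero_pow (pow_ne_zero _ hp)]
  have H : ∀ j, j + 1 < n + 1 →
      traceU p (f ^ (p - 2) * (fun h => traceU p (delta p M f * f ^ (p - 2) * h))^[j] c) = 0 :=
    fun j hj => hzero c hc j (h0 j (by omega))
  refine isQuasiFSplitPair_of_form hf0 n.succ_pos
    (AddMonoidHom.mk' (wittForm p f (delta p M f) c (n + 1)) (wittForm_add H))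
    (wittForm_frobenius_mul H) ?_ (fun a b h => wittForm_eq_of_coeff_eq H h)
    (fun a ha ha' => dvd_wittForm hD hDt hDtm hDt0 H ha fun t ht => (ha' t ht).mul_right _) ?_
  · change IsUnit (wittForm p f (delta p M f) c (n + 1) 1)
    rw [wittForm_one H]
    exact hunit c hc n h1
  · intro hn π hπ
    obtain ⟨c', hc', h1', h2'⟩ := hsq (by omega)
    exact multiplicity_le_one_of_traceU hf0 hDt hDt0 (hzero c' hc' 0 h1') (hunit c' hc' 1 h2') hπ

end PairExistence
end QFS
end

open MvPolynomial AlgebraicGeometry CategoryTheory Opposite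
noncomputable section
namespace QFS

/-! ### Filtrations of monoid algebras by exponents -/

section ExpFil

variable {k : Type*} [Field k] {Λ : Type*} [AddCommMonoid Λ]

/-- The elements of a monoid algebra all of whose exponents satisfy `c ≤ v a`. -/
def expFil (k : Type*) [Field k] (v : Λ →+ ℤ) (c : ℤ) : Submodule k (AddMonoidAlgebra k Λ) where
  carrier := {b | ∀ a, b.coeff a ≠ 0 → c ≤ v a}
  zero_mem' := fun a h => absurd rfl h
  add_mem' := by
    intro b b' hb hb' a h
    by_cases h1 : b.coeff a = 0
    · refine hb' a fun h2 => h ?_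
      rw [AddMonoidAlgebra.coeff_add, Finsupp.add_apply, h1, h2, add_zero]
    · exact hb a h1
  smul_mem' := by
    intro r b hb a h
    refine hb a fun h1 => h ?_
    rw [AddMonoidAlgebra.coeff_smul, Finsupp.smul_apply, h1, smul_zero]

theorem single_mem_expFil {v : Λ →+ ℤ} {c : ℤ} {a : Λ} (h : c ≤ v a) (r : k) :
    AddMonoidAlgebra.single a r ∈ expFil k v c := by
  classical
  intro a' ha'
  rw [AddMonoidAlgebra.coeff_single, Finsupp.single_apply] at ha'
  split_ifs at ha' with h1
  · rwa [← h1]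
  · exact absurd rfl ha'

theorem expFil_mono (v : Λ →+ ℤ) {c c' : ℤ} (h : c' ≤ c) : expFil k v c ≤ expFil k v c' :=
  fun _ hb a ha => h.trans (hb a ha)

theorem mul_mem_expFil {v : Λ →+ ℤ} {c c' : ℤ} {b b' : AddMonoidAlgebra k Λ}
    (hb : b ∈ expFil k v c) (hb' : b' ∈ expFil k v c') : b * b' ∈ expFil k v (c + c') := by
  classical
  intro a ha
  have h1 := AddMonoidAlgebra.support_coeff_mul_subset b b' (Finsupp.mem_support_iff.2 ha)
  obtain ⟨x, hx, y, hy, rfl⟩ := Finset.mem_add.1 h1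
  rw [map_add]
  exact add_le_add (hb x (Finsupp.mem_support_iff.1 hx)) (hb' y (Finsupp.mem_support_iff.1 hy))

theorem one_mem_expFil (v : Λ →+ ℤ) : (1 : AddMonoidAlgebra k Λ) ∈ expFil k v 0 :=
  single_mem_expFil (by rw [map_zero]) 1

theorem pow_mem_expFil {v : Λ →+ ℤ} {c : ℤ} {b : AddMonoidAlgebra k Λ} (hb : b ∈ expFil k v c)
    (n : ℕ) : b ^ n ∈ expFil k v (n * c) := by
  induction n with
  | zero => simpa using one_mem_expFil v
  | succ n ih =>
    rw [pow_succ]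
    have := mul_mem_expFil ih hb
    convert this using 1
    push_cast
    ring

theorem expFil_pow_le (v : Λ →+ ℤ) (c : ℤ) (n : ℕ) :
    expFil k v c ^ n ≤ expFil k v (n * c) := by
  induction n with
  | zero =>
    rw [pow_zero, Submodule.one_le]
    simpa using one_mem_expFil v
  | succ n ih =>
    rw [pow_succ]
    refine Submodule.mul_le.2 fun a ha b hb => ?_
    have := mul_mem_expFil (ih ha) hb
    convert this using 1
    push_cast
    ring

/-- The elements of a monoid algebra divisible by `f ^ l` with quotient in `expFil v c`. -/
def mulFil (f : AddMonoidAlgebra k Λ) (v : Λ →+ ℤ) (l : ℕ) (c : ℤ) :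
    Submodule k (AddMonoidAlgebra k Λ) :=
  (expFil k v c).map (LinearMap.mulLeft k (f ^ l))

variable {f : AddMonoidAlgebra k Λ} {v : Λ →+ ℤ}

theorem mem_mulFil {l : ℕ} {c : ℤ} {b : AddMonoidAlgebra k Λ} :
    b ∈ mulFil f v l c ↔ ∃ e ∈ expFil k v c, f ^ l * e = b := Iff.rfl

/-- Surplus factors of f are moved into the quotient; each costs one unit of exponent since f has
exponents at least -1. -/
theorem mulFil_le (hf : f ∈ expFil k v (-1)) {l m : ℕ} {c c' : ℤ} (hl : l ≤ m)
    (hc : c' + (m - l) ≤ c) : mulFil f v m c ≤ mulFil f v l c' := by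
  rintro _ ⟨e, he, rfl⟩
  refine ⟨f ^ (m - l) * e, expFil_mono v ?_ (mul_mem_expFil (pow_mem_expFil hf (m - l)) he), ?_⟩
  · rw [Nat.cast_sub hl]
    linarith
  · simp only [LinearMap.mulLeft_apply]
    rw [← mul_assoc, ← pow_add, Nat.add_sub_cancel' hl]

theorem mulFil_pow_le (l : ℕ) (c : ℤ) (n : ℕ) :
    mulFil f v l c ^ n ≤ mulFil f v (n * l) (n * c) := by
  induction n with
  | zero =>
    rw [pow_zero, Submodule.one_le]
    exact ⟨1, by simpa using one_mem_expFil v, by simp⟩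
  | succ n ih =>
    rw [pow_succ]
    refine Submodule.mul_le.2 fun a ha b hb => ?_
    obtain ⟨x, hx, rfl⟩ := ih ha
    obtain ⟨y, hy, rfl⟩ := hb
    refine mem_mulFil.2 ⟨x * y, ?_, ?_⟩
    · have := mul_mem_expFil hx hy
      convert this using 1
      push_cast
      ring
    · simp only [LinearMap.mulLeft_apply]
      rw [show (n + 1) * l = n * l + l by ring, pow_add]
      ring

/-- The sequence `f • v^{≥ 1}, …, f • v^{≥ 1}, f² • v^{≥ 2}, ⊤, …`. -/
def errSeq (f : AddMonoidAlgebra k Λ) (v : Λ →+ ℤ) (n t : ℕ) : Submodule k (AddMonoidAlgebra k Λ) :=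
  if t + 1 < n then mulFil f v 1 1 else if t + 1 = n then mulFil f v 2 2 else ⊤

theorem mulFil_le_errSeq (hf : f ∈ expFil k v (-1)) {l : ℕ} (hl : 2 ≤ l) (n t : ℕ) :
    mulFil f v l l ≤ errSeq f v n t := by
  rw [errSeq]
  split_ifs
  · exact mulFil_le hf (by omega) (by push_cast; linarith)
  · exact mulFil_le hf (by omega) (by push_cast; linarith)
  · exact le_top

theorem admissible_errSeq {p : ℕ} (hp : p.Prime) (hf : f ∈ expFil k v (-1)) (n : ℕ) :
    Admissible p (errSeq f v n) := by
  intro t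
  by_cases h : t + 1 < n
  · have : errSeq f v n t = mulFil f v 1 1 := if_pos h
    rw [this]
    refine (mulFil_pow_le 1 1 p).trans ?_
    rw [mul_one, mul_one]
    exact mulFil_le_errSeq hf hp.two_le n _
  · have : errSeq f v n (t + 1) = ⊤ := by rw [errSeq, if_neg (by omega), if_neg (by omega)]
    rw [this]
    exact le_top

end ExpFil

/-! ### The expansion of `F [f]` -/

section Core

open WittVector

variable {p : ℕ} [Fact p.Prime] {k : Type*} [Field k] [CharP k p] [PerfectRing k p]
  {Λ : Type*} [AddCommMonoid Λ] {ι : Type*}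

theorem coeff_iterate_verschiebung {R : Type*} [CommRing R] (x : WittVector p R) (j t : ℕ) :
    (verschiebung^[j] x).coeff t = if j ≤ t then x.coeff (t - j) else 0 := by
  induction j generalizing t with
  | zero => simp
  | succ j ih =>
    rw [Function.iterate_succ_apply']
    rcases t with _ | t
    · rw [verschiebung_coeff_zero, if_neg (by omega)]
    · rw [verschiebung_coeff_succ, ih]
      simp

theorem iterate_verschiebung_mem {R l : Type*} [CommRing R] [CharP R p] [CommRing l] [Algebra l R]
    {J : ℕ → Submodule l R} {hJ : Admissible p J} {x : WittVector p R} {j : ℕ}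
    (hx : ∀ t, x.coeff t ∈ J (t + j)) : verschiebung^[j] x ∈ wittSubgroup J hJ := by
  intro t
  rw [coeff_iterate_verschiebung]
  split_ifs with h
  · have := hx (t - j)
    rwa [Nat.sub_add_cancel h] at this
  · exact zero_mem _

theorem iterate_verschiebung_add {R : Type*} [CommRing R] (j : ℕ) (x y : WittVector p R) :
    verschiebung^[j] (x + y) = verschiebung^[j] x + verschiebung^[j] y :=
  iterate_map_add verschiebung j x y

theorem iterate_verschiebung_sum {R α : Type*} [CommRing R] (j : ℕ) (s : Finset α)
    (x : α → WittVector p R) :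
    verschiebung^[j] (∑ a ∈ s, x a) = ∑ a ∈ s, verschiebung^[j] (x a) := by
  induction j with
  | zero => rfl
  | succ j ih => simp only [Function.iterate_succ_apply', ih, map_sum]

theorem iterate_verschiebung_p_mul {R : Type*} [CommRing R] [CharP R p] (j : ℕ)
    (x : WittVector p R) : verschiebung^[j] ((p : WittVector p R) * x) = p * verschiebung^[j] x := by
  induction j with
  | zero => rfl
  | succ j ih => rw [Function.iterate_succ_apply', ih, verschiebung_p_mul, Function.iterate_succ_apply']

theorem admissible_span {R : Type*} [CommRing R] (f : R) :
    Admissible p fun _ : ℕ => Ideal.span {f} :=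
  fun _ => Ideal.pow_le_self (Fact.out : p.Prime).ne_zero

/-- The Witt vectors with components divisible by `f`. -/
def wittDvd (p : ℕ) [Fact p.Prime] {R : Type*} [CommRing R] [CharP R p] (f : R) :
    AddSubgroup (WittVector p R) :=
  wittSubgroup (fun _ : ℕ => Ideal.span {f}) (admissible_span f)

theorem iterate_verschiebung_mem_wittDvd {R : Type*} [CommRing R] [CharP R p] (f : R) {l : ℕ}
    (hl : l ≠ 0) (x : WittVector p R) (j : ℕ) :
    verschiebung^[j] (teichmuller p f ^ l * x) ∈ wittDvd p f := by
  refine iterate_verschiebung_mem fun t => ?_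
  rw [← map_pow, teichmuller_mul_coeff, Ideal.mem_span_singleton]
  exact Dvd.dvd.mul_right ((dvd_pow_self f hl).trans
    (dvd_pow_self _ (pow_ne_zero _ (Fact.out : p.Prime).ne_zero))) _

/-- The error term in the expansion of `F [f]`. -/
def errGroup {f : AddMonoidAlgebra k Λ} {v : ι → Λ →+ ℤ} (hf : ∀ i, f ∈ expFil k (v i) (-1))
    (n : ℕ) : AddSubgroup (WittVector p (AddMonoidAlgebra k Λ)) :=
  (wittDvd p f).map (AddMonoidHom.mulLeft (p : WittVector p (AddMonoidAlgebra k Λ))) ⊔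
    ⨆ i, wittSubgroup (errSeq f (v i) n) (admissible_errSeq (Fact.out : p.Prime) (hf i) n)

variable {f : AddMonoidAlgebra k Λ} {v : ι → Λ →+ ℤ} (hf : ∀ i, f ∈ expFil k (v i) (-1))

theorem p_mul_mem_errGroup (n : ℕ) {x : WittVector p (AddMonoidAlgebra k Λ)}
    (hx : x ∈ wittDvd p f) :
    (p : WittVector p (AddMonoidAlgebra k Λ)) * x ∈ errGroup (p := p) hf n :=
  AddSubgroup.mem_sup_left ⟨x, hx, rfl⟩

theorem mem_errGroup {n : ℕ} (i : ι) {x : WittVector p (AddMonoidAlgebra k Λ)}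
    (hx : ∀ t, x.coeff t ∈ errSeq f (v i) n t) : x ∈ errGroup (p := p) hf n :=
  AddSubgroup.mem_sup_right (AddSubgroup.mem_iSup_of_mem i hx)

theorem admissible_expFil (v : Λ →+ ℤ) (c : ℤ) :
    Admissible p fun t => expFil k v (p ^ t * c) := by
  intro t
  refine (expFil_pow_le v _ p).trans (le_of_eq ?_)
  congr 1
  push_cast
  ring

theorem teichmuller_mem_wittSubgroup {R : Type*} [CommRing R] [CharP R p] [Algebra k R]
    {J : ℕ → Submodule k R} (hJ : Admissible p J) {x : R} (hx : x ∈ J 0) :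
    teichmuller p x ∈ wittSubgroup J hJ := by
  have := teichmuller_sum_mem_wittSubgroup hJ {()} (g := fun _ => x) (fun _ _ => hx)
  rwa [Finset.sum_singleton] at this

theorem termwiseLift_mem_wittSubgroup_expFil {v : Λ →+ ℤ} {c : ℤ} {b : AddMonoidAlgebra k Λ}
    (hb : b ∈ expFil k v c) :
    termwiseLift p b ∈ wittSubgroup _ (admissible_expFil (k := k) (p := p) v c) := by
  refine teichmuller_sum_mem_wittSubgroup _ _ fun a ha => ?_
  rw [pow_zero, one_mul]
  exact single_mem_expFil (hb a (Finsupp.mem_support_iff.1 ha)) _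

/-- The Witt vectors `g_0 = 1` and `g_{j + 1} = F(ft) ^ (p - 2) * Dt * F(g_j)`. -/
def coreSeq {R : Type*} [CommRing R] (ft Dt : WittVector p R) : ℕ → WittVector p R
  | 0 => 1
  | j + 1 => frobenius ft ^ (p - 2) * Dt * frobenius (coreSeq ft Dt j)

theorem coreSeq_mem_liftSubring {ft Dt : WittVector p (AddMonoidAlgebra k Λ)}
    (hft : ft ∈ liftSubring p) (hDt : Dt ∈ liftSubring p) (j : ℕ) :
    coreSeq ft Dt j ∈ liftSubring p := by
  induction j with
  | zero => exact one_mem _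
  | succ j ih =>
    exact mul_mem (mul_mem (pow_mem (frobenius_mem_liftSubring hft) _) hDt)
      (frobenius_mem_liftSubring ih)

theorem exists_eq_termwiseLift_add_p_mul {z : WittVector p (AddMonoidAlgebra k Λ)}
    (hz : z ∈ liftSubring p) :
    ∃ z', z = termwiseLift p (z.coeff 0) + (p : WittVector p (AddMonoidAlgebra k Λ)) * z' := by
  obtain ⟨y, -, hy⟩ := exists_eq_p_mul_of_mem_liftSubring
    (sub_mem hz (termwiseLift_mem_liftSubring (p := p) (z.coeff 0))) (by
      change WittVector.constantCoeff (z - termwiseLift p (z.coeff 0)) = 0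
      rw [map_sub]
      change z.coeff 0 - (termwiseLift p (z.coeff 0)).coeff 0 = 0
      rw [termwiseLift_coeff_zero, sub_self])
  exact ⟨y, by rw [← hy]; ring⟩

/-- Without a constant term, each term of b has exponent at least one in some direction i, so [f]
times its lift belongs to the i-th error subgroup. Working term by term keeps these as single
Teichmüller lifts. -/
theorem iterate_verschiebung_teichmuller_mul_termwiseLift_mem (hv : ∀ a : Λ, a ≠ 0 → ∃ i, 1 ≤ v i a)
    {n j : ℕ} (hj : j + 1 < n) {b : AddMonoidAlgebra k Λ} (hb : b.coeff 0 = 0) :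
    verschiebung^[j] (teichmuller p f * termwiseLift p b) ∈ errGroup (p := p) hf n := by
  rw [termwiseLift, Finset.mul_sum, iterate_verschiebung_sum]
  refine sum_mem fun a ha => ?_
  obtain ⟨i, hi⟩ := hv a (by rintro rfl; exact Finsupp.mem_support_iff.1 ha hb)
  refine mem_errGroup hf i (iterate_verschiebung_mem
    (hJ := admissible_errSeq (Fact.out : p.Prime) (hf i) n) fun t => ?_)
  rw [← map_mul]
  rcases t with _ | t
  · rw [teichmuller_coeff_zero, zero_add, errSeq, if_pos hj]
    exact ⟨_, single_mem_expFil hi (b.coeff a), by simp⟩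
  · rw [teichmuller_coeff_pos _ _ _ (by omega)]
    exact zero_mem _

/-- V D = [f] - f~ is homogeneous in the exponent filtration, so its component t+1 has exponents at
least -p^(t+1). -/
theorem verschiebung_coeff_mem_expFil (hf : ∀ i, f ∈ expFil k (v i) (-1)) {D : WittVector p (AddMonoidAlgebra k Λ)}
    (hD : teichmuller p f = termwiseLift p f + verschiebung D) (i : ι) (t : ℕ) :
    D.coeff t ∈ expFil k (v i) (p ^ (t + 1) * (-1)) := by
  have h : verschiebung D ∈ wittSubgroup _ (admissible_expFil (k := k) (p := p) (v i) (-1)) := by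
    have : verschiebung D = teichmuller p f - termwiseLift p f := by rw [hD]; ring
    rw [this]
    refine sub_mem (teichmuller_mem_wittSubgroup _ ?_) (termwiseLift_mem_wittSubgroup_expFil (hf i))
    rw [pow_zero, one_mul]
    exact hf i
  have := h (t + 1)
  rwa [verschiebung_coeff_succ] at this

/-- With l = p (p-1) p^t, the t-th component is f^l times something of exponent at least p^(t+2) -
p^(t+1) = l: the two Frobenius maps on b outweigh the poles of D. As l ≥ 2, this fits every slot of
the error sequence. -/
theorem iterate_verschiebung_teichmuller_mul_frobenius_mem
    (hv : ∀ a : Λ, a ≠ 0 → ∃ i, 1 ≤ v i a) (n j : ℕ) {D : WittVector p (AddMonoidAlgebra k Λ)}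
    (hD : teichmuller p f = termwiseLift p f + verschiebung D)
    {b : AddMonoidAlgebra k Λ} (hb : b.coeff 0 = 0) :
    verschiebung^[j] (teichmuller p f ^ (p * (p - 1)) * D *
      frobenius (frobenius (termwiseLift p b))) ∈ errGroup (p := p) hf n := by
  have h2p := (Fact.out : p.Prime).two_le
  rw [termwiseLift, map_sum, map_sum, Finset.mul_sum, iterate_verschiebung_sum]
  refine sum_mem fun a ha => ?_
  obtain ⟨i, hi⟩ := hv a (by rintro rfl; exact Finsupp.mem_support_iff.1 ha hb)
  refine mem_errGroup hf i (iterate_verschiebung_mem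
    (hJ := admissible_errSeq (Fact.out : p.Prime) (hf i) n) fun t => ?_)
  have e : teichmuller p f ^ (p * (p - 1)) * D * frobenius (frobenius
      (teichmuller p (AddMonoidAlgebra.single a (b.coeff a)))) =
      teichmuller p (f ^ (p * (p - 1)) * (AddMonoidAlgebra.single a (b.coeff a)) ^ (p * p)) * D := by
    rw [frobenius_teichmuller, map_pow, frobenius_teichmuller, map_mul, map_pow, map_pow, pow_mul]
    ring
  rw [e, teichmuller_mul_coeff]
  have hl : 2 ≤ p * (p - 1) * p ^ t := by
    have h1 : 1 ≤ p - 1 := by omega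
    have h3 : 1 ≤ p ^ t := Nat.one_le_pow _ _ (by omega)
    calc 2 = 2 * 1 * 1 := rfl
      _ ≤ _ := by gcongr
  refine mulFil_le_errSeq (hf i) hl n _ ⟨AddMonoidAlgebra.single a (b.coeff a) ^ (p * p * p ^ t) *
    D.coeff t, expFil_mono _ ?_ (mul_mem_expFil (pow_mem_expFil (single_mem_expFil hi _) _)
      (verschiebung_coeff_mem_expFil hf hD i t)), ?_⟩
  · rw [Nat.cast_mul, Nat.cast_mul, Nat.cast_sub (by omega)]
    push_cast
    ring_nf
    rfl
  · simp only [LinearMap.mulLeft_apply]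
    rw [mul_pow, ← pow_mul, ← pow_mul]
    ring

/-- Starting from F[f] = [f]^p, each use of `exists_teichmuller_pow_mul_eq` trades V^j([f]^p g_j)
for -V^(j+1)([f]^p g_(j+1)). What is left over is an error provided f^(p-1) g_j has no constant
term. -/
theorem frobenius_teichmuller_sub_mem [IsDomain (AddMonoidAlgebra k Λ)]
    (hv : ∀ a : Λ, a ≠ 0 → ∃ i, 1 ≤ v i a) (n : ℕ) {D Dt : WittVector p (AddMonoidAlgebra k Λ)}
    (hD : teichmuller p f = termwiseLift p f + verschiebung D)
    (hDt : (p : WittVector p (AddMonoidAlgebra k Λ)) * Dt =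
      termwiseLift p f ^ p - frobenius (termwiseLift p f)) (hDtm : Dt ∈ liftSubring p)
    {j : ℕ} (hj : j < n) (h0 : ∀ l < j,
      (f ^ (p - 1) * (coreSeq (termwiseLift p f) Dt l).coeff 0).coeff 0 = 0) :
    frobenius (teichmuller p f) - (-1) ^ j * verschiebung^[j] (teichmuller p f ^ p *
      coreSeq (termwiseLift p f) Dt j) ∈ errGroup (p := p) hf n := by
  have h2p := (Fact.out : p.Prime).two_le
  induction j with
  | zero =>
    rw [frobenius_teichmuller]
    simp [coreSeq]
  | succ j ih =>
    have h1 := ih (by omega) fun l hl => h0 l (by omega)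
    set g := coreSeq (termwiseLift p f) Dt j with hg
    set z := termwiseLift p f ^ (p - 1) * g with hz
    have hzm : z ∈ liftSubring p := mul_mem (pow_mem (termwiseLift_mem_liftSubring _) _)
      (coreSeq_mem_liftSubring (termwiseLift_mem_liftSubring _) hDtm j)
    have hz0 : (z.coeff 0).coeff 0 = 0 := by
      have : z.coeff 0 = f ^ (p - 1) * g.coeff 0 := by
        rw [hz, mul_coeff_zero]
        congr 1
        change WittVector.constantCoeff (termwiseLift p f ^ (p - 1)) = _
        rw [map_pow]
        congr 1
        exact termwiseLift_coeff_zero f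
      rw [this]
      exact h0 j (by omega)
    obtain ⟨z', hz'⟩ := exists_eq_termwiseLift_add_p_mul hzm
    obtain ⟨y, hy⟩ := exists_teichmuller_pow_pred_mul_eq hD g
    obtain ⟨E, hE⟩ := exists_teichmuller_pow_mul_eq hD hDt g
    rw [← hz] at hE hy
    -- the first error term
    have e1 : verschiebung^[j] (teichmuller p f * z) ∈ errGroup (p := p) hf n := by
      rw [hz', mul_add, iterate_verschiebung_add]
      refine add_mem (iterate_verschiebung_teichmuller_mul_termwiseLift_mem hf hv hj hz0) ?_
      rw [mul_left_comm, iterate_verschiebung_p_mul]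
      refine p_mul_mem_errGroup hf n ?_
      have := iterate_verschiebung_mem_wittDvd f one_ne_zero z' j
      rwa [pow_one] at this
    have e2 : verschiebung^[j + 2] (teichmuller p f ^ (p * (p - 1)) * D *
        frobenius (frobenius (teichmuller p f ^ (p - 1) * g))) ∈ errGroup (p := p) hf n := by
      have : teichmuller p f ^ (p * (p - 1)) * D *
          frobenius (frobenius (teichmuller p f ^ (p - 1) * g)) =
          teichmuller p f ^ (p * (p - 1)) * D * frobenius (frobenius (termwiseLift p (z.coeff 0))) +
          (p : WittVector p (AddMonoidAlgebra k Λ)) * (teichmuller p f ^ (p * (p - 1)) * (D *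
            (frobenius (frobenius z') + frobenius y))) := by
        rw [hy]
        conv_lhs => rw [hz']
        rw [map_add, map_add, map_add, map_add, frobenius_verschiebung, map_mul, map_mul, map_mul,
          map_natCast, map_natCast]
        ring
      rw [this, iterate_verschiebung_add, iterate_verschiebung_p_mul]
      refine add_mem (iterate_verschiebung_teichmuller_mul_frobenius_mem hf hv n _ hD hz0)
        (p_mul_mem_errGroup hf n (iterate_verschiebung_mem_wittDvd f ?_ _ _))
      exact Nat.mul_ne_zero (by omega) (by omega)
    have e3 : verschiebung^[j] ((p : WittVector p (AddMonoidAlgebra k Λ)) *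
        (teichmuller p f * E)) ∈ errGroup (p := p) hf n := by
      rw [iterate_verschiebung_p_mul]
      refine p_mul_mem_errGroup hf n ?_
      have := iterate_verschiebung_mem_wittDvd f one_ne_zero E j
      rwa [pow_one] at this
    have hsub : ∀ x y : WittVector p (AddMonoidAlgebra k Λ), verschiebung^[j] (x - y) =
        verschiebung^[j] x - verschiebung^[j] y := fun x y => iterate_map_sub verschiebung j x y
    have hsum : verschiebung^[j] (teichmuller p f ^ p * g) =
        verschiebung^[j] (teichmuller p f * z) -
        verschiebung^[j + 1] (teichmuller p f ^ p * coreSeq (termwiseLift p f) Dt (j + 1)) -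
        verschiebung^[j + 2] (teichmuller p f ^ (p * (p - 1)) * D *
        frobenius (frobenius (teichmuller p f ^ (p - 1) * g))) +
        verschiebung^[j] ((p : WittVector p (AddMonoidAlgebra k Λ)) * (teichmuller p f * E)) := by
      rw [hE, iterate_verschiebung_add, hsub, hsub]
      rfl
    have hsign : ∀ x ∈ errGroup (p := p) hf n,
        (-1 : WittVector p (AddMonoidAlgebra k Λ)) ^ j * x ∈ errGroup (p := p) hf n := by
      intro x hx
      rcases neg_one_pow_eq_or (WittVector p (AddMonoidAlgebra k Λ)) j with h | h
      · rwa [h, one_mul]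
      · rw [h, neg_one_mul]
        exact neg_mem hx
    rw [hsum] at h1
    have := add_mem h1 (hsign _ (add_mem (sub_mem e1 e2) e3))
    convert this using 1
    rw [pow_succ]
    ring

end Core
end QFS
end

open MvPolynomial AlgebraicGeometry CategoryTheory Opposite
noncomputable section
namespace QFS

/-! ### Laurent polynomials of degree zero -/

section Laurent

variable {N : ℕ}

/-- The exponents of Laurent monomials of weighted degree zero. -/
def degZero (q : Fin (N + 1) → ℕ) : AddSubgroup (Fin (N + 1) → ℤ) where
  carrier := {a | ∑ i, (q i : ℤ) * a i = 0}
  zero_mem' := by simp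
  add_mem' := by
    intro a b ha hb
    simp only [Set.mem_setOf_eq, Pi.add_apply, mul_add, Finset.sum_add_distrib] at ha hb ⊢
    rw [ha, hb, add_zero]
  neg_mem' := by
    intro a ha
    simp only [Set.mem_setOf_eq, Pi.neg_apply, mul_neg, Finset.sum_neg_distrib] at ha ⊢
    rw [ha, neg_zero]

theorem mem_degZero {q : Fin (N + 1) → ℕ} {a : Fin (N + 1) → ℤ} :
    a ∈ degZero q ↔ ∑ i, (q i : ℤ) * a i = 0 := Iff.rfl

/-- The `i`-th exponent. -/
def coord (q : Fin (N + 1) → ℕ) (i : Fin (N + 1)) : degZero q →+ ℤ :=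
  (Pi.evalAddMonoidHom _ i).comp (degZero q).subtype

@[simp]
theorem coord_apply (q : Fin (N + 1) → ℕ) (i : Fin (N + 1)) (a : degZero q) :
    coord q i a = (a : Fin (N + 1) → ℤ) i := rfl

/-- The weighted exponents sum to zero with positive weights, so they cannot all be nonpositive
unless all vanish. -/
theorem exists_one_le_coord {q : Fin (N + 1) → ℕ} (hq : ∀ i, 0 < q i) (a : degZero q)
    (ha : a ≠ 0) : ∃ i, 1 ≤ coord q i a := by
  by_contra! h
  have h1 : ∀ i ∈ Finset.univ, (q i : ℤ) * (a : Fin (N + 1) → ℤ) i ≤ 0 := fun i _ =>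
    mul_nonpos_of_nonneg_of_nonpos (by positivity) (by have := h i; rw [coord_apply] at this; omega)
  have h2 := (Finset.sum_eq_zero_iff_of_nonpos h1).1 (mem_degZero.1 a.2)
  refine ha (Subtype.ext (funext fun i => ?_))
  have h3 := h2 i (Finset.mem_univ i)
  rcases mul_eq_zero.1 h3 with h4 | h4
  · have := hq i
    omega
  · exact h4

theorem exists_zero_le_coord {q : Fin (N + 1) → ℕ} (hq : ∀ i, 0 < q i) (a : degZero q) :
    ∃ i, 0 ≤ coord q i a := by
  by_cases ha : a = 0
  · exact ⟨0, by rw [ha, map_zero]⟩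
  · obtain ⟨i, hi⟩ := exists_one_le_coord hq a ha
    exact ⟨i, by omega⟩

variable {k : Type*} [Field k]

instance isDomain_laurent (q : Fin (N + 1) → ℕ) : IsDomain (AddMonoidAlgebra k (degZero q)) :=
  have : UniqueSums (degZero q) :=
    UniqueSums.of_injective_addHom (degZero q).subtype.toAddHom Subtype.val_injective inferInstance
  inferInstance

theorem coeff_mapDomainRingHom {Λ Λ' : Type*} [AddCommMonoid Λ] [AddCommMonoid Λ'] {φ : Λ →+ Λ'}
    (hφ : Function.Injective φ) (x : AddMonoidAlgebra k Λ) (a : Λ) :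
    (AddMonoidAlgebra.mapDomainRingHom k φ x).coeff (φ a) = x.coeff a :=
  Finsupp.mapDomain_apply hφ x.coeff a

theorem mem_range_of_coeff_mapDomainRingHom_ne_zero {Λ Λ' : Type*} [AddCommMonoid Λ]
    [AddCommMonoid Λ'] {φ : Λ →+ Λ'} {x : AddMonoidAlgebra k Λ} {b : Λ'}
    (hb : (AddMonoidAlgebra.mapDomainRingHom k φ x).coeff b ≠ 0) : ∃ a, φ a = b := by
  by_contra h
  exact hb (Finsupp.mapDomain_notin_range x.coeff b fun ⟨a, ha⟩ => h ⟨a, ha⟩)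

/-- Exponents of monomials as exponents of Laurent monomials. -/
def castExp (N : ℕ) : (Fin (N + 1) →₀ ℕ) →+ (Fin (N + 1) → ℤ) where
  toFun a i := a i
  map_zero' := rfl
  map_add' a b := by ext i; simp

@[simp]
theorem castExp_apply (a : Fin (N + 1) →₀ ℕ) (i : Fin (N + 1)) : castExp N a i = a i := rfl

theorem castExp_injective : Function.Injective (castExp N) := fun a b h =>
  Finsupp.ext fun i => Int.ofNat.inj (congrFun h i)

/-- The embedding of polynomials into Laurent polynomials. -/
def polyToLaurent : MvPolynomial (Fin (N + 1)) k →+* AddMonoidAlgebra k (Fin (N + 1) → ℤ) :=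
  AddMonoidAlgebra.mapDomainRingHom k (castExp N)

/-- The embedding of degree zero Laurent polynomials into Laurent polynomials. -/
def zeroToLaurent (q : Fin (N + 1) → ℕ) :
    AddMonoidAlgebra k (degZero q) →+* AddMonoidAlgebra k (Fin (N + 1) → ℤ) :=
  AddMonoidAlgebra.mapDomainRingHom k (degZero q).subtype

theorem polyToLaurent_monomial (a : Fin (N + 1) →₀ ℕ) (c : k) :
    polyToLaurent (monomial a c) = AddMonoidAlgebra.single (castExp N a) c :=
  AddMonoidAlgebra.mapDomain_single

theorem zeroToLaurent_single (q : Fin (N + 1) → ℕ) (a : degZero q) (c : k) :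
    zeroToLaurent q (AddMonoidAlgebra.single a c) = AddMonoidAlgebra.single a.1 c :=
  AddMonoidAlgebra.mapDomain_single

theorem coeff_polyToLaurent_castExp (g : MvPolynomial (Fin (N + 1)) k) (a : Fin (N + 1) →₀ ℕ) :
    (polyToLaurent g).coeff (castExp N a) = g.coeff a :=
  coeff_mapDomainRingHom castExp_injective g a

theorem coeff_polyToLaurent_sub (g : MvPolynomial (Fin (N + 1)) k) (a b : Fin (N + 1) →₀ ℕ) :
    (polyToLaurent g).coeff (castExp N a - castExp N b) = (g * monomial b 1).coeff a := by
  rw [← coeff_polyToLaurent_castExp (g * monomial b 1), map_mul, polyToLaurent_monomial,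
    AddMonoidAlgebra.coeff_mul_single_apply, mul_one, sub_eq_add_neg]

/-- If `b = g / (x_0 ⋯ x_N) ^ s`, the coefficients of `b` are those of `g`. -/
theorem coeff_eq_of_mul_single {q : Fin (N + 1) → ℕ} {b : AddMonoidAlgebra k (degZero q)}
    {g : MvPolynomial (Fin (N + 1)) k} {s : ℕ}
    (h : zeroToLaurent q b * AddMonoidAlgebra.single (fun _ => (s : ℤ)) 1 = polyToLaurent g)
    (a : degZero q) : b.coeff a = (polyToLaurent g).coeff (a.1 + fun _ => (s : ℤ)) := by
  rw [← h, AddMonoidAlgebra.coeff_mul_single_apply, mul_one, add_neg_cancel_right]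
  exact (coeff_mapDomainRingHom (φ := (degZero q).subtype) Subtype.val_injective b a).symm

theorem coeff_mul_pow_char {p : ℕ} [Fact p.Prime] [CharP k p] {Λ : Type*} [AddCommGroup Λ]
    (x y : AddMonoidAlgebra k Λ) (c : Λ) :
    (x * y ^ p).coeff c = ∑ b ∈ y.coeff.support, x.coeff (c - p • b) * y.coeff b ^ p := by
  have h : y ^ p = ∑ b ∈ y.coeff.support, AddMonoidAlgebra.single (p • b) (y.coeff b ^ p) := by
    conv_lhs => rw [← AddMonoidAlgebra.sum_coeff_single y, Finsupp.sum]
    rw [sum_pow_char]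
    exact Finset.sum_congr rfl fun b _ => AddMonoidAlgebra.single_pow ..
  rw [h, Finset.mul_sum, AddMonoidAlgebra.coeff_sum, Finsupp.finsetSum_apply]
  refine Finset.sum_congr rfl fun b _ => ?_
  rw [AddMonoidAlgebra.coeff_mul_single_apply, sub_eq_add_neg]

end Laurent

/-! ### The rows R_n as coefficients of Laurent polynomials -/

section LaurentRows

open WittVector

variable {p : ℕ} [Fact p.Prime] {k : Type*} [Field k] [CharP k p] [PerfectRing k p] {N m : ℕ}
  {q : Fin (N + 1) → ℕ} {M : Fin m → Fin (N + 1) →₀ ℕ}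

theorem castExp_sub_one_mem {a : Fin (N + 1) →₀ ℕ} (ha : Finsupp.weight q a = ∑ i, q i) :
    (castExp N a - 1) ∈ degZero q := by
  rw [Finsupp.weight_apply, Finsupp.sum_fintype _ _ (by simp)] at ha
  rw [mem_degZero]
  simp only [Pi.sub_apply, castExp_apply, Pi.one_apply, mul_sub, mul_one, Finset.sum_sub_distrib]
  rw [sub_eq_zero]
  have := congrArg (Nat.cast (R := ℤ)) ha
  push_cast at this
  rw [← this]
  exact Finset.sum_congr rfl fun i _ => by simp [mul_comm]

/-- The exponents of `M_i / (x_0 ⋯ x_N)`. -/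
def shiftExp (hMq : ∀ i, Finsupp.weight q (M i) = ∑ i, q i) (i : Fin m) : degZero q :=
  ⟨castExp N (M i) - 1, castExp_sub_one_mem (hMq i)⟩

theorem shiftExp_injective (hM : Function.Injective M)
    (hMq : ∀ i, Finsupp.weight q (M i) = ∑ i, q i) : Function.Injective (shiftExp hMq) := by
  intro i j h
  have := congrArg Subtype.val h
  exact hM (castExp_injective (sub_left_injective this))

/-- The Laurent polynomial `f / (x_0 ⋯ x_N)`. -/
def shiftPoly (hMq : ∀ i, Finsupp.weight q (M i) = ∑ i, q i) (f : MvPolynomial (Fin (N + 1)) k) :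
    AddMonoidAlgebra k (degZero q) :=
  ∑ i, AddMonoidAlgebra.single (shiftExp hMq i) (f.coeff (M i))

variable (hMq : ∀ i, Finsupp.weight q (M i) = ∑ i, q i) {f : MvPolynomial (Fin (N + 1)) k}

theorem coeff_shiftPoly_ne_zero {a : degZero q} (h : (shiftPoly hMq f).coeff a ≠ 0) :
    a ∈ Set.range (shiftExp hMq) := by
  classical
  by_contra h1
  refine h ?_
  rw [shiftPoly, AddMonoidAlgebra.coeff_sum, Finsupp.finsetSum_apply]
  refine Finset.sum_eq_zero fun i _ => ?_
  rw [AddMonoidAlgebra.coeff_single, Finsupp.single_apply, if_neg fun h2 => h1 ⟨i, h2⟩]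

theorem coeff_shiftPoly (hM : Function.Injective M) (i : Fin m) :
    (shiftPoly hMq f).coeff (shiftExp hMq i) = f.coeff (M i) := by
  classical
  rw [shiftPoly, AddMonoidAlgebra.coeff_sum, Finsupp.finsetSum_apply, Finset.sum_eq_single i]
  · simp
  · intro j _ hj
    rw [AddMonoidAlgebra.coeff_single, Finsupp.single_apply,
      if_neg fun h => hj (shiftExp_injective hM hMq h)]
  · simp

theorem shiftPoly_mem_expFil (i : Fin (N + 1)) : shiftPoly hMq f ∈ expFil k (coord q i) (-1) := by
  refine sum_mem fun j _ => single_mem_expFil ?_ _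
  have : (0 : ℤ) ≤ M j i := by positivity
  simp [shiftExp]
  omega

theorem shiftExp_add_one (i : Fin m) :
    (shiftExp hMq i).1 + (fun _ => (1 : ℤ)) = castExp N (M i) := by
  ext j
  simp [shiftExp]

theorem zeroToLaurent_shiftPoly (hM : Function.Injective M)
    (hf : ∀ a, f.coeff a ≠ 0 → a ∈ Set.range M) :
    zeroToLaurent q (shiftPoly hMq f) * AddMonoidAlgebra.single (fun _ => (1 : ℤ)) 1 =
      polyToLaurent f := by
  conv_rhs => rw [← sum_monomial_eq hM hf]
  rw [shiftPoly, map_sum, map_sum, Finset.sum_mul]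
  refine Finset.sum_congr rfl fun i _ => ?_
  rw [zeroToLaurent_single, polyToLaurent_monomial, AddMonoidAlgebra.single_mul_single, mul_one,
    shiftExp_add_one]

theorem shiftPoly_ne_zero (hM : Function.Injective M)
    (hf : ∀ a, f.coeff a ≠ 0 → a ∈ Set.range M) (hf0 : f ≠ 0) : shiftPoly hMq f ≠ 0 := by
  intro h
  obtain ⟨a, ha⟩ := MvPolynomial.ne_zero_iff.1 hf0
  obtain ⟨i, rfl⟩ := hf a ha
  rw [← coeff_shiftPoly hMq hM, h] at ha
  exact ha rfl

theorem zeroToLaurent_delta {δ : AddMonoidAlgebra k (degZero q)} (hM : Function.Injective M)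
    (hδ : δ = ∑ β ∈ (Finset.univ.piAntidiag p : Finset (Fin m → ℕ)) with ∀ i, β i ≤ p - 1,
      ((Nat.multinomial Finset.univ β / p : ℕ) : AddMonoidAlgebra k (degZero q)) *
        ∏ i, AddMonoidAlgebra.single (shiftExp hMq i)
          ((shiftPoly hMq f).coeff (shiftExp hMq i)) ^ β i) :
    zeroToLaurent q δ * AddMonoidAlgebra.single (fun _ => (1 : ℤ)) 1 ^ p =
      polyToLaurent (delta p M f) := by
  rw [hδ, delta, map_sum, map_sum, Finset.sum_mul]
  refine Finset.sum_congr rfl fun β hβ => ?_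
  rw [Finset.mem_filter, Finset.mem_piAntidiag] at hβ
  rw [map_mul, map_mul, map_natCast, map_natCast, mul_assoc, map_prod, map_prod, ← hβ.1.1,
    ← Finset.prod_pow_eq_pow_sum, ← Finset.prod_mul_distrib]
  congr 1
  refine Finset.prod_congr rfl fun i _ => ?_
  rw [map_pow, map_pow, ← mul_pow, coeff_shiftPoly hMq hM, zeroToLaurent_single,
    polyToLaurent_monomial, AddMonoidAlgebra.single_mul_single, mul_one, shiftExp_add_one]

/-- The vector with entries 1 - a_i is nonnegative of weight ∑ q_i, hence the exponent of some M_i.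
So the exponents having no entry at least 2 are exactly those of the ξ/M_i. -/
theorem mem_range_shiftExp (hMq' : ∀ a, a ∈ Set.range M ↔ Finsupp.weight q a = ∑ i, q i)
    {a : degZero q} (ha : ∀ i, coord q i a ≤ 1) : ∃ i, a = -shiftExp hMq i := by
  have h1 : ∀ i, 0 ≤ 1 - (a : Fin (N + 1) → ℤ) i := fun i => by
    have := ha i
    rw [coord_apply] at this
    omega
  set b : Fin (N + 1) →₀ ℕ := Finsupp.equivFunOnFinite.symm
    fun i => (1 - (a : Fin (N + 1) → ℤ) i).toNat with hb
  have hb' : ∀ i, (b i : ℤ) = 1 - (a : Fin (N + 1) → ℤ) i := fun i => by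
    have := h1 i
    simp only [hb, Finsupp.equivFunOnFinite_symm_apply_apply]
    omega
  obtain ⟨i, hi⟩ := (hMq' b).2 (by
    rw [Finsupp.weight_apply, Finsupp.sum_fintype _ _ (by simp)]
    have h2 := mem_degZero.1 a.2
    zify
    simp only [smul_eq_mul, Nat.cast_mul, hb', sub_mul, one_mul, Finset.sum_sub_distrib]
    rw [sub_eq_self]
    rw [← h2]
    exact Finset.sum_congr rfl fun i _ => mul_comm _ _)
  refine ⟨i, Subtype.ext (funext fun j => ?_)⟩
  simp [shiftExp, hi, hb']

/-- Put y = f'^(p-2) g_n. The next Laurent polynomial is (δ f'^(p-2)) y^p, so its coefficients are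
sums of p-th powers of coefficients of y, weighted by coefficients of δ f'^(p-2): the recursion
R_(n+2) = F(R_(n+1) T). The rows see only the exponents of ξ/M_j, because no other coefficients of y
contribute. -/
theorem coeff_coreSeq (hM : Function.Injective M)
    (hMq' : ∀ a, a ∈ Set.range M ↔ Finsupp.weight q a = ∑ i, q i)
    (hf : ∀ a, f.coeff a ≠ 0 → a ∈ Set.range M)
    {Dt : WittVector p (AddMonoidAlgebra k (degZero q))}
    (hDt0 : Dt.coeff 0 = ∑ β ∈ (Finset.univ.piAntidiag p : Finset (Fin m → ℕ)) with
      ∀ i, β i ≤ p - 1, ((Nat.multinomial Finset.univ β / p : ℕ) : AddMonoidAlgebra k (degZero q)) *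
        ∏ i, AddMonoidAlgebra.single (shiftExp hMq i)
          ((shiftPoly hMq f).coeff (shiftExp hMq i)) ^ β i) (n : ℕ) (i : Fin m) :
    (shiftPoly hMq f ^ (p - 2) *
      (coreSeq (termwiseLift p (shiftPoly hMq f)) Dt n).coeff 0).coeff (-shiftExp hMq i) =
      rowR p M f (n + 1) i := by
  classical
  have h2p := (Fact.out : p.Prime).two_le
  have hs : ∀ s : ℕ, (AddMonoidAlgebra.single (fun _ => (1 : ℤ)) 1 :
      AddMonoidAlgebra k (Fin (N + 1) → ℤ)) ^ s = AddMonoidAlgebra.single (fun _ => (s : ℤ)) 1 := by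
    intro s
    rw [AddMonoidAlgebra.single_pow, one_pow]
    congr 1
    ext
    simp
  have hroot : ∀ x : k, (frobeniusEquiv k p).symm x ^ p = x := fun x =>
    frobeniusEquiv_symm_pow_p k p x ▸ by simp
  have hF := zeroToLaurent_shiftPoly hMq hM hf
  have hδ := zeroToLaurent_delta hMq hM hDt0
  set f' := shiftPoly hMq f
  induction n generalizing i with
  | zero =>
    have h1 : zeroToLaurent q (f' ^ (p - 2)) *
        AddMonoidAlgebra.single (fun _ => ((p - 2 : ℕ) : ℤ)) 1 = polyToLaurent (f ^ (p - 2)) := by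
      rw [← hs, map_pow, map_pow, ← mul_pow, hF]
    change _ = (traceU p (f ^ (p - 2) * monomial (M i) 1)).coeff 0 ^ p
    rw [coreSeq, one_coeff_zero, mul_one, coeff_eq_of_mul_single h1, coeff_traceU, hroot,
      ← coeff_polyToLaurent_sub]
    congr 1
    ext j
    simp [shiftExp]
    push_cast [h2p, (by omega : 1 ≤ p)]
    ring
  | succ n ih =>
    set g := (coreSeq (termwiseLift p f') Dt n).coeff 0 with hg
    set y := f' ^ (p - 2) * g with hy
    have e : f' ^ (p - 2) * (coreSeq (termwiseLift p f') Dt (n + 1)).coeff 0 =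
        (Dt.coeff 0 * f' ^ (p - 2)) * y ^ p := by
      rw [coreSeq, mul_coeff_zero, mul_coeff_zero, coeff_frobenius_charP, ← map_pow,
        coeff_frobenius_charP, ← hg, hy]
      have : (termwiseLift p f' ^ (p - 2)).coeff 0 = f' ^ (p - 2) := by
        change WittVector.constantCoeff (termwiseLift p f' ^ (p - 2)) = _
        rw [map_pow]
        congr 1
        exact termwiseLift_coeff_zero f'
      rw [this]
      ring
    have h1 : zeroToLaurent q (Dt.coeff 0 * f' ^ (p - 2)) *
        AddMonoidAlgebra.single (fun _ => ((p + (p - 2) : ℕ) : ℤ)) 1 =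
          polyToLaurent (delta p M f * f ^ (p - 2)) := by
      rw [← hs, map_mul, map_mul, map_pow, map_pow, pow_add, ← hδ, ← hF]
      ring
    rw [e, coeff_mul_pow_char]
    -- Multiplying δ f'^(p-2) by ξ^(2p-2) gives a polynomial, so p b_l ≤ 2p - 1 for every l, that
    -- is, b_l ≤ 1.
    have h3 : ∀ b : degZero q, (Dt.coeff 0 * f' ^ (p - 2)).coeff (-shiftExp hMq i - p • b) ≠ 0 →
        b ∈ Set.range fun j => -shiftExp hMq j := by
      intro b hb
      rw [coeff_eq_of_mul_single h1] at hb
      obtain ⟨w, hw⟩ := mem_range_of_coeff_mapDomainRingHom_ne_zero hb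
      obtain ⟨j, hj⟩ := mem_range_shiftExp hMq hMq' (a := b) fun l => by
        have h4 := congrFun hw l
        simp [shiftExp] at h4
        rw [Nat.cast_sub h2p] at h4
        rw [coord_apply]
        by_contra hlt
        have h5 : (p : ℤ) * 2 ≤ p * (b : Fin (N + 1) → ℤ) l :=
          mul_le_mul_of_nonneg_left (by omega) (by positivity)
        push_cast at h4
        omega
      exact ⟨j, hj.symm⟩
    have hinj : Function.Injective fun j => -shiftExp hMq j := fun a b h =>
      shiftExp_injective hM hMq (neg_injective h)
    have h4 : ∑ b ∈ y.coeff.support, (Dt.coeff 0 * f' ^ (p - 2)).coeff (-shiftExp hMq i - p • b) *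
        y.coeff b ^ p = ∑ b ∈ Finset.univ.image fun j => -shiftExp hMq j,
          (Dt.coeff 0 * f' ^ (p - 2)).coeff (-shiftExp hMq i - p • b) * y.coeff b ^ p := by
      refine Finset.sum_congr_of_eq_on_inter ?_ ?_ fun _ _ _ => rfl
      · intro b _ hb
        by_contra h0
        obtain ⟨j, hj⟩ := h3 b (left_ne_zero_of_mul h0)
        exact hb (Finset.mem_image.2 ⟨j, Finset.mem_univ _, hj⟩)
      · intro b _ hb
        rw [Finsupp.notMem_support_iff.1 hb, zero_pow (by omega), mul_zero]
    rw [h4, Finset.sum_image fun a _ b _ h => hinj h]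
    change _ = (∑ j, rowR p M f (n + 1) j * matT p M f j i) ^ p
    rw [sum_pow_char]
    refine Finset.sum_congr rfl fun j _ => ?_
    rw [ih, mul_pow, mul_comm, matT, Matrix.of_apply, coeff_traceU, hroot,
      ← coeff_polyToLaurent_sub, coeff_eq_of_mul_single h1]
    congr 2
    ext l
    simp [shiftExp]
    push_cast [h2p, (by omega : 1 ≤ p)]
    ring

end LaurentRows
end QFS
end

open MvPolynomial AlgebraicGeometry CategoryTheory Opposite
noncomputable section
namespace QFS

/-! ### Stability of the error terms under shifts and constants -/

section ErrShift

open WittVector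

variable {p : ℕ} [Fact p.Prime] {k : Type*} [Field k] [CharP k p] [PerfectRing k p]
  {Λ : Type*} [AddCommMonoid Λ] {ι : Type*} {f : AddMonoidAlgebra k Λ} {v : ι → Λ →+ ℤ}
  (hf : ∀ i, f ∈ expFil k (v i) (-1))

theorem errSeq_add (v : Λ →+ ℤ) (n t s : ℕ) : errSeq f v (n + s) (t + s) = errSeq f v n t := by
  have h1 : t + s + 1 < n + s ↔ t + 1 < n := by omega
  have h2 : t + s + 1 = n + s ↔ t + 1 = n := by omega
  rw [errSeq, errSeq]
  simp only [h1, h2]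

theorem errGroup_induction {n : ℕ} {P : WittVector p (AddMonoidAlgebra k Λ) → Prop}
    (hp : ∀ x ∈ wittDvd p f, P ((p : WittVector p (AddMonoidAlgebra k Λ)) * x))
    (hi : ∀ (i : ι) (x : WittVector p (AddMonoidAlgebra k Λ)),
      (∀ t, x.coeff t ∈ errSeq f (v i) n t) → P x)
    (h0 : P 0) (hadd : ∀ x y, P x → P y → P (x + y)) {x : WittVector p (AddMonoidAlgebra k Λ)}
    (hx : x ∈ errGroup (p := p) hf n) : P x := by
  obtain ⟨_, ⟨y, hy, rfl⟩, z, hz, rfl⟩ := AddSubgroup.mem_sup.1 hx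
  refine hadd _ _ (hp y hy) ?_
  exact AddSubgroup.iSup_induction _ (C := P) hz (fun i x hx => hi i x hx) h0 hadd

theorem iterate_verschiebung_map_mul_mem_errGroup {n : ℕ} (w : WittVector p k)
    {x : WittVector p (AddMonoidAlgebra k Λ)} (hx : x ∈ errGroup (p := p) hf n) (s : ℕ) :
    verschiebung^[s] (WittVector.map (algebraMap k (AddMonoidAlgebra k Λ)) w * x) ∈
      errGroup (p := p) hf (n + s) := by
  refine errGroup_induction hf (P := fun x => verschiebung^[s] (WittVector.map
    (algebraMap k (AddMonoidAlgebra k Λ)) w * x) ∈ errGroup (p := p) hf (n + s)) ?_ ?_ ?_ ?_ hx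
  · intro x hx
    rw [mul_left_comm, iterate_verschiebung_p_mul]
    refine p_mul_mem_errGroup hf _ (iterate_verschiebung_mem fun t => ?_)
    exact mul_coeff_mem (p := p) (k := AddMonoidAlgebra k Λ) (J := fun _ => ⊤)
      (J' := fun _ => Ideal.span {f}) (fun _ => le_top) (admissible_span f) (admissible_span f)
      (fun t => Ideal.mul_le_right) t (fun _ _ => trivial) fun s _ => hx s
  · intro i x hx
    refine mem_errGroup hf i (iterate_verschiebung_mem
      (hJ := admissible_errSeq (Fact.out : p.Prime) (hf i) _) fun t => ?_)
    rw [errSeq_add]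
    exact map_mul_mem_wittSubgroup (hJ := admissible_errSeq (Fact.out : p.Prime) (hf i) n) w hx t
  · rw [mul_zero]
    have : verschiebung^[s] (0 : WittVector p (AddMonoidAlgebra k Λ)) = 0 :=
      iterate_map_zero verschiebung s
    rw [this]
    exact zero_mem _
  · intro x y hx hy
    rw [mul_add, iterate_verschiebung_add]
    exact add_mem hx hy

/-- V^n places f^2 u in the last constrained slot, where each term of u having some exponent at
least 2 is admitted. The remainder lands in slots that carry no condition. -/
theorem iterate_verschiebung_mem_errGroup [Nonempty ι] {n : ℕ}
    (Z : WittVector p (AddMonoidAlgebra k Λ)) {u : AddMonoidAlgebra k Λ}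
    (hZ : Z.coeff 0 = f ^ 2 * u) (hu : ∀ a, u.coeff a ≠ 0 → ∃ i, 2 ≤ v i a) :
    verschiebung^[n] Z ∈ errGroup (p := p) hf (n + 1) := by
  obtain ⟨Z', hZ'⟩ := exists_eq_add_verschiebung (x := Z)
    (y := teichmuller p (f ^ 2) * termwiseLift p u) (by
      rw [hZ, mul_coeff_zero, teichmuller_coeff_zero, termwiseLift_coeff_zero])
  rw [hZ', iterate_verschiebung_add]
  refine add_mem ?_ ?_
  · rw [termwiseLift, Finset.mul_sum, iterate_verschiebung_sum]
    refine sum_mem fun a ha => ?_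
    obtain ⟨i, hi⟩ := hu a (Finsupp.mem_support_iff.1 ha)
    refine mem_errGroup hf i (iterate_verschiebung_mem
      (hJ := admissible_errSeq (Fact.out : p.Prime) (hf i) _) fun t => ?_)
    rw [← map_mul]
    rcases t with _ | t
    · rw [teichmuller_coeff_zero, zero_add, errSeq, if_neg (by omega), if_pos rfl]
      exact ⟨_, single_mem_expFil hi (u.coeff a), by simp⟩
    · rw [teichmuller_coeff_pos _ _ _ (by omega)]
      exact zero_mem _
  · refine mem_errGroup hf (Classical.arbitrary ι) fun t => ?_
    rw [← Function.iterate_succ_apply, coeff_iterate_verschiebung]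
    split_ifs with h
    · rw [errSeq, if_neg (by omega), if_neg (by omega)]
      trivial
    · exact zero_mem _

end ErrShift

/-! ### A linear relation between the rows makes F[f'] an error term -/

section LaurentFrobenius

open WittVector

variable {p : ℕ} [Fact p.Prime] {k : Type*} [Field k] [CharP k p] [PerfectRing k p] {N m : ℕ}
  {q : Fin (N + 1) → ℕ} {M : Fin m → Fin (N + 1) →₀ ℕ}
  (hMq : ∀ i, Finsupp.weight q (M i) = ∑ i, q i) {f : MvPolynomial (Fin (N + 1)) k}

theorem coeff_zero_shiftPoly_mul (y : AddMonoidAlgebra k (degZero q)) :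
    (shiftPoly hMq f * y).coeff 0 = ∑ i, f.coeff (M i) * y.coeff (-shiftExp hMq i) := by
  rw [shiftPoly, Finset.sum_mul, AddMonoidAlgebra.coeff_sum, Finsupp.finsetSum_apply]
  refine Finset.sum_congr rfl fun i _ => ?_
  rw [AddMonoidAlgebra.coeff_single_mul_apply, add_zero]

theorem coeff_zero_teichmuller_pow_mul_sub_sum {R : Type*} [CommRing R] (f : R) (n : ℕ)
    (x : WittVector p R) (c y : ℕ → WittVector p R) :
    (teichmuller p f ^ p * x - ∑ l ∈ Finset.range n, c l * (teichmuller p f ^ p * y l)).coeff 0 =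
      f ^ 2 * (f ^ (p - 2) * x.coeff 0 -
        ∑ l ∈ Finset.range n, (c l).coeff 0 * (f ^ (p - 2) * (y l).coeff 0)) := by
  have e : f ^ p = f ^ 2 * f ^ (p - 2) := by
    have h2p := (Fact.out : p.Prime).two_le
    rw [← pow_add]; congr 1; omega
  have h : ∀ z : WittVector p R, (teichmuller p f ^ p * z).coeff 0 =
      f ^ 2 * f ^ (p - 2) * z.coeff 0 := fun z => by
    rw [mul_coeff_zero, ← map_pow, teichmuller_coeff_zero, e]
  change WittVector.constantCoeff (teichmuller p f ^ p * x -
    ∑ l ∈ Finset.range n, c l * (teichmuller p f ^ p * y l)) = _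
  rw [map_sub, map_sum, mul_sub, Finset.mul_sum]
  congr 1
  · exact (h x).trans (mul_assoc _ _ _)
  · refine Finset.sum_congr rfl fun l _ => ?_
    change (c l * (teichmuller p f ^ p * y l)).coeff 0 = _
    rw [mul_coeff_zero, h]
    ring

/-- Since F is bijective on W(k), a constant is moved out of V by taking its inverse image under F.
-/
theorem iterate_verschiebung_map_mul_eq (w : k) (x : WittVector p (AddMonoidAlgebra k (degZero q)))
    (j : ℕ) : ∃ w' : WittVector p k, verschiebung^[j] (WittVector.map
      (algebraMap k (AddMonoidAlgebra k (degZero q))) (teichmuller p w) * x) =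
      WittVector.map (algebraMap k (AddMonoidAlgebra k (degZero q))) w' * verschiebung^[j] x := by
  have : ∀ (w : WittVector p k), ∃ w' : WittVector p k, verschiebung^[j] (WittVector.map
      (algebraMap k (AddMonoidAlgebra k (degZero q))) w * x) =
      WittVector.map (algebraMap k (AddMonoidAlgebra k (degZero q))) w' * verschiebung^[j] x := by
    induction j with
    | zero => exact fun w => ⟨w, rfl⟩
    | succ j ih =>
      intro w
      obtain ⟨w₁, h₁⟩ := ih w
      obtain ⟨w₂, rfl⟩ := (frobenius_bijective p k).2 w₁
      refine ⟨w₂, ?_⟩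
      rw [Function.iterate_succ_apply', h₁, Function.iterate_succ_apply', mul_verschiebung]
      congr 2
      refine WittVector.ext fun t => ?_
      rw [map_coeff, coeff_frobenius_charP, coeff_frobenius_charP, map_coeff, map_pow]
  exact this _

set_option maxHeartbeats 1000000 in
-- F[f'] is ± V^n([f']^p g_n) modulo errors. Subtract the terms V^n(w_l [f']^p g_l), themselves
-- errors. What remains has zeroth entry f'^2 u, where by the relation u has coefficient zero at
-- every ξ/M_i; each of its exponents then has an entry at least 2.
theorem frobenius_teichmuller_shiftPoly_mem (hM : Function.Injective M) (hq : ∀ i, 0 < q i)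
    (hMq' : ∀ a, a ∈ Set.range M ↔ Finsupp.weight q a = ∑ i, q i)
    (hf : ∀ a, f.coeff a ≠ 0 → a ∈ Set.range M) {n : ℕ}
    (h0 : ∀ l < n, rowR p M f (l + 1) ⬝ᵥ coeffVec M f = 0) (w : ℕ → k)
    (hw : rowR p M f (n + 1) = ∑ l ∈ Finset.range n, w l • rowR p M f (l + 1)) :
    frobenius (teichmuller p (shiftPoly hMq f)) ∈
      errGroup (p := p) (v := coord q) (shiftPoly_mem_expFil hMq (f := f)) (n + 1) := by
  have h2p := (Fact.out : p.Prime).two_le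
  obtain ⟨D, Dt, hD, hDt, hDtm, hDt0⟩ := exists_termwiseLift_delta_single (p := p)
    (shiftExp_injective hM hMq) (f := shiftPoly hMq f) fun a ha => coeff_shiftPoly_ne_zero hMq ha
  have hrow := coeff_coreSeq hMq hM hMq' hf hDt0
  set f' := shiftPoly hMq f with hf'
  set g := coreSeq (termwiseLift p f') Dt with hg
  have hfil : ∀ i, f' ∈ expFil k (coord q i) (-1) := shiftPoly_mem_expFil hMq
  have hcoef : ∀ l < n, (f' ^ (p - 1) * (g l).coeff 0).coeff 0 = 0 := by
    intro l hl
    have e : f' ^ (p - 1) * (g l).coeff 0 = f' * (f' ^ (p - 2) * (g l).coeff 0) := by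
      rw [← mul_assoc, ← pow_succ']
      congr 2
      omega
    rw [e, coeff_zero_shiftPoly_mul, ← h0 l hl, dotProduct]
    refine Finset.sum_congr rfl fun i _ => ?_
    rw [hrow, mul_comm]
    rfl
  have hcore : ∀ n' j, j < n' → j ≤ n → frobenius (teichmuller p f') - (-1) ^ j *
      verschiebung^[j] (teichmuller p f' ^ p * g j) ∈ errGroup (p := p) hfil n' :=
    fun n' j hj hj' => frobenius_teichmuller_sub_mem hfil (exists_one_le_coord hq) n' hD hDt hDtm hj
      fun l hl => hcoef l (by omega)
  have hsign : ∀ (x : WittVector p (AddMonoidAlgebra k (degZero q))) (n' j : ℕ),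
      x ∈ errGroup (p := p) hfil n' → (-1) ^ j * x ∈ errGroup (p := p) hfil n' := by
    intro x n' j hx
    rcases neg_one_pow_eq_or (WittVector p (AddMonoidAlgebra k (degZero q))) j with h | h
    · rwa [h, one_mul]
    · rw [h, neg_one_mul]
      exact neg_mem hx
  let cst : k → WittVector p (AddMonoidAlgebra k (degZero q)) := fun r =>
    WittVector.map (algebraMap k (AddMonoidAlgebra k (degZero q))) (teichmuller p r)
  -- the terms with `l < n`
  have hterm : ∀ l < n, verschiebung^[n] (cst (w l) * (teichmuller p f' ^ p * g l)) ∈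
      errGroup (p := p) hfil (n + 1) := by
    intro l hl
    obtain ⟨s, rfl⟩ : ∃ s, n = s + 1 + l := ⟨n - l - 1, by omega⟩
    obtain ⟨w', hw'⟩ := iterate_verschiebung_map_mul_eq (w l) (teichmuller p f' ^ p * g l) l
    rw [Function.iterate_add_apply, hw']
    have h1 := hsign _ _ l (hcore (l + 1) l (by omega) (by omega))
    have h2 := iterate_verschiebung_map_mul_mem_errGroup hfil w' h1 (s + 1)
    rw [mul_sub, ← mul_assoc ((-1) ^ l), ← mul_pow, neg_one_mul, neg_neg, one_pow, one_mul,
      mul_sub] at h2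
    have hsub : ∀ x y : WittVector p (AddMonoidAlgebra k (degZero q)),
        verschiebung^[s + 1] (x - y) = verschiebung^[s + 1] x - verschiebung^[s + 1] y :=
      fun x y => iterate_map_sub verschiebung _ x y
    rw [hsub, show l + 1 + (s + 1) = s + 1 + l + 1 by omega] at h2
    have h3 : verschiebung^[s + 1] (WittVector.map (algebraMap k (AddMonoidAlgebra k (degZero q))) w'
        * ((-1) ^ l * frobenius (teichmuller p f'))) ∈ errGroup (p := p) hfil (s + 1 + l + 1) := by
      obtain ⟨w₂, rfl⟩ := (frobenius_bijective p k).2 w'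
      have e : WittVector.map (algebraMap k (AddMonoidAlgebra k (degZero q))) (frobenius w₂) *
          ((-1) ^ l * frobenius (teichmuller p f')) = WittVector.frobenius (teichmuller p f' *
            ((-1) ^ l * WittVector.map (algebraMap k (AddMonoidAlgebra k (degZero q))) w₂)) := by
        have : WittVector.map (algebraMap k (AddMonoidAlgebra k (degZero q))) (frobenius w₂) =
            frobenius (WittVector.map (algebraMap k (AddMonoidAlgebra k (degZero q))) w₂) := by
          refine WittVector.ext fun t => ?_
          rw [map_coeff, coeff_frobenius_charP, coeff_frobenius_charP, map_coeff, map_pow]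
        rw [this]
        simp only [map_mul, map_pow, map_neg, map_one]
        ring
      rw [e, Function.iterate_succ_apply, verschiebung_frobenius', iterate_verschiebung_p_mul]
      refine p_mul_mem_errGroup hfil _ ?_
      have := iterate_verschiebung_mem_wittDvd f' one_ne_zero
        ((-1) ^ l * WittVector.map (algebraMap k (AddMonoidAlgebra k (degZero q))) w₂) s
      rwa [pow_one] at this
    have := sub_mem h3 h2
    rwa [sub_sub_cancel] at this
  have hlast : verschiebung^[n] (teichmuller p f' ^ p * g n - ∑ l ∈ Finset.range n,
      cst (w l) * (teichmuller p f' ^ p * g l)) ∈ errGroup (p := p) hfil (n + 1) := by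
    refine iterate_verschiebung_mem_errGroup hfil _ (u := f' ^ (p - 2) * (g n).coeff 0 -
      ∑ l ∈ Finset.range n, algebraMap k _ (w l) * (f' ^ (p - 2) * (g l).coeff 0)) ?_ ?_
    · rw [coeff_zero_teichmuller_pow_mul_sub_sum]
      simp only [cst, map_coeff, teichmuller_coeff_zero]
    · intro a ha
      by_contra! hlt
      obtain ⟨i, rfl⟩ := mem_range_shiftExp hMq hMq' (a := a) fun i => by
        have := hlt i
        omega
      refine ha ?_
      rw [AddMonoidAlgebra.coeff_sub, Finsupp.sub_apply, hrow, AddMonoidAlgebra.coeff_sum,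
        Finsupp.finsetSum_apply, sub_eq_zero, hw, Finset.sum_apply]
      refine Finset.sum_congr rfl fun l _ => ?_
      rw [Pi.smul_apply, ← hrow, ← Algebra.smul_def, AddMonoidAlgebra.coeff_smul_apply]
  have hsub : ∀ x y : WittVector p (AddMonoidAlgebra k (degZero q)),
      verschiebung^[n] (x - y) = verschiebung^[n] x - verschiebung^[n] y :=
    fun x y => iterate_map_sub verschiebung _ x y
  rw [hsub, iterate_verschiebung_sum] at hlast
  have h4 := add_mem hlast (sum_mem fun l hl => hterm l (Finset.mem_range.1 hl))
  rw [sub_add_cancel] at h4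
  have h5 := add_mem (hcore (n + 1) n (by omega) le_rfl) (hsign _ _ n h4)
  rwa [sub_add_cancel] at h5

end LaurentFrobenius
end QFS
end

open MvPolynomial AlgebraicGeometry CategoryTheory Opposite
noncomputable section
namespace QFS

/-! ### Laurent polynomials as fractions -/

section LaurentEval

variable {k : Type*} [Field k] {N : ℕ} {q : Fin (N + 1) → ℕ}

/-- The evaluation of Laurent polynomials of degree zero at invertible elements of a field. -/
def laurentEval {K : Type*} [Field K] [Algebra k K] (q : Fin (N + 1) → ℕ) (x : Fin (N + 1) → K)
    (hx : ∀ i, x i ≠ 0) : AddMonoidAlgebra k (degZero q) →ₐ[k] K :=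
  AddMonoidAlgebra.lift k K (degZero q)
    { toFun := fun a => ∏ i, x i ^ (a.toAdd : Fin (N + 1) → ℤ) i
      map_one' := by simp
      map_mul' := fun a b => by
        rw [← Finset.prod_mul_distrib]
        exact Finset.prod_congr rfl fun i _ => by
          rw [toAdd_mul, AddSubgroup.coe_add, Pi.add_apply, zpow_add₀ (hx i)] }

theorem laurentEval_single {K : Type*} [Field K] [Algebra k K] (x : Fin (N + 1) → K)
    (hx : ∀ i, x i ≠ 0) (a : degZero q) (c : k) :
    laurentEval q x hx (AddMonoidAlgebra.single a c) =
      algebraMap k K c * ∏ i, x i ^ (a : Fin (N + 1) → ℤ) i := by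
  rw [laurentEval, AddMonoidAlgebra.lift_single, Algebra.smul_def]
  rfl

theorem exists_eq_prod_pow_mul_laurentEval {K : Type*} [Field K] [Algebra k K]
    [Algebra (MvPolynomial (Fin (N + 1)) k) K] [IsScalarTower k (MvPolynomial (Fin (N + 1)) k) K]
    (hx : ∀ i, algebraMap (MvPolynomial (Fin (N + 1)) k) K (X i) ≠ 0)
    {e : AddMonoidAlgebra k (degZero q)} {s : ℕ} (he : ∀ j, e ∈ expFil k (coord q j) (-s))
    (i : Fin (N + 1)) {c : ℤ} (hc : e ∈ expFil k (coord q i) c) {r : ℕ} (hr : (r : ℤ) ≤ s + c) :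
    ∃ h : MvPolynomial (Fin (N + 1)) k, (∏ j, algebraMap (MvPolynomial (Fin (N + 1)) k) K (X j)) ^ s *
      laurentEval q (fun j => algebraMap (MvPolynomial (Fin (N + 1)) k) K (X j)) hx e =
        algebraMap (MvPolynomial (Fin (N + 1)) k) K (X i ^ r * h) := by
  classical
  have hterm : ∀ a ∈ e.coeff.support, ∃ h : MvPolynomial (Fin (N + 1)) k,
      (∏ j, algebraMap (MvPolynomial (Fin (N + 1)) k) K (X j)) ^ s *
      laurentEval q (fun j => algebraMap (MvPolynomial (Fin (N + 1)) k) K (X j)) hx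
        (AddMonoidAlgebra.single a (e.coeff a)) =
        algebraMap (MvPolynomial (Fin (N + 1)) k) K (X i ^ r * h) := by
    intro a ha
    have h1 : ∀ j, 0 ≤ (a : Fin (N + 1) → ℤ) j + s := fun j => by
      have := he j a (Finsupp.mem_support_iff.1 ha)
      rw [coord_apply] at this
      omega
    have h2 : (r : ℤ) ≤ (a : Fin (N + 1) → ℤ) i + s := by
      have := hc a (Finsupp.mem_support_iff.1 ha)
      rw [coord_apply] at this
      omega
    choose b hb using fun j => Int.eq_ofNat_of_zero_le (h1 j)
    have hbi : r ≤ b i := by have := hb i; omega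
    have h3 : (∏ j, (X j : MvPolynomial (Fin (N + 1)) k) ^ b j) =
        X i ^ r * (X i ^ (b i - r) * ∏ j ∈ Finset.univ.erase i, X j ^ b j) := by
      rw [← mul_assoc, ← pow_add, Nat.add_sub_cancel' hbi,
        Finset.mul_prod_erase Finset.univ (fun j => X j ^ b j) (Finset.mem_univ i)]
    refine ⟨C (e.coeff a) * (X i ^ (b i - r) * ∏ j ∈ Finset.univ.erase i, X j ^ b j), ?_⟩
    rw [mul_left_comm, ← h3, laurentEval_single, map_mul, map_prod, mul_left_comm,
      ← Finset.prod_pow, ← Finset.prod_mul_distrib]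
    congr 1
    · rw [← MvPolynomial.algebraMap_eq, ← IsScalarTower.algebraMap_apply]
    · refine Finset.prod_congr rfl fun j _ => ?_
      rw [← zpow_natCast, ← zpow_add₀ (hx j), map_pow, ← zpow_natCast, ← hb j, add_comm (s : ℤ)]
  choose! h hh using hterm
  refine ⟨∑ a ∈ e.coeff.support, h a, ?_⟩
  conv_lhs => rw [← AddMonoidAlgebra.sum_coeff_single e, Finsupp.sum]
  rw [map_sum, Finset.mul_sum, Finset.mul_sum, map_sum]
  exact Finset.sum_congr rfl hh

theorem eventually_mem_expFil (e : AddMonoidAlgebra k (degZero q)) :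
    ∀ᶠ s : ℕ in Filter.atTop, ∀ j, e ∈ expFil k (coord q j) (-s) := by
  have h : ∀ (j : Fin (N + 1)) (a : e.coeff.support), ∀ᶠ s : ℕ in Filter.atTop,
      (-s : ℤ) ≤ coord q j a := by
    intro j a
    filter_upwards [Filter.eventually_ge_atTop (coord q j a).natAbs] with s hs
    omega
  have h2 := Filter.eventually_all.2 fun j => Filter.eventually_all.2 (h j)
  filter_upwards [h2] with s hs j a ha
  exact hs j ⟨a, Finsupp.mem_support_iff.2 ha⟩

theorem laurentEval_shiftPoly {m : ℕ} {M : Fin m → Fin (N + 1) →₀ ℕ}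
    (hMq : ∀ i, Finsupp.weight q (M i) = ∑ i, q i) (hM : Function.Injective M)
    {f : MvPolynomial (Fin (N + 1)) k} (hf : ∀ a, f.coeff a ≠ 0 → a ∈ Set.range M)
    {K : Type*} [Field K] [Algebra k K]
    [Algebra (MvPolynomial (Fin (N + 1)) k) K] [IsScalarTower k (MvPolynomial (Fin (N + 1)) k) K]
    (hx : ∀ i, algebraMap (MvPolynomial (Fin (N + 1)) k) K (X i) ≠ 0) :
    (∏ j, algebraMap (MvPolynomial (Fin (N + 1)) k) K (X j)) *
      laurentEval q (fun j => algebraMap (MvPolynomial (Fin (N + 1)) k) K (X j)) hx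
        (shiftPoly hMq f) = algebraMap (MvPolynomial (Fin (N + 1)) k) K f := by
  conv_rhs => rw [← sum_monomial_eq hM hf]
  rw [shiftPoly, map_sum, map_sum, Finset.mul_sum]
  refine Finset.sum_congr rfl fun i _ => ?_
  rw [laurentEval_single, monomial_eq, map_mul, mul_left_comm, ← Finset.prod_mul_distrib]
  congr 1
  · rw [← MvPolynomial.algebraMap_eq, ← IsScalarTower.algebraMap_apply]
  · rw [Finsupp.prod_fintype _ _ (by simp), map_prod]
    refine Finset.prod_congr rfl fun j _ => ?_
    have : (shiftExp hMq i : Fin (N + 1) → ℤ) j = M i j - 1 := by simp [shiftExp]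
    rw [this, zpow_sub₀ (hx j), map_pow, zpow_natCast, zpow_one, mul_div_cancel₀ _ (hx j)]

end LaurentEval

/-! ### Obstruction to splitting the pair -/

section PairObstruction

open WittVector

variable {p : ℕ} [Fact p.Prime] {k : Type*} [Field k] [CharP k p] [PerfectRing k p]

theorem exists_decomposition_of_mem_errGroup {Λ : Type*} [AddCommMonoid Λ] {ι : Type*} [Fintype ι]
    {f : AddMonoidAlgebra k Λ} {v : ι → Λ →+ ℤ} (hf : ∀ i, f ∈ expFil k (v i) (-1)) {n : ℕ}
    {x : WittVector p (AddMonoidAlgebra k Λ)} (hx : x ∈ errGroup (p := p) hf n) :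
    ∃ (y : WittVector p (AddMonoidAlgebra k Λ)) (z : ι → WittVector p (AddMonoidAlgebra k Λ)),
      (∀ t, f ∣ y.coeff t) ∧ (∀ i t, (z i).coeff t ∈ errSeq f (v i) n t) ∧
      x = (p : WittVector p (AddMonoidAlgebra k Λ)) * y + ∑ i, z i := by
  classical
  have h0 : ∀ i, (0 : WittVector p (AddMonoidAlgebra k Λ)) ∈ wittSubgroup (errSeq f (v i) n)
    (admissible_errSeq (Fact.out : p.Prime) (hf i) n) := fun i => zero_mem _
  refine errGroup_induction hf (P := fun x => ∃ (y : WittVector p (AddMonoidAlgebra k Λ))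
    (z : ι → WittVector p (AddMonoidAlgebra k Λ)), (∀ t, f ∣ y.coeff t) ∧
      (∀ i t, (z i).coeff t ∈ errSeq f (v i) n t) ∧
      x = (p : WittVector p (AddMonoidAlgebra k Λ)) * y + ∑ i, z i) ?_ ?_ ?_ ?_ hx
  · intro x hx
    exact ⟨x, 0, fun t => Ideal.mem_span_singleton.1 (hx t), fun i => h0 i, by simp⟩
  · intro i x hx
    refine ⟨0, Pi.single i x, fun t => by simp, fun j => ?_, by simp⟩
    rcases eq_or_ne j i with rfl | h
    · rwa [Pi.single_eq_same]
    · rw [Pi.single_eq_of_ne h]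
      exact h0 j
  · exact ⟨0, 0, fun t => by simp, fun i => h0 i, by simp⟩
  · rintro _ _ ⟨y, z, hy, hz, rfl⟩ ⟨y', z', hy', hz', rfl⟩
    refine ⟨y + y', z + z', fun t => ?_, fun i => ?_, ?_⟩
    · have h1 : y ∈ wittDvd p f := fun t => Ideal.mem_span_singleton.2 (hy t)
      have h2 : y' ∈ wittDvd p f := fun t => Ideal.mem_span_singleton.2 (hy' t)
      exact Ideal.mem_span_singleton.1 (add_mem h1 h2 t)
    · exact add_mem (S := AddSubgroup (WittVector p (AddMonoidAlgebra k Λ)))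
        (s := wittSubgroup _ (admissible_errSeq (Fact.out : p.Prime) (hf i) n)) (hz i) (hz' i)
    · simp only [Pi.add_apply, Finset.sum_add_distrib]
      ring

/-- The `A`-submodules `f ^ (-(p ^ (t + 1) - 1)) A` for `t < n`, and `f ^ (-(p ^ (n + 1) - 2)) A`
for `t = n`. -/
def poleSeq {A K : Type*} [CommRing A] [Field K] [Algebra A K] (p : ℕ) (f : A) (n t : ℕ) :
    Submodule A K :=
  if t < n then Submodule.span A {(algebraMap A K f ^ (p ^ (t + 1) - 1))⁻¹} else
    if t = n then Submodule.span A {(algebraMap A K f ^ (p ^ (t + 1) - 2))⁻¹} else ⊤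

/-- The pole orders grow slowly enough: p (p^(t+1) - 1) ≤ p^(t+2) - 2 because p ≥ 2, which also
covers passage to the last slot. -/
theorem admissible_poleSeq {A K : Type*} [CommRing A] [Field K] [Algebra A K] {f : A}
    (hf : algebraMap A K f ≠ 0) (n : ℕ) : Admissible p (poleSeq (K := K) p f n) := by
  have h2p := (Fact.out : p.Prime).two_le
  intro t
  by_cases h : t < n
  · have hle : ∀ s, (p ^ (t + 1) - 1) * p ≤ s → Submodule.span A
        {(algebraMap A K f ^ (p ^ (t + 1) - 1))⁻¹} ^ p ≤
          Submodule.span A {(algebraMap A K f ^ s)⁻¹} := by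
      intro s hs
      rw [Submodule.span_pow, Set.singleton_pow, Submodule.span_singleton_le_iff_mem,
        Submodule.mem_span_singleton]
      refine ⟨f ^ (s - (p ^ (t + 1) - 1) * p), ?_⟩
      rw [Algebra.smul_def, map_pow, inv_pow, ← pow_mul, pow_sub₀ _ hf hs]
      field_simp
    have h1 : poleSeq (K := K) p f n t =
      Submodule.span A {(algebraMap A K f ^ (p ^ (t + 1) - 1))⁻¹} := if_pos h
    have h3 : (p ^ (t + 1) - 1) * p ≤ p ^ (t + 1 + 1) - 2 := by
      rw [Nat.sub_mul, one_mul, ← pow_succ]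
      omega
    rw [h1]
    by_cases h4 : t + 1 < n
    · rw [poleSeq, if_pos h4]
      exact hle _ (by omega)
    · rw [poleSeq, if_neg h4, if_pos (by omega)]
      exact hle _ h3
  · have : poleSeq (K := K) p f n (t + 1) = ⊤ := by
      rw [poleSeq, if_neg (by omega), if_neg (by omega)]
    rw [this]
    exact le_top

theorem mem_divSections_of_mem_poleSeq {A : Type*} [CommRing A] [IsDomain A]
    [UniqueFactorizationMonoid A] {f : A} (hf : f ≠ 0) {n t : ℕ} (ht : t < n + 1)
    {a : FractionRing A} (ha : a ∈ poleSeq (K := FractionRing A) p f n t) :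
    a ∈ divSections ((p : ℚ) ^ t * (p * (1 - 2 / (p : ℚ) ^ (n + 1)))) f := by
  have h2p := (Fact.out : p.Prime).two_le
  have hp0 : (0 : ℚ) < p := by exact_mod_cast (Fact.out : p.Prime).pos
  have h2p' : (2 : ℚ) ≤ p := by exact_mod_cast h2p
  have hle : 2 ≤ p ^ (t + 1) := h2p.trans (Nat.le_self_pow (by omega) p)
  have e : (p : ℚ) ^ t * (p * (1 - 2 / (p : ℚ) ^ (n + 1))) =
      (p : ℚ) ^ (t + 1) - 2 * ((p : ℚ) ^ (t + 1) / (p : ℚ) ^ (n + 1)) := by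
    rw [pow_succ (p : ℚ) t]
    ring
  rw [poleSeq] at ha
  split_ifs at ha with h1 h3
  · obtain ⟨b, rfl⟩ := Submodule.mem_span_singleton.1 ha
    rw [Algebra.smul_def, ← div_eq_mul_inv]
    refine div_pow_mem_divSections hf ?_ b
    rw [e, Nat.cast_sub (by omega)]
    push_cast
    have h4 : 2 * ((p : ℚ) ^ (t + 1) / (p : ℚ) ^ (n + 1)) ≤ 1 := by
      rw [← mul_div_assoc, div_le_one (by positivity)]
      calc 2 * (p : ℚ) ^ (t + 1) ≤ p * (p : ℚ) ^ (t + 1) := by gcongr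
        _ = (p : ℚ) ^ (t + 2) := by ring
        _ ≤ (p : ℚ) ^ (n + 1) := pow_le_pow_right₀ (by linarith) (by omega)
    linarith
  · obtain ⟨b, rfl⟩ := Submodule.mem_span_singleton.1 ha
    rw [Algebra.smul_def, ← div_eq_mul_inv]
    refine div_pow_mem_divSections hf ?_ b
    rw [e, Nat.cast_sub hle, h3, div_self (by positivity)]
    push_cast
    linarith
  · omega

/-- Compare coefficients at the exponent (l, …, l), which no multiple of x_i^(l+1) involves.
Equivalently, 1/ξ represents a nonzero class in top local cohomology. -/
theorem prod_X_pow_ne_sum {N l : ℕ} (a : Fin (N + 1) → MvPolynomial (Fin (N + 1)) k) :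
    (∏ j, (X j : MvPolynomial (Fin (N + 1)) k)) ^ l ≠ ∑ i, X i ^ (l + 1) * a i := by
  classical
  intro h
  set w : Fin (N + 1) →₀ ℕ := Finsupp.equivFunOnFinite.symm fun _ => l with hw
  have h1 : (∏ j, (X j : MvPolynomial (Fin (N + 1)) k)) ^ l = monomial w 1 := by
    rw [monomial_eq, C_1, one_mul, Finsupp.prod_fintype _ _ (by simp), ← Finset.prod_pow]
    rfl
  have h2 := congrArg (MvPolynomial.coeff w) h
  rw [h1, coeff_monomial, if_pos rfl, coeff_sum] at h2
  refine one_ne_zero (h2.trans (Finset.sum_eq_zero fun i _ => ?_))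
  rw [X_pow_eq_monomial, coeff_monomial_mul', if_neg]
  intro hle
  have := hle i
  simp [hw] at this

theorem p_mul_coeff_congr {R : Type*} [CommRing R] [CharP R p] {x y : WittVector p R} {n : ℕ}
    (h : ∀ t < n, x.coeff t = y.coeff t) (t : ℕ) (ht : t < n + 1) :
    ((p : WittVector p R) * x).coeff t = ((p : WittVector p R) * y).coeff t := by
  rw [← verschiebung_frobenius', ← verschiebung_frobenius']
  rcases t with _ | t
  · rw [verschiebung_coeff_zero, verschiebung_coeff_zero]
  · rw [verschiebung_coeff_succ, verschiebung_coeff_succ, coeff_frobenius_charP,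
      coeff_frobenius_charP, h t (by omega)]

theorem mul_div_mul_cancel_aux {K : Type*} [Field K] {x g : K} (hx : x ≠ 0) (hg : g ≠ 0)
    (s u e : K) : s * x / (u * g) * (g / x * e) = s * e * u⁻¹ := by
  rcases eq_or_ne u 0 with rfl | hu
  · simp
  · field_simp

set_option maxHeartbeats 1000000 in
-- Multiply F[f'] = p y + ∑ z_i by [ξ^(L+1)/f]^p. The left side becomes F[ξ^L]. On the right, y and
-- the z_i turn into y' and [x_i^(L+1)]^p z'_i, where y', z'_i have poles allowed by pD. Applying φ
-- kills the multiple of p, A having characteristic p, and gives ξ^L = ∑ x_i^(L+1) φ(z'_i).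
theorem not_isQuasiFSplitPair_of_mem_errGroup {N m : ℕ} {q : Fin (N + 1) → ℕ}
    {M : Fin m → Fin (N + 1) →₀ ℕ} (hMq : ∀ i, Finsupp.weight q (M i) = ∑ i, q i)
    (hM : Function.Injective M) {f : MvPolynomial (Fin (N + 1)) k} (hf0 : f ≠ 0)
    (hf : ∀ a, f.coeff a ≠ 0 → a ∈ Set.range M) {n : ℕ}
    (hF : frobenius (teichmuller p (shiftPoly hMq f)) ∈
      errGroup (p := p) (v := coord q) (shiftPoly_mem_expFil hMq (f := f)) (n + 1)) :
    ¬ IsQuasiFSplitPair p (1 - 2 / (p : ℚ) ^ (n + 1)) f (n + 1) := by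
  classical
  rintro ⟨hn, φ, hadd, hmul, hone⟩
  have h2p := (Fact.out : p.Prime).two_le
  let A := MvPolynomial (Fin (N + 1)) k
  let K := FractionRing A
  have hinj : Function.Injective (algebraMap A K) := IsFractionRing.injective A K
  have hKp : CharP K p := charP_of_injective_algebraMap hinj p
  have hfK : algebraMap A K f ≠ 0 := (map_ne_zero_iff _ hinj).2 hf0
  have hx : ∀ i, algebraMap A K (X i) ≠ 0 := fun i => (map_ne_zero_iff _ hinj).2 (X_ne_zero i)
  let θ := laurentEval (k := k) q (fun j => algebraMap A K (X j)) hx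
  let ξ : K := ∏ j, algebraMap A K (X j)
  have hξ0 : ξ ≠ 0 := Finset.prod_ne_zero_iff.2 fun j _ => hx j
  obtain ⟨y, z, hy, hz, hsum⟩ := exists_decomposition_of_mem_errGroup _ hF
  set f' := shiftPoly hMq f with hf'
  have hθf : θ f' = algebraMap A K f / ξ := by
    rw [eq_div_iff hξ0, mul_comm]
    exact laurentEval_shiftPoly hMq hM hf hx
  choose e he using hy
  have hz1 : ∀ (i : Fin (N + 1)) (t : Fin n), ∃ ε ∈ expFil k (coord q i) 1,
      (z i).coeff t = f' * ε := by
    intro i t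
    have h1 := hz i t
    rw [errSeq, if_pos (by omega)] at h1
    obtain ⟨ε, hε, h2⟩ := mem_mulFil.1 h1
    exact ⟨ε, hε, by rw [← h2, pow_one]⟩
  have hz2 : ∀ i : Fin (N + 1), ∃ ε ∈ expFil k (coord q i) 2, (z i).coeff n = f' ^ 2 * ε := by
    intro i
    have h1 := hz i n
    rw [errSeq, if_neg (by omega), if_pos rfl] at h1
    obtain ⟨ε, hε, h2⟩ := mem_mulFil.1 h1
    exact ⟨ε, hε, h2.symm⟩
  choose ε₁ hε₁ hzε₁ using hz1
  choose ε₂ hε₂ hzε₂ using hz2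
  -- L bounds the negative exponents of the finitely many quotients that matter. The exponents (L+1)
  -- p^(t+1), lowered by 1 or 2, are then still at least L.
  obtain ⟨L, hL1, hL2, hL3⟩ := ((Filter.eventually_all.2 fun t : Fin n =>
    eventually_mem_expFil (e t)).and ((Filter.eventually_all.2 fun i => Filter.eventually_all.2
      fun t : Fin n => eventually_mem_expFil (ε₁ i t)).and
        (Filter.eventually_all.2 fun i => eventually_mem_expFil (ε₂ i)))).exists
  have hmono : ∀ {b : AddMonoidAlgebra k (degZero q)} {s : ℕ}, L ≤ s →
      (∀ j, b ∈ expFil k (coord q j) (-L)) → ∀ j, b ∈ expFil k (coord q j) (-s) :=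
    fun h hb j => expFil_mono _ (by omega) (hb j)
  have hc2 : ∀ t : ℕ, 2 ≤ p ^ (t + 1) := fun t => h2p.trans (Nat.le_self_pow (by omega) p)
  have hexp : ∀ t : ℕ, L + 2 ≤ (L + 1) * p ^ (t + 1) := fun t => by
    calc L + 2 ≤ (L + 1) * 2 := by omega
      _ ≤ _ := Nat.mul_le_mul_left _ (hc2 t)
  -- the pieces of the decomposition, divided by powers of `x_i`
  have hpy : ∀ t : Fin n, ∃ h : A, ξ ^ ((L + 1) * p ^ (t + 1 : ℕ) - 1) * θ (e t) =
      algebraMap A K h := by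
    intro t
    have := hexp t
    obtain ⟨h, hh⟩ := exists_eq_prod_pow_mul_laurentEval hx
      (hmono (s := (L + 1) * p ^ (t + 1 : ℕ) - 1) (by omega) (hL1 t)) 0 (r := 0)
      (hmono (s := (L + 1) * p ^ (t + 1 : ℕ) - 1) (by omega) (hL1 t) 0) (by simp)
    exact ⟨_, hh⟩
  have hpz1 : ∀ (i : Fin (N + 1)) (t : Fin n), ∃ h : A,
      ξ ^ ((L + 1) * p ^ (t + 1 : ℕ) - 1) * θ (ε₁ i t) =
        algebraMap A K (X i ^ ((L + 1) * p ^ (t + 1 : ℕ)) * h) := by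
    intro i t
    have := hexp t
    exact exists_eq_prod_pow_mul_laurentEval hx
      (hmono (s := (L + 1) * p ^ (t + 1 : ℕ) - 1) (by omega) (hL2 i t)) i (hε₁ i t) (by omega)
  have hpz2 : ∀ (i : Fin (N + 1)), ∃ h : A, ξ ^ ((L + 1) * p ^ (n + 1 : ℕ) - 2) * θ (ε₂ i) =
        algebraMap A K (X i ^ ((L + 1) * p ^ (n + 1 : ℕ)) * h) := by
    intro i
    have := hexp n
    exact exists_eq_prod_pow_mul_laurentEval hx
      (hmono (s := (L + 1) * p ^ (n + 1 : ℕ) - 2) (by omega) (hL3 i)) i (hε₂ i) (by omega)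
  choose h₀ hh₀ using hpy
  choose h₁ hh₁ using hpz1
  choose h₂ hh₂ using hpz2
  let J := poleSeq (K := K) p f n
  have hJ : Admissible p J := admissible_poleSeq hfK n
  let y' : WittVector p K := WittVector.mk p fun t =>
    if ht : t < n then algebraMap A K (h₀ ⟨t, ht⟩) * (algebraMap A K f ^ (p ^ (t + 1) - 1))⁻¹ else 0
  let z' : Fin (N + 1) → WittVector p K := fun i => WittVector.mk p fun t =>
    if ht : t < n then algebraMap A K (h₁ i ⟨t, ht⟩) * (algebraMap A K f ^ (p ^ (t + 1) - 1))⁻¹ else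
      if t = n then algebraMap A K (h₂ i) * (algebraMap A K f ^ (p ^ (t + 1) - 2))⁻¹ else 0
  have hy'mem : y' ∈ wittSubgroup J hJ := by
    intro t
    change (if ht : t < n then _ else _) ∈ poleSeq (K := K) p f n t
    rw [poleSeq]
    split_ifs
    · rw [← Algebra.smul_def]
      exact Submodule.smul_mem _ _ (Submodule.mem_span_singleton_self _)
    · exact zero_mem _
    · exact zero_mem _
  have hz'mem : ∀ i, z' i ∈ wittSubgroup J hJ := by
    intro i t
    change (if ht : t < n then _ else _) ∈ poleSeq (K := K) p f n t
    rw [poleSeq]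
    split_ifs
    · rw [← Algebra.smul_def]
      exact Submodule.smul_mem _ _ (Submodule.mem_span_singleton_self _)
    · rw [← Algebra.smul_def]
      exact Submodule.smul_mem _ _ (Submodule.mem_span_singleton_self _)
    · exact zero_mem _
  have hmulmem : ∀ (a : A) (x : WittVector p K), x ∈ wittSubgroup J hJ →
      teichmuller p (algebraMap A K a) ^ p * x ∈ wittSubgroup J hJ := by
    intro a x hx t
    rw [coeff_teichmuller_pow_mul, ← map_pow, ← Algebra.smul_def]
    exact Submodule.smul_mem _ _ (hx t)
  have hsec : ∀ x ∈ wittSubgroup J hJ, truncate (n + 1) x ∈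
      wittDivSections p (n + 1) (p * (1 - 2 / (p : ℚ) ^ (n + 1))) f := by
    intro x hx i
    rw [coeff_truncate]
    exact mem_divSections_of_mem_poleSeq hf0 i.2 (hx i)
  let Φ : wittSubgroup J hJ →+ A := AddMonoidHom.mk' (fun x => φ (truncate (n + 1) x.1))
    fun a b => by
      change φ (truncate (n + 1) (a.1 + b.1)) = _
      rw [map_add, hadd _ (hsec _ a.2) _ (hsec _ b.2)]
  have hΦmul : ∀ (a : A) (x : wittSubgroup J hJ),
      Φ ⟨_, hmulmem a x.1 x.2⟩ = a * Φ x := by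
    intro a x
    have h := hmul (truncate (n + 1) (teichmuller p a)) (truncate (n + 1) x.1) (hsec _ x.2)
    rw [wittFrob_truncate, wittMap_truncate, ← map_mul, frobenius_teichmuller, map_pow,
      map_teichmuller, coeff_truncate, teichmuller_coeff_zero] at h
    exact h
  -- Agreement in n components suffices in length n+1, since p = V F shifts by one. Hence y' could
  -- be set to zero from slot n on.
  have hyE : ∀ t < n, (teichmuller p (ξ ^ (L + 1) / algebraMap A K f) ^ p *
      WittVector.map θ.toRingHom y).coeff t = y'.coeff t := by
    intro t ht
    have h5 := hexp t
    have h6 := hc2 t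
    have h7 : y'.coeff t = algebraMap A K (h₀ ⟨t, ht⟩) *
      (algebraMap A K f ^ (p ^ (t + 1) - 1))⁻¹ := dif_pos ht
    rw [h7, ← hh₀ ⟨t, ht⟩, coeff_teichmuller_pow_mul, map_coeff, he]
    change _ * θ (f' * e t) = _
    rw [map_mul, hθf, div_pow, ← pow_mul]
    have e1 : ξ ^ ((L + 1) * p ^ (t + 1)) = ξ ^ ((L + 1) * p ^ (t + 1) - 1) * ξ := by
      rw [← pow_succ]; congr 1; omega
    have e2 : algebraMap A K f ^ p ^ (t + 1) = algebraMap A K f ^ (p ^ (t + 1) - 1) *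
        algebraMap A K f := by rw [← pow_succ]; congr 1; omega
    rw [e1, e2]
    exact mul_div_mul_cancel_aux hξ0 hfK _ _ _
  have hzE : ∀ i, ∀ t < n + 1, (teichmuller p (ξ ^ (L + 1) / algebraMap A K f) ^ p *
      WittVector.map θ.toRingHom (z i)).coeff t =
        (teichmuller p (algebraMap A K (X i ^ (L + 1))) ^ p * z' i).coeff t := by
    intro i t ht
    have h5 := hexp t
    have h6 := hc2 t
    rw [coeff_teichmuller_pow_mul, coeff_teichmuller_pow_mul, map_coeff, div_pow, ← pow_mul,
      ← map_pow (algebraMap A K) (X i ^ (L + 1)), ← pow_mul (X i)]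
    rcases Nat.lt_succ_iff_lt_or_eq.1 ht with ht' | rfl
    · have h7 : (z' i).coeff t = algebraMap A K (h₁ i ⟨t, ht'⟩) *
        (algebraMap A K f ^ (p ^ (t + 1) - 1))⁻¹ := dif_pos ht'
      rw [h7, ← mul_assoc, ← map_mul, ← hh₁ i ⟨t, ht'⟩, hzε₁ i ⟨t, ht'⟩]
      change _ * θ (f' * _) = _
      rw [map_mul, hθf]
      have e1 : ξ ^ ((L + 1) * p ^ (t + 1)) = ξ ^ ((L + 1) * p ^ (t + 1) - 1) * ξ := by
        rw [← pow_succ]; congr 1; omega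
      have e2 : algebraMap A K f ^ p ^ (t + 1) = algebraMap A K f ^ (p ^ (t + 1) - 1) *
          algebraMap A K f := by rw [← pow_succ]; congr 1; omega
      rw [e1, e2]
      exact mul_div_mul_cancel_aux hξ0 hfK _ _ _
    · have h7 : (z' i).coeff t = algebraMap A K (h₂ i) *
        (algebraMap A K f ^ (p ^ (t + 1) - 2))⁻¹ := by
        change (if ht : t < t then _ else if t = t then _ else _) = _
        rw [dif_neg (lt_irrefl t), if_pos rfl]
      rw [h7, ← mul_assoc, ← map_mul, ← hh₂ i, hzε₂ i]
      change _ * θ (f' ^ 2 * _) = _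
      rw [map_mul, map_pow, hθf, div_pow]
      have e1 : ξ ^ ((L + 1) * p ^ (t + 1)) = ξ ^ ((L + 1) * p ^ (t + 1) - 2) * ξ ^ 2 := by
        rw [← pow_add]; congr 1; omega
      have e2 : algebraMap A K f ^ p ^ (t + 1) = algebraMap A K f ^ (p ^ (t + 1) - 2) *
          algebraMap A K f ^ 2 := by rw [← pow_add]; congr 1; omega
      rw [e1, e2]
      exact mul_div_mul_cancel_aux (pow_ne_zero 2 hξ0) (pow_ne_zero 2 hfK) _ _ _
  have hkey : truncate (n + 1) (teichmuller p (ξ ^ L) ^ p) =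
      truncate (n + 1) ((p : WittVector p K) * y' +
        ∑ i, teichmuller p (algebraMap A K (X i ^ (L + 1))) ^ p * z' i) := by
    have h1 := congrArg (fun x => teichmuller p (ξ ^ (L + 1) / algebraMap A K f) ^ p *
      WittVector.map θ.toRingHom x) hsum
    beta_reduce at h1
    rw [map_add, map_mul, map_natCast, map_sum, mul_add, Finset.mul_sum, frobenius_teichmuller,
      map_pow, map_teichmuller, ← mul_pow, ← map_mul] at h1
    have h3 : ξ ^ (L + 1) / algebraMap A K f * θ.toRingHom f' = ξ ^ L := by
      change _ * θ f' = _
      rw [hθf, pow_succ, div_mul_div_cancel₀ hfK, mul_div_cancel_right₀ _ hξ0]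
    rw [h3] at h1
    rw [h1, map_add, map_add, map_sum, map_sum]
    congr 1
    · rw [mul_left_comm, truncate_eq_iff]
      exact p_mul_coeff_congr hyE
    · exact Finset.sum_congr rfl fun i _ => truncate_eq_iff.2 (hzE i)
  have hfinal := congrArg φ hkey
  have hl : φ (truncate (n + 1) (teichmuller p (ξ ^ L) ^ p)) = (∏ j, X j) ^ L := by
    have h := hone (truncate (n + 1) (teichmuller p ((∏ j, X j) ^ L)))
    have hξL : ξ ^ L = algebraMap A K ((∏ j, X j) ^ L) := by rw [map_pow, map_prod]
    rw [wittFrob_truncate, wittMap_truncate, frobenius_teichmuller, map_pow,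
      map_teichmuller, coeff_truncate, teichmuller_coeff_zero] at h
    rw [hξL]
    exact h
  have hval : (p : WittVector p K) * y' +
      ∑ i, teichmuller p (algebraMap A K (X i ^ (L + 1))) ^ p * z' i =
      ((p • ⟨y', hy'mem⟩ + ∑ i, ⟨_, hmulmem (X i ^ (L + 1)) _ (hz'mem i)⟩ :
        wittSubgroup J hJ) : WittVector p K) := by
    rw [AddSubgroup.coe_add, AddSubgroup.coe_nsmul, AddSubgroup.val_finsetSum, nsmul_eq_mul]
  have hr : ∀ x : wittSubgroup J hJ, φ (truncate (n + 1) (x : WittVector p K)) = Φ x :=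
    fun x => rfl
  rw [hl, hval, hr, map_add, map_nsmul, map_sum, nsmul_eq_mul, CharP.cast_eq_zero, zero_mul,
    zero_add] at hfinal
  refine prod_X_pow_ne_sum (l := L) (fun i => Φ ⟨z' i, hz'mem i⟩) (hfinal.trans ?_)
  exact Finset.sum_congr rfl fun i _ => hΦmul _ ⟨z' i, hz'mem i⟩

end PairObstruction
end QFS
end

open MvPolynomial AlgebraicGeometry CategoryTheory Opposite
noncomputable section
namespace QFS

/-! ### Extending a form on Witt vectors to localizations of a quotient -/

section Extension

open WittVector

variable {p : ℕ} [Fact p.Prime] {n : ℕ}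

/-- The case c = f: the colon condition f^2 ∣ a f in the last slot is just f ∣ a, so the form
preserves divisibility by f in all slots. Normalization divides by the nonzero constant Ψ(1). -/
theorem exists_normalized_form_of_rowR {k : Type*} [Field k] [CharP k p] [PerfectRing k p]
    {N m : ℕ} {M : Fin m → Fin (N + 1) →₀ ℕ} (hM : Function.Injective M) {q : Fin (N + 1) → ℕ}
    (hq : ∀ i, 0 < q i) (hMq : ∀ a, a ∈ Set.range M ↔ Finsupp.weight q a = ∑ i, q i)
    {f : MvPolynomial (Fin (N + 1)) k} (hf : f.IsWeightedHomogeneous q (∑ i, q i))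
    (h0 : ∀ l < n, rowR p M f (l + 1) ⬝ᵥ coeffVec M f = 0)
    (h1 : rowR p M f (n + 1) ⬝ᵥ coeffVec M f ≠ 0) :
    ∃ Ψ : WittVector p (MvPolynomial (Fin (N + 1)) k) →+ MvPolynomial (Fin (N + 1)) k,
      (∀ x a, Ψ (frobenius x * a) = x.coeff 0 * Ψ a) ∧
      (∀ a, (∀ t < n + 1, f ∣ a.coeff t) → f ∣ Ψ a) ∧
      (∀ e a, (∀ t, (a.coeff t).IsWeightedHomogeneous q (p ^ (t + 1) * e)) →
        (Ψ a).IsWeightedHomogeneous q e) ∧ Ψ 1 = 1 := by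
  have hp := (Fact.out : p.Prime).ne_zero
  obtain ⟨D, Dt, hD, hDt, hDtm, hDt0⟩ := exists_termwiseLift_delta (p := p) hM
    fun a ha => (hMq a).2 (hf ha)
  have H : ∀ j, j + 1 < n + 1 →
      traceU p (f ^ (p - 2) * (fun h => traceU p (delta p M f * f ^ (p - 2) * h))^[j] f) = 0 := by
    intro j hj
    obtain ⟨r, hr, hr'⟩ := traceU_iterate_eq_C hM hq hMq hf hf j
    rw [h0 j (by omega)] at hr'
    rw [hr, pow_eq_zero_iff (pow_ne_zero _ hp) |>.1 hr', C_0]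
  obtain ⟨r, hr, hr'⟩ := traceU_iterate_eq_C hM hq hMq hf hf n
  have hr0 : r ≠ 0 := by
    rintro rfl
    rw [zero_pow (pow_ne_zero _ hp)] at hr'
    exact h1 hr'.symm
  refine ⟨(AddMonoidHom.mulLeft (C r⁻¹)).comp
    (AddMonoidHom.mk' (wittForm p f (delta p M f) f (n + 1)) (wittForm_add H)), ?_, ?_, ?_, ?_⟩
  · intro x a
    change C r⁻¹ * wittForm p f (delta p M f) f (n + 1) _ =
      _ * (C r⁻¹ * wittForm p f (delta p M f) f (n + 1) _)
    rw [wittForm_frobenius_mul H]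
    ring
  · intro a ha
    refine Dvd.dvd.mul_left (dvd_wittForm hD hDt hDtm hDt0 H (fun t ht => ha t (by omega))
      fun t ht => ?_) _
    rw [pow_two]
    exact mul_dvd_mul (ha t (by omega)) dvd_rfl
  · intro e a ha
    have := (isWeightedHomogeneous_C q r⁻¹).mul
      (wittForm_mem (n := n + 1) hf (delta_mem (p := p) (fun i => (hMq _).1 ⟨i, rfl⟩) f) hf ha)
    rwa [zero_add] at this
  · change C r⁻¹ * wittForm p f (delta p M f) f (n + 1) 1 = 1
    rw [wittForm_one H, hr, ← C_mul, inv_mul_cancel₀ hr0, C_1]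

variable {A L : Type*} [CommRing A] [CommRing L] [CharP A p] [CharP L p]
  {f : A} {Ψ : WittVector p A →+ A}

/-- F[g'] b - F[g] b' vanishes in L, so some s in T makes its components multiples of f after
multiplication by [s]^p. Then f divides s times the value of Ψ, and s is invertible in L. -/
theorem form_mul_eq_of_truncate_eq (hmul : ∀ x a, Ψ (frobenius x * a) = x.coeff 0 * Ψ a)
    (hdvd : ∀ a, (∀ t < n, f ∣ a.coeff t) → f ∣ Ψ a) {ι : A →+* L} {T : Submonoid A}
    (hT : ∀ s ∈ T, IsUnit (ι s)) (hker : ∀ b, ι b = 0 → ∃ s ∈ T, f ∣ s * b) (hf : ι f = 0)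
    {a : WittVector p L} {g g' : A} {b b' : WittVector p A}
    (h : truncate n (teichmuller p (ι g) ^ p * a) = truncate n (WittVector.map ι b))
    (h' : truncate n (teichmuller p (ι g') ^ p * a) = truncate n (WittVector.map ι b')) :
    ι g' * ι (Ψ b) = ι g * ι (Ψ b') := by
  classical
  have hz : ∀ t < n, ι ((frobenius (teichmuller p g') * b -
      frobenius (teichmuller p g) * b').coeff t) = 0 := by
    have h1 : truncate n (WittVector.map ι (frobenius (teichmuller p g') * b -
        frobenius (teichmuller p g) * b')) = truncate n 0 := by
      rw [map_sub, map_sub, map_mul, map_mul, map_mul, map_mul, ← h, ← h', frobenius_teichmuller,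
        frobenius_teichmuller, map_pow (WittVector.map ι), map_pow (WittVector.map ι),
        map_teichmuller, map_teichmuller, ← map_mul, ← map_mul, ← map_sub]
      congr 1
      ring
    intro t ht
    have := truncate_eq_iff.1 h1 t ht
    rwa [map_coeff, zero_coeff] at this
  choose! s hsT hs using fun (t : ℕ) (ht : t < n) => hker _ (hz t ht)
  have hS : (∏ t ∈ Finset.range n, s t) ∈ T :=
    prod_mem fun t ht => hsT t (Finset.mem_range.1 ht)
  have h2 := hdvd (frobenius (teichmuller p (∏ t ∈ Finset.range n, s t)) *
    (frobenius (teichmuller p g') * b - frobenius (teichmuller p g) * b')) (by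
      intro t ht
      rw [frobenius_teichmuller, coeff_teichmuller_pow_mul]
      refine (hs t ht).trans (mul_dvd_mul_right ?_ _)
      exact (Finset.dvd_prod_of_mem s (Finset.mem_range.2 ht)).trans
        (dvd_pow_self _ (pow_ne_zero _ (Fact.out : p.Prime).ne_zero)))
  rw [hmul, map_sub, hmul, hmul, teichmuller_coeff_zero, teichmuller_coeff_zero,
    teichmuller_coeff_zero] at h2
  have h3 := map_dvd ι h2
  rw [hf, zero_dvd_iff, map_mul, (hT _ hS).mul_right_eq_zero, map_sub, map_mul, map_mul,
    sub_eq_zero] at h3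
  exact h3

theorem exists_common_denominator {ι : A →+* L} {T : Submonoid A}
    (hsurj : ∀ y, ∃ s ∈ T, ∃ b, ι s * y = ι b) (a : WittVector p L) (n : ℕ) :
    ∃ s ∈ T, ∃ b : WittVector p A,
      truncate n (teichmuller p (ι s) * a) = truncate n (WittVector.map ι b) := by
  classical
  choose s hsT c hc using fun t => hsurj (a.coeff t)
  have h1 : ∀ t, ∃ b, t < n → (ι (∏ l ∈ Finset.range n, s l)) ^ p ^ t * a.coeff t = ι b := by
    intro t
    by_cases ht : t < n
    · obtain ⟨u, hu⟩ : s t ∣ (∏ l ∈ Finset.range n, s l) ^ p ^ t :=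
        (Finset.dvd_prod_of_mem s (Finset.mem_range.2 ht)).trans
          (dvd_pow_self _ (pow_ne_zero _ (Fact.out : p.Prime).ne_zero))
      refine ⟨c t * u, fun _ => ?_⟩
      rw [← map_pow, hu, map_mul, map_mul, ← hc t]
      ring
    · exact ⟨0, fun h => absurd h ht⟩
  choose b hb using h1
  refine ⟨∏ l ∈ Finset.range n, s l, prod_mem fun t _ => hsT t, WittVector.mk p b, truncate_eq_iff.2 fun t ht => ?_⟩
  rw [map_coeff, teichmuller_mul_coeff, hb t ht]
  rfl

/-- L is a localization of A/fA. Put Φ(a) = Ψ(b)/g for any b, g with [g]^p a = b in W_n(L);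
semilinearity of Ψ dictates this, and the choice is immaterial by `form_mul_eq_of_truncate_eq`. -/
theorem exists_extension_of_form (hn : 0 < n)
    (hmul : ∀ x a, Ψ (frobenius x * a) = x.coeff 0 * Ψ a)
    (hdvd : ∀ a, (∀ t < n, f ∣ a.coeff t) → f ∣ Ψ a) {ι : A →+* L} {T : Submonoid A}
    (hT : ∀ s ∈ T, IsUnit (ι s)) (hsurj : ∀ y, ∃ s ∈ T, ∃ b, ι s * y = ι b)
    (hker : ∀ b, ι b = 0 → ∃ s ∈ T, f ∣ s * b) (hf : ι f = 0) :
    ∃ Φ : TruncatedWittVector p n L → L, (∀ a b, Φ (a + b) = Φ a + Φ b) ∧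
      (∀ a b, Φ (wittFrob p a * b) = a.coeff ⟨0, hn⟩ * Φ b) ∧
      ∀ (a : TruncatedWittVector p n L) (g : A) (b : WittVector p A), IsUnit (ι g) →
        (∀ t : Fin n, ι g ^ p ^ (t + 1 : ℕ) * a.coeff t = ι (b.coeff t)) →
          ι g * Φ a = ι (Ψ b) := by
  have hex : ∀ a : WittVector p L, ∃ y : L, ∃ g ∈ T, ∃ b, ι g * y = ι (Ψ b) ∧
      truncate n (teichmuller p (ι g) ^ p * a) = truncate n (WittVector.map ι b) := by
    intro a
    obtain ⟨s, hs, b, hb⟩ := exists_common_denominator hsurj a n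
    obtain ⟨u, hu⟩ := (hT s hs).exists_right_inv
    have e : p - 1 + 1 = p := Nat.succ_pred (Fact.out : p.Prime).ne_zero
    refine ⟨u * ι (Ψ (teichmuller p s ^ (p - 1) * b)), s, hs, teichmuller p s ^ (p - 1) * b,
      by rw [← mul_assoc, hu, one_mul], ?_⟩
    rw [map_mul (WittVector.map ι), map_mul (truncate n) (WittVector.map ι _), ← hb,
      map_pow (WittVector.map ι), map_teichmuller, ← map_mul (truncate n), ← mul_assoc, ← pow_succ,
      e]
  choose Φ₀ g₀ hg₀ b₀ h₁ h₂ using hex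
  have key : ∀ (a : WittVector p L) (g : A) (b : WittVector p A), IsUnit (ι g) →
      truncate n (teichmuller p (ι g) ^ p * a) = truncate n (WittVector.map ι b) →
      ι g * Φ₀ a = ι (Ψ b) := by
    intro a g b _ h
    have h3 := form_mul_eq_of_truncate_eq hmul hdvd hT hker hf (h₂ a) h
    rw [← h₁ a] at h3
    apply (hT _ (hg₀ a)).mul_left_cancel
    rw [← h3]
    ring
  have key' : ∀ {a a' : WittVector p L}, truncate n a = truncate n a' → Φ₀ a = Φ₀ a' := by
    intro a a' h
    have h3 := key a' (g₀ a) (b₀ a) (hT _ (hg₀ a)) (by rw [← h₂ a, map_mul, map_mul, h])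
    rw [← h₁ a] at h3
    exact ((hT _ (hg₀ a)).mul_left_cancel h3).symm
  have hadd : ∀ a b : WittVector p L, Φ₀ (a + b) = Φ₀ a + Φ₀ b := by
    intro a b
    have hu := (hT _ (hg₀ a)).mul (hT _ (hg₀ b))
    have h3 := key (a + b) (g₀ a * g₀ b)
      (frobenius (teichmuller p (g₀ b)) * b₀ a + frobenius (teichmuller p (g₀ a)) * b₀ b)
      (by rwa [map_mul]) (by
        rw [map_add (WittVector.map ι), map_mul (WittVector.map ι), map_mul (WittVector.map ι),
          map_add (truncate n) (WittVector.map ι _ * _),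
          map_mul (truncate n) (WittVector.map ι _) (WittVector.map ι (b₀ a)),
          map_mul (truncate n) (WittVector.map ι _) (WittVector.map ι (b₀ b)), ← h₂, ← h₂,
          frobenius_teichmuller, frobenius_teichmuller, map_pow (WittVector.map ι),
          map_pow (WittVector.map ι), map_teichmuller, map_teichmuller, ← map_mul (truncate n),
          ← map_mul (truncate n), ← map_add (truncate n), map_mul ι, map_mul (teichmuller p)]
        refine congrArg (truncate n) ?_
        ring)
    rw [map_add, hmul, hmul, teichmuller_coeff_zero, teichmuller_coeff_zero, map_add, map_mul,
      map_mul, map_mul, ← h₁, ← h₁] at h3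
    apply hu.mul_left_cancel
    rw [h3]
    ring
  have hfrob : ∀ a b : WittVector p L, Φ₀ (frobenius a * b) = a.coeff 0 * Φ₀ b := by
    intro a b
    obtain ⟨s, hs, x, hx⟩ := exists_common_denominator hsurj a n
    have hu := (hT _ hs).mul (hT _ (hg₀ b))
    have hF : truncate n (frobenius (teichmuller p (ι s) * a)) =
        truncate n (WittVector.map ι (frobenius x)) := by
      rw [← wittFrob_truncate, hx, wittFrob_truncate]
      refine congrArg (truncate n) (WittVector.ext fun t => ?_)
      rw [coeff_frobenius_charP, map_coeff, map_coeff, coeff_frobenius_charP, map_pow]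
    have h3 := key (frobenius a * b) (s * g₀ b) (frobenius x * b₀ b)
      (by rwa [map_mul]) (by
        rw [map_mul (WittVector.map ι), map_mul (truncate n) (WittVector.map ι _), ← hF, ← h₂,
          map_mul WittVector.frobenius, frobenius_teichmuller, ← map_mul (truncate n), map_mul ι,
          map_mul (teichmuller p)]
        refine congrArg (truncate n) ?_
        ring)
    rw [hmul, map_mul, map_mul, ← h₁] at h3
    have h4 : ι s * a.coeff 0 = ι (x.coeff 0) := by
      have := truncate_eq_iff.1 hx 0 hn
      rwa [map_coeff, teichmuller_mul_coeff, pow_zero, pow_one] at this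
    apply hu.mul_left_cancel
    rw [h3, ← h4]
    ring
  refine ⟨fun a => Φ₀ a.out, ?_, ?_, ?_⟩
  · intro a b
    change Φ₀ (a + b).out = Φ₀ a.out + Φ₀ b.out
    rw [← hadd]
    exact key' (by rw [truncate_out, map_add, truncate_out, truncate_out])
  · intro a b
    change Φ₀ (wittFrob p a * b).out = _ * Φ₀ b.out
    have e : a.coeff ⟨0, hn⟩ = a.out.coeff 0 := by
      conv_lhs => rw [← truncate_out a]
      rw [coeff_truncate]
    rw [e, ← hfrob]
    exact key' (by rw [truncate_out, map_mul, truncate_out, ← wittFrob_truncate, truncate_out])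
  · intro a g b hg h
    refine key _ g b hg (truncate_eq_iff.2 fun t ht => ?_)
    rw [coeff_teichmuller_pow_mul, map_coeff, ← h ⟨t, ht⟩]
    congr 1
    conv_rhs => rw [← truncate_out a]
    rw [coeff_truncate]

end Extension
end QFS
end

open MvPolynomial AlgebraicGeometry CategoryTheory Opposite
noncomputable section
namespace QFS

/-! ### Sections of the structure sheaf of `Proj` as functions -/

section ProjSections

universe u

variable {k : Type*} [Field k] {S : Type u} [CommRing S] [Algebra k S]
  (𝒮 : ℕ → Submodule k S) [GradedAlgebra 𝒮]

instance isPrime_asHomogeneousIdeal (x : Proj 𝒮) : x.asHomogeneousIdeal.toIdeal.IsPrime :=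
  x.isPrime

/-- The localization of the graded ring at a point of `Proj`. -/
abbrev LocAt (x : Proj 𝒮) : Type u :=
  Localization.AtPrime x.asHomogeneousIdeal.toIdeal

/-- The value of a section at a point, in the full localization. -/
def evalAt (U : (Proj 𝒮).Opens) (x : Proj 𝒮) (hx : x ∈ U) : Γ(Proj 𝒮, U) →+* LocAt 𝒮 x :=
  (algebraMap (HomogeneousLocalization.AtPrime 𝒮 x.asHomogeneousIdeal.toIdeal) (LocAt 𝒮 x)).comp
    (openToLocalization 𝒮 U x hx).hom

variable {𝒮}

theorem evalAt_res {U V : (Proj 𝒮).Opens} (h : V ≤ U) (x : Proj 𝒮) (hx : x ∈ V)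
    (s : Γ(Proj 𝒮, U)) :
    evalAt 𝒮 V x hx (((Proj 𝒮).presheaf.map (homOfLE h).op).hom s) = evalAt 𝒮 U x (h hx) s :=
  rfl

theorem section_ext {U : (Proj 𝒮).Opens} {s t : Γ(Proj 𝒮, U)}
    (h : ∀ x hx, evalAt 𝒮 U x hx s = evalAt 𝒮 U x hx t) : s = t :=
  Subtype.ext (funext fun x => HomogeneousLocalization.val_injective _ (h x.1 x.2))

theorem exists_eq_fraction {U : (Proj 𝒮).Opens} (s : Γ(Proj 𝒮, U)) (x : Proj 𝒮) (hx : x ∈ U) :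
    ∃ (V : (Proj 𝒮).Opens) (_ : x ∈ V) (h : V ≤ U) (e : ℕ) (r g : S), r ∈ 𝒮 e ∧ g ∈ 𝒮 e ∧
      (∀ y ∈ V, g ∉ y.asHomogeneousIdeal) ∧
      ∀ y (hy : y ∈ V), algebraMap S (LocAt 𝒮 y) g * evalAt 𝒮 U y (h hy) s =
        algebraMap S (LocAt 𝒮 y) r := by
  obtain ⟨V, hV, i, e, r, g, hg, h⟩ := s.2 ⟨x, hx⟩
  refine ⟨V, hV, i.le, e, r, g, r.2, g.2, fun y hy => hg ⟨y, hy⟩, fun y hy => ?_⟩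
  have h1 : evalAt 𝒮 U y (i.le hy) s = Localization.mk (r : S) ⟨g, hg ⟨y, hy⟩⟩ :=
    congrArg HomogeneousLocalization.val (h ⟨y, hy⟩)
  rw [h1, Localization.mk_eq_mk']
  exact IsLocalization.mk'_spec' (LocAt 𝒮 y) (r : S)
    (⟨g, hg ⟨y, hy⟩⟩ : y.asHomogeneousIdeal.toIdeal.primeCompl)

theorem exists_section {U : (Proj 𝒮).Opens} (F : ∀ x ∈ U, LocAt 𝒮 x)
    (hF : ∀ x ∈ U, ∃ (V : (Proj 𝒮).Opens) (_ : x ∈ V) (h : V ≤ U) (e : ℕ) (r g : S),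
      r ∈ 𝒮 e ∧ g ∈ 𝒮 e ∧ (∀ y ∈ V, g ∉ y.asHomogeneousIdeal) ∧
      ∀ y (hy : y ∈ V), algebraMap S (LocAt 𝒮 y) g * F y (h hy) = algebraMap S (LocAt 𝒮 y) r) :
    ∃ s : Γ(Proj 𝒮, U), ∀ x hx, evalAt 𝒮 U x hx s = F x hx := by
  have key : ∀ (y : Proj 𝒮) (e : ℕ) (r g : 𝒮 e) (hg : (g : S) ∉ y.asHomogeneousIdeal)
      (z : LocAt 𝒮 y), algebraMap S (LocAt 𝒮 y) g * z = algebraMap S (LocAt 𝒮 y) r →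
      z = (HomogeneousLocalization.mk ⟨e, r, g, hg⟩ :
        HomogeneousLocalization.AtPrime 𝒮 y.asHomogeneousIdeal.toIdeal).val := by
    intro y e r g hg z hz
    rw [HomogeneousLocalization.val_mk, Localization.mk_eq_mk', IsLocalization.eq_mk'_iff_mul_eq,
      mul_comm]
    exact hz
  have hval : ∀ x : U, ∃ z : HomogeneousLocalization.AtPrime 𝒮 x.1.asHomogeneousIdeal.toIdeal,
      z.val = F x.1 x.2 := by
    intro x
    obtain ⟨V, hV, h, e, r, g, hr, hg, hgV, hy⟩ := hF x.1 x.2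
    exact ⟨_, (key x.1 e ⟨r, hr⟩ ⟨g, hg⟩ (hgV _ hV) _ (hy x.1 hV)).symm⟩
  choose z hz using hval
  refine ⟨⟨z, fun x => ?_⟩, fun x hx => hz ⟨x, hx⟩⟩
  obtain ⟨V, hV, h, e, r, g, hr, hg, hgV, hy⟩ := hF x.1 x.2
  refine ⟨V, hV, homOfLE h, e, ⟨r, hr⟩, ⟨g, hg⟩, fun y => hgV y.1 y.2, fun y => ?_⟩
  apply HomogeneousLocalization.val_injective
  refine (hz ⟨y.1, h y.2⟩).trans ?_
  exact key y.1 e ⟨r, hr⟩ ⟨g, hg⟩ (hgV _ y.2) _ (hy y.1 y.2)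

/-- Finitely many sections have, locally, a common denominator. -/
theorem exists_common_fraction {U : (Proj 𝒮).Opens} {n : ℕ} (s : Fin n → Γ(Proj 𝒮, U))
    (x : Proj 𝒮) (hx : x ∈ U) :
    ∃ (V : (Proj 𝒮).Opens) (_ : x ∈ V) (h : V ≤ U) (e : ℕ) (r : Fin n → S) (g : S),
      (∀ t, r t ∈ 𝒮 e) ∧ g ∈ 𝒮 e ∧ (∀ y ∈ V, g ∉ y.asHomogeneousIdeal) ∧
      ∀ y (hy : y ∈ V) t, algebraMap S (LocAt 𝒮 y) g * evalAt 𝒮 U y (h hy) (s t) =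
        algebraMap S (LocAt 𝒮 y) (r t) := by
  induction n with
  | zero =>
    refine ⟨U, hx, le_rfl, 0, fun _ => 0, 1, fun _ => zero_mem _, SetLike.GradedOne.one_mem,
      fun y _ => ?_, fun y hy t => t.elim0⟩
    exact fun h => (inferInstance : y.asHomogeneousIdeal.toIdeal.IsPrime).ne_top
      ((Ideal.eq_top_iff_one _).2 h)
  | succ n ih =>
    obtain ⟨V, hV, h, e, r, g, hr, hg, hgV, hy⟩ := ih fun t => s t.succ
    obtain ⟨V', hV', h', e', r', g', hr', hg', hgV', hy'⟩ := exists_eq_fraction (s 0) x hx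
    refine ⟨V ⊓ V', ⟨hV, hV'⟩, inf_le_left.trans h, e + e',
      Fin.cons (g * r') fun t => r t * g', g * g', ?_, SetLike.mul_mem_graded hg hg', ?_, ?_⟩
    · intro t
      refine Fin.cases ?_ (fun t => ?_) t
      · exact SetLike.mul_mem_graded hg hr'
      · exact SetLike.mul_mem_graded (hr t) hg'
    · intro y hyV
      exact y.asHomogeneousIdeal.toIdeal.primeCompl.mul_mem (hgV y hyV.1) (hgV' y hyV.2)
    · intro y hyV t
      refine Fin.cases ?_ (fun t => ?_) t
      · rw [Fin.cons_zero, map_mul, map_mul, mul_assoc, hy' y hyV.2]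
      · rw [Fin.cons_succ, map_mul, map_mul, ← hy y hyV.1 t]
        ring

end ProjSections

/-! ### Gluing a form to a splitting of Proj -/

section ProjExistence

open WittVector

universe u

variable {p : ℕ} [Fact p.Prime] {k : Type*} [Field k] [CharP k p] {A : Type*} [CommRing A]
  [CharP A p] {S : Type u} [CommRing S] [Algebra k S] {𝒮 : ℕ → Submodule k S} [GradedAlgebra 𝒮]

theorem charP_locAt (x : Proj 𝒮) : CharP (LocAt 𝒮 x) p :=
  charP_of_injective_ringHom
    (f := (algebraMap S (LocAt 𝒮 x)).comp (algebraMap k S)) (RingHom.injective _) p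

theorem wittMap_add {n : ℕ} {R R' : Type*} [CommRing R] [CommRing R'] (g : R →+* R')
    (a b : TruncatedWittVector p n R) : wittMap p g (a + b) = wittMap p g a + wittMap p g b := by
  rw [← truncate_out a, ← truncate_out b, ← map_add, wittMap_truncate, wittMap_truncate,
    wittMap_truncate, map_add, map_add]

theorem wittMap_mul {n : ℕ} {R R' : Type*} [CommRing R] [CommRing R'] (g : R →+* R')
    (a b : TruncatedWittVector p n R) : wittMap p g (a * b) = wittMap p g a * wittMap p g b := by
  rw [← truncate_out a, ← truncate_out b, ← map_mul, wittMap_truncate, wittMap_truncate,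
    wittMap_truncate, map_mul, map_mul]

theorem coeff_wittMap {n : ℕ} {R R' : Type*} [CommRing R] [CommRing R'] (g : R →+* R')
    (a : TruncatedWittVector p n R) (i : Fin n) : (wittMap p g a).coeff i = g (a.coeff i) := by
  simp [wittMap]

theorem wittMap_wittFrob {n : ℕ} {R R' : Type*} [CommRing R] [CommRing R'] (g : R →+* R')
    (a : TruncatedWittVector p n R) : wittMap p g (wittFrob p a) = wittFrob p (wittMap p g a) :=
  TruncatedWittVector.ext fun i => by simp [wittMap, wittFrob]

/-- Extend Ψ to the full localization at each point and apply it to germs. The germs form a section: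
where a_t = r_t/g with a common g of degree e, the value is Ψ(b)/g with b_t = g^(p^(t+1)-1) r_t of
degree p^(t+1) e, hence a quotient of elements of degree e. -/
theorem isQuasiFSplit_proj_of_form {n : ℕ} (hn : 0 < n) {f : A} {Ψ : WittVector p A →+ A}
    (hmul : ∀ x a, Ψ (frobenius x * a) = x.coeff 0 * Ψ a)
    (hdvd : ∀ a, (∀ t < n, f ∣ a.coeff t) → f ∣ Ψ a) (hone : Ψ 1 = 1) {𝒜 : ℕ → Set A}
    (h0 : ∀ e, 0 ∈ 𝒜 e)
    (hdeg : ∀ e a, (∀ t, a.coeff t ∈ 𝒜 (p ^ (t + 1) * e)) → Ψ a ∈ 𝒜 e)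
    {π : A →+* S} (hπs : Function.Surjective π) (hker : ∀ a, π a = 0 ↔ f ∣ a)
    (hπ : ∀ e a, a ∈ 𝒜 e → π a ∈ 𝒮 e) (hπ' : ∀ e, ∀ s ∈ 𝒮 e, ∃ a ∈ 𝒜 e, π a = s) :
    IsQuasiFSplit p (Proj 𝒮) n := by
  have h2 := (Fact.out : p.Prime).two_le
  have hΦ : ∀ x : Proj 𝒮, ∃ Φ : TruncatedWittVector p n (LocAt 𝒮 x) → LocAt 𝒮 x,
      (∀ a b, Φ (a + b) = Φ a + Φ b) ∧
      (∀ a b, Φ (wittFrob p a * b) = a.coeff ⟨0, hn⟩ * Φ b) ∧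
      ∀ (a : TruncatedWittVector p n (LocAt 𝒮 x)) (g : A) (b : WittVector p A),
        IsUnit ((algebraMap S (LocAt 𝒮 x)).comp π g) →
        (∀ t : Fin n, (algebraMap S (LocAt 𝒮 x)).comp π g ^ p ^ (t + 1 : ℕ) * a.coeff t =
          (algebraMap S (LocAt 𝒮 x)).comp π (b.coeff t)) →
          (algebraMap S (LocAt 𝒮 x)).comp π g * Φ a = (algebraMap S (LocAt 𝒮 x)).comp π (Ψ b) := by
    intro x
    have : CharP (LocAt 𝒮 x) p := charP_locAt (k := k) x
    refine exists_extension_of_form (T := x.asHomogeneousIdeal.toIdeal.primeCompl.comap π) hn hmul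
      hdvd ?_ ?_ ?_ ?_
    · intro s hs
      exact IsLocalization.map_units (LocAt 𝒮 x) (⟨π s, hs⟩ : x.asHomogeneousIdeal.toIdeal.primeCompl)
    · intro y
      obtain ⟨⟨b, s⟩, hy⟩ := IsLocalization.surj x.asHomogeneousIdeal.toIdeal.primeCompl y
      obtain ⟨b, rfl⟩ := hπs b
      obtain ⟨s', hs'⟩ := hπs s
      refine ⟨s', ?_, b, ?_⟩
      · change π s' ∈ x.asHomogeneousIdeal.toIdeal.primeCompl
        rw [hs']
        exact s.2
      · rw [RingHom.comp_apply, RingHom.comp_apply, hs', mul_comm]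
        exact hy
    · intro b hb
      obtain ⟨s, hs⟩ := (IsLocalization.map_eq_zero_iff
        x.asHomogeneousIdeal.toIdeal.primeCompl (LocAt 𝒮 x) (π b)).1 hb
      obtain ⟨s', hs'⟩ := hπs s
      refine ⟨s', ?_, ?_⟩
      · change π s' ∈ x.asHomogeneousIdeal.toIdeal.primeCompl
        rw [hs']
        exact s.2
      · rw [← hker, map_mul, hs', hs]
    · rw [RingHom.comp_apply, (hker f).2 dvd_rfl, map_zero]
  choose Φ hΦadd hΦmul hΦval using hΦ
  have hex : ∀ (U : (Proj 𝒮).Opens) (a : TruncatedWittVector p n Γ(Proj 𝒮, U)),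
      ∃ s : Γ(Proj 𝒮, U), ∀ x hx,
        evalAt 𝒮 U x hx s = Φ x (wittMap p (evalAt 𝒮 U x hx) a) := by
    intro U a
    refine exists_section (fun x hx => Φ x (wittMap p (evalAt 𝒮 U x hx) a)) fun x hx => ?_
    obtain ⟨V, hV, h, e, r, g, hr, hg, hgV, hy⟩ := exists_common_fraction
      (fun t => a.coeff t) x hx
    obtain ⟨g', hg', rfl⟩ := hπ' e g hg
    have hb : ∀ t : ℕ, ∃ b ∈ 𝒜 (p ^ (t + 1) * e), ∀ ht : t < n,
        π b = π g' ^ (p ^ (t + 1) - 1) * r ⟨t, ht⟩ := by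
      intro t
      by_cases ht : t < n
      · obtain ⟨b, hb, hb'⟩ := hπ' (p ^ (t + 1) * e) (π g' ^ (p ^ (t + 1) - 1) * r ⟨t, ht⟩) (by
          have h1 := SetLike.mul_mem_graded (SetLike.pow_mem_graded (p ^ (t + 1) - 1) hg)
            (hr ⟨t, ht⟩)
          have h3 : (p ^ (t + 1) - 1) • e + e = p ^ (t + 1) * e := by
            rw [smul_eq_mul, ← Nat.succ_mul, Nat.succ_eq_add_one,
              Nat.sub_add_cancel (Nat.one_le_pow _ _ (by omega))]
          rwa [h3] at h1)
        exact ⟨b, hb, fun _ => hb'⟩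
      · exact ⟨0, h0 _, fun h => absurd h ht⟩
    choose b hb hb' using hb
    refine ⟨V, hV, h, e, π (Ψ (WittVector.mk p b)), π g', hπ _ _ (hdeg _ _ hb), hg, hgV,
      fun y hyV => ?_⟩
    refine hΦval y _ g' (WittVector.mk p b) (IsLocalization.map_units (LocAt 𝒮 y)
      (⟨π g', hgV y hyV⟩ : y.asHomogeneousIdeal.toIdeal.primeCompl)) fun t => ?_
    have h3 : (WittVector.mk p b).coeff t = b t := rfl
    have h4 : p ^ (t + 1 : ℕ) = p ^ (t + 1 : ℕ) - 1 + 1 :=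
      (Nat.sub_add_cancel (Nat.one_le_pow _ _ (by omega))).symm
    rw [h3, RingHom.comp_apply, RingHom.comp_apply, hb' t t.2, coeff_wittMap, map_mul,
      ← hy y hyV, map_pow]
    conv_lhs => rw [h4, pow_succ]
    rw [mul_assoc]
  choose φ hφ using hex
  have hΦone : ∀ x, Φ x 1 = 1 := by
    intro x
    have h3 := hΦval x 1 1 1 (by rw [map_one]; exact isUnit_one) (fun t => by
      rw [map_one, one_pow, one_mul]
      rw [← map_one (truncate (p := p) n), coeff_truncate, ← map_coeff, map_one])
    rwa [map_one, one_mul, hone, map_one] at h3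
  have hφadd : ∀ U a b, φ U (a + b) = φ U a + φ U b := fun U a b => section_ext fun x hx => by
    rw [hφ, wittMap_add, hΦadd, map_add, hφ, hφ]
  have hφmul : ∀ (U : (Proj 𝒮).Opens) (a b : TruncatedWittVector p n Γ(Proj 𝒮, U)),
      φ U (wittFrob p a * b) = a.coeff ⟨0, hn⟩ * φ U b := fun U a b => section_ext fun x hx => by
    rw [hφ, wittMap_mul, wittMap_wittFrob, hΦmul, map_mul, hφ, coeff_wittMap]
  refine ⟨hn, fun U => AddMonoidHom.mk' (φ U) (hφadd U), ?_, hφmul, ?_⟩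
  · intro U V h a
    refine section_ext fun x hx => ?_
    rw [evalAt_res]
    change evalAt 𝒮 V x hx (φ V _) = evalAt 𝒮 U x (h hx) (φ U a)
    rw [hφ, hφ]
    congr 1
  · intro U a
    have h3 := hφmul U a 1
    rw [mul_one] at h3
    refine h3.trans ?_
    have h4 : φ U 1 = 1 := section_ext fun x hx => by
      rw [hφ, map_one, ← hΦone x]
      congr 1
      rw [← map_one (truncate (p := p) n), wittMap_truncate, map_one, map_one]
    rw [h4, mul_one]

end ProjExistence
end QFS
end

open MvPolynomial AlgebraicGeometry CategoryTheory Opposite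
noncomputable section
namespace QFS

/-! ### The splitting of the hypersurface -/

section HypersurfaceExistence

variable {p : ℕ} [Fact p.Prime] {k : Type*} [Field k] [CharP k p] [PerfectRing k p]

theorem exists_isWeightedHomogeneous_of_mem_quotGrading {N : ℕ} {q : Fin (N + 1) → ℕ}
    {I : Ideal (MvPolynomial (Fin (N + 1)) k)} {e : ℕ} {s : MvPolynomial (Fin (N + 1)) k ⧸ I}
    (hs : s ∈ quotGrading (weightedHomogeneousSubmodule k q) I e) :
    ∃ a : MvPolynomial (Fin (N + 1)) k, a.IsWeightedHomogeneous q e ∧ Ideal.Quotient.mk I a = s :=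
  hs

theorem isQuasiFSplit_hypersurface_of_rowR {N m n : ℕ} {M : Fin m → Fin (N + 1) →₀ ℕ}
    (hM : Function.Injective M) {q : Fin (N + 1) → ℕ} (hq : ∀ i, 0 < q i)
    (hMq : ∀ a, a ∈ Set.range M ↔ Finsupp.weight q a = ∑ i, q i)
    {f : MvPolynomial (Fin (N + 1)) k} (hf : f.IsWeightedHomogeneous q (∑ i, q i))
    (h0 : ∀ l < n, rowR p M f (l + 1) ⬝ᵥ coeffVec M f = 0)
    (h1 : rowR p M f (n + 1) ⬝ᵥ coeffVec M f ≠ 0) :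
    IsQuasiFSplit p (hypersurface q f (∑ i, q i) hf) (n + 1) := by
  obtain ⟨Ψ, hmul, hdvd, hdeg, hone⟩ := exists_normalized_form_of_rowR hM hq hMq hf h0 h1
  letI := weightedGradedAlgebra k q
  letI := quotGradedAlgebra (weightedHomogeneousSubmodule k q) (Ideal.span {f})
    (isHomogeneous_span q hf)
  exact isQuasiFSplit_proj_of_form (𝒮 := quotGrading (weightedHomogeneousSubmodule k q)
    (Ideal.span {f})) n.succ_pos hmul hdvd hone
    (𝒜 := fun e => {a | a.IsWeightedHomogeneous q e}) (fun e => isWeightedHomogeneous_zero k q e)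
    hdeg (π := Ideal.Quotient.mk (Ideal.span {f})) Ideal.Quotient.mk_surjective
    (fun a => Ideal.Quotient.eq_zero_iff_mem.trans Ideal.mem_span_singleton)
    (fun e a ha => mk_mem_quotGrading ha)
    fun e s hs => exists_isWeightedHomogeneous_of_mem_quotGrading hs

end HypersurfaceExistence

/-! ### Eliminating multiples of p from the error terms -/

section GoodSum

open WittVector

variable {p : ℕ} [Fact p.Prime] {k : Type*} [Field k] [CharP k p]
  [PerfectRing k p] {Λ : Type*} [AddCommMonoid Λ] {ι : Type*} [Fintype ι]

theorem truncate_verschiebung_congr {R : Type*} [CommRing R] {n : ℕ} {x y : WittVector p R}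
    (h : truncate n x = truncate n y) :
    truncate (n + 1) (verschiebung x) = truncate (n + 1) (verschiebung y) := by
  rw [truncate_eq_iff] at h ⊢
  rintro (_ | t) ht
  · rw [verschiebung_coeff_zero, verschiebung_coeff_zero]
  · rw [verschiebung_coeff_succ, verschiebung_coeff_succ, h t (by omega)]

theorem admissible_mulFil {f : AddMonoidAlgebra k Λ} {v : Λ →+ ℤ} (hf : f ∈ expFil k v (-1)) :
    Admissible p fun _ : ℕ => mulFil f v 1 1 := by
  have h2 := (Fact.out : p.Prime).two_le
  intro t
  refine (mulFil_pow_le 1 1 p).trans (mulFil_le hf (by omega) ?_)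
  push_cast
  linarith

/-- Up to length `n`, the Witt vector `x` is a sum of Witt vectors with components of the form
`f * b` with `b` of positive exponent at some coordinate. -/
def IsGoodSum (p : ℕ) [Fact p.Prime] (f : AddMonoidAlgebra k Λ) (v : ι → Λ →+ ℤ) (n : ℕ)
    (x : WittVector p (AddMonoidAlgebra k Λ)) : Prop :=
  ∃ z : ι → WittVector p (AddMonoidAlgebra k Λ),
    (∀ i t, (z i).coeff t ∈ mulFil f (v i) 1 1) ∧ truncate n x = truncate n (∑ i, z i)

variable {f : AddMonoidAlgebra k Λ} {v : ι → Λ →+ ℤ} {n : ℕ}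
  {x y : WittVector p (AddMonoidAlgebra k Λ)}

theorem IsGoodSum.of_mem_ideal_zero (x : WittVector p (AddMonoidAlgebra k Λ)) :
    IsGoodSum p f v 0 x :=
  ⟨0, fun i t => by rw [Pi.zero_apply, zero_coeff]; exact zero_mem _,
    truncate_eq_iff.2 fun t ht => absurd ht (Nat.not_lt_zero t)⟩

theorem IsGoodSum.add (hf : ∀ i, f ∈ expFil k (v i) (-1))
    (hx : IsGoodSum p f v n x) (hy : IsGoodSum p f v n y) :
    IsGoodSum p f v n (x + y) := by
  obtain ⟨z, hz, hxz⟩ := hx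
  obtain ⟨w, hw, hyw⟩ := hy
  refine ⟨z + w, fun i => ?_, ?_⟩
  · exact add_mem (S := AddSubgroup _) (s := wittSubgroup _ (admissible_mulFil (p := p) (hf i)))
      (hz i) (hw i)
  · rw [map_add, hxz, hyw, ← map_add, ← Finset.sum_add_distrib]
    rfl

theorem IsGoodSum.single (i : ι) (hx : ∀ t < n, x.coeff t ∈ mulFil f (v i) 1 1) :
    IsGoodSum p f v n x := by
  classical
  refine ⟨Pi.single i (WittVector.mk p fun t => if t < n then x.coeff t else 0), fun j t => ?_, ?_⟩
  · rcases eq_or_ne j i with rfl | h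
    · rw [Pi.single_eq_same]
      change (if t < n then x.coeff t else 0) ∈ _
      split_ifs with ht
      · exact hx t ht
      · exact zero_mem _
    · rw [Pi.single_eq_of_ne h, zero_coeff]
      exact zero_mem _
  · rw [Finset.sum_pi_single' i]
    simp only [Finset.mem_univ, if_true]
    refine truncate_eq_iff.2 fun t ht => ?_
    change _ = if t < n then x.coeff t else 0
    rw [if_pos ht]

theorem IsGoodSum.sum (hf : ∀ i, f ∈ expFil k (v i) (-1))
    {α : Type*} (s : Finset α) {x : α → WittVector p (AddMonoidAlgebra k Λ)}
    (hx : ∀ a ∈ s, IsGoodSum p f v n (x a)) : IsGoodSum p f v n (∑ a ∈ s, x a) := by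
  classical
  induction s using Finset.induction_on with
  | empty =>
    refine ⟨0, fun i t => by rw [Pi.zero_apply, zero_coeff]; exact zero_mem _, by simp⟩
  | insert a s ha ih =>
    rw [Finset.sum_insert ha]
    exact IsGoodSum.add hf (hx a (Finset.mem_insert_self a s))
      (ih fun b hb => hx b (Finset.mem_insert_of_mem hb))

theorem IsGoodSum.verschiebung (hx : IsGoodSum p f v n x) :
    IsGoodSum p f v (n + 1) (verschiebung x) := by
  obtain ⟨z, hz, hxz⟩ := hx
  refine ⟨fun i => WittVector.verschiebung (z i), fun i t => ?_, ?_⟩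
  · rcases t with _ | t
    · rw [verschiebung_coeff_zero]
      exact zero_mem _
    · rw [verschiebung_coeff_succ]
      exact hz i t
  · rw [truncate_verschiebung_congr hxz, map_sum]

theorem IsGoodSum.map_mul (hf : ∀ i, f ∈ expFil k (v i) (-1))
    (hx : IsGoodSum p f v n x) (w : WittVector p k) :
    IsGoodSum p f v n (WittVector.map (algebraMap k (AddMonoidAlgebra k Λ)) w * x) := by
  obtain ⟨z, hz, hxz⟩ := hx
  refine ⟨fun i => WittVector.map (algebraMap k (AddMonoidAlgebra k Λ)) w * z i, fun i => ?_, ?_⟩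
  · exact map_mul_mem_wittSubgroup (hJ := admissible_mulFil (p := p) (hf i)) w (hz i)
  · rw [_root_.map_mul, hxz, ← _root_.map_mul, Finset.mul_sum]

theorem IsGoodSum.congr (hx : IsGoodSum p f v n x) (h : truncate n y = truncate n x) :
    IsGoodSum p f v n y := by
  obtain ⟨z, hz, hxz⟩ := hx
  exact ⟨z, hz, h.trans hxz⟩

/-- Induction on the length. The term p y = V F y of F[f] has length one less inside V, where the
result is known for y. This settles F[f]; a general x divisible by f is a sum of Teichmüller lifts
[f t], with t running over the terms of x_0/f, plus a V, treated the same way. -/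
theorem isGoodSum_frobenius (hf : ∀ i, f ∈ expFil k (v i) (-1))
    (hv : ∀ a : Λ, a ≠ 0 → ∃ i, 1 ≤ v i a) {n : ℕ}
    (hF : ∃ (y : WittVector p (AddMonoidAlgebra k Λ)) (z : ι → WittVector p (AddMonoidAlgebra k Λ)),
      y ∈ wittDvd p f ∧ (∀ i, ∀ t < n, (z i).coeff t ∈ mulFil f (v i) 1 1) ∧
      truncate n (frobenius (teichmuller p f)) =
        truncate n ((p : WittVector p (AddMonoidAlgebra k Λ)) * y + ∑ i, z i))
    {l : ℕ} (hl : l ≤ n) (x : WittVector p (AddMonoidAlgebra k Λ)) (hx : x ∈ wittDvd p f) :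
    IsGoodSum p f v l (frobenius x) := by
  classical
  have h2 := (Fact.out : p.Prime).two_le
  obtain ⟨y, z, hy, hz, hyz⟩ := hF
  induction l generalizing x with
  | zero => exact IsGoodSum.of_mem_ideal_zero _
  | succ l ih =>
    have hl' : l ≤ n := by omega
    have hFf : IsGoodSum p f v (l + 1) (frobenius (teichmuller p f)) := by
      have h1 : IsGoodSum p f v (l + 1)
          ((p : WittVector p (AddMonoidAlgebra k Λ)) * y + ∑ i, z i) := by
        refine IsGoodSum.add hf ?_ (IsGoodSum.sum hf _ fun i _ =>
          IsGoodSum.single i fun t ht => hz i t (by omega))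
        rw [← verschiebung_frobenius']
        exact (ih hl' y hy).verschiebung
      refine h1.congr (truncate_eq_iff.2 fun t ht => truncate_eq_iff.1 hyz t (by omega))
    obtain ⟨b, hb⟩ := Ideal.mem_span_singleton.1 (hx 0)
    have hbsum : ∑ a ∈ b.coeff.support, AddMonoidAlgebra.single a (b.coeff a) = b :=
      AddMonoidAlgebra.coeff_injective (by
        rw [AddMonoidAlgebra.coeff_sum]
        exact Finsupp.sum_single b.coeff)
    have hmem : ∀ a, teichmuller p (f * AddMonoidAlgebra.single a (b.coeff a)) ∈ wittDvd p f := by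
      intro a
      have := iterate_verschiebung_mem_wittDvd (p := p) f one_ne_zero
        (teichmuller p (AddMonoidAlgebra.single a (b.coeff a))) 0
      rwa [pow_one, ← map_mul] at this
    obtain ⟨x', hx'⟩ := exists_eq_add_verschiebung (x := x)
      (y := ∑ a ∈ b.coeff.support, teichmuller p (f * AddMonoidAlgebra.single a (b.coeff a))) (by
        change _ = WittVector.constantCoeff _
        rw [map_sum]
        change _ = ∑ a ∈ b.coeff.support,
          (teichmuller p (f * AddMonoidAlgebra.single a (b.coeff a))).coeff 0
        simp only [teichmuller_coeff_zero]
        rw [← Finset.mul_sum, hbsum, hb])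
    have hx'mem : x' ∈ wittDvd p f := by
      have h1 : WittVector.verschiebung x' ∈ wittDvd p f := by
        have := sub_mem hx (sum_mem (t := b.coeff.support) fun a _ => hmem a)
        rwa [hx', add_sub_cancel_left] at this
      intro t
      have := h1 (t + 1)
      rwa [verschiebung_coeff_succ] at this
    rw [hx', map_add, map_sum, frobenius_verschiebung, mul_comm x', ← verschiebung_frobenius']
    refine IsGoodSum.add hf (IsGoodSum.sum hf _ fun a _ => ?_) (ih hl' x' hx'mem).verschiebung
    -- The constant term gives a constant multiple of F[f], just settled. Any other term has a
    -- positive exponent in some direction and needs no information on F[f].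
    by_cases ha : a = 0
    · have e : frobenius (teichmuller p (f * AddMonoidAlgebra.single a (b.coeff a))) =
          WittVector.map (algebraMap k (AddMonoidAlgebra k Λ)) (teichmuller p (b.coeff a ^ p)) *
            frobenius (teichmuller p f) := by
        rw [map_teichmuller, frobenius_teichmuller, frobenius_teichmuller, map_mul, mul_pow,
          mul_comm, map_pow, map_pow, ha]
        rfl
      rw [e]
      exact IsGoodSum.map_mul hf hFf _
    · obtain ⟨i, hi⟩ := hv a ha
      refine IsGoodSum.single i fun t _ => ?_
      rw [frobenius_teichmuller]
      have hm : teichmuller p (f * AddMonoidAlgebra.single a (b.coeff a)) ∈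
          wittSubgroup _ (admissible_mulFil (p := p) (hf i)) :=
        teichmuller_mem_wittSubgroup _ (mem_mulFil.2
          ⟨AddMonoidAlgebra.single a (b.coeff a), single_mem_expFil hi _, by rw [pow_one]⟩)
      rw [← frobenius_teichmuller, coeff_frobenius_charP]
      exact admissible_mulFil (p := p) (hf i) t (Submodule.pow_mem_pow _ (hm t) p)

end GoodSum

/-! ### Čech decompositions of Witt vectors -/

section Cech

open WittVector

variable {p : ℕ} [Fact p.Prime] {k : Type*} [Field k] [CharP k p] [PerfectRing k p] {B : Type*} [CommRing B] [CharP B p]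
  [Algebra k B] {ι : Type*} [Fintype ι] {R : ι → Submodule k B}
  {P : ι → B →+ B}

/-- Decompose the zeroth component with the projections P_i, lift the parts by Teichmüller, and
repeat for the remainder inside V. -/
theorem exists_truncate_eq_sum (hR : ∀ i, Admissible p fun _ : ℕ => R i) (hP : ∀ b, ∑ i, P i b = b)
    (hPR : ∀ i b, P i b ∈ R i) (n : ℕ) (a : WittVector p B) :
    ∃ α : ι → WittVector p B, (∀ i t, (α i).coeff t ∈ R i) ∧
      truncate n a = truncate n (∑ i, α i) := by
  induction n generalizing a with
  | zero => exact ⟨0, fun i t => by rw [Pi.zero_apply, zero_coeff]; exact zero_mem _,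
      truncate_eq_iff.2 fun t ht => absurd ht (Nat.not_lt_zero t)⟩
  | succ n ih =>
    obtain ⟨a', ha'⟩ := exists_eq_add_verschiebung (x := a)
      (y := ∑ i, teichmuller p (P i (a.coeff 0))) (by
        change _ = WittVector.constantCoeff _
        rw [map_sum]
        change _ = ∑ i, (teichmuller p (P i (a.coeff 0))).coeff 0
        simp only [teichmuller_coeff_zero]
        rw [hP])
    obtain ⟨α, hα, hαa⟩ := ih a'
    refine ⟨fun i => teichmuller p (P i (a.coeff 0)) + verschiebung (α i), fun i => ?_, ?_⟩
    · refine add_mem (S := AddSubgroup _) (s := wittSubgroup _ (hR i))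
        (teichmuller_mem_wittSubgroup (hR i) (hPR i _)) ?_
      rintro (_ | t)
      · rw [verschiebung_coeff_zero]
        exact zero_mem _
      · rw [verschiebung_coeff_succ]
        exact hα i t
    · conv_lhs => rw [ha']
      rw [map_add, truncate_verschiebung_congr hαa, ← map_add, Finset.sum_add_distrib,
        map_sum verschiebung]

theorem exists_antisymm (hR : ∀ i, Admissible p fun _ : ℕ => R i) (hP : ∀ b, ∑ i, P i b = b)
    (hPR : ∀ i b, P i b ∈ R i) 
    (hPR' : ∀ i j, ∀ b ∈ R j, P i b ∈ R j) (n : ℕ) (c : ι → WittVector p B)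
    (hc : ∀ i t, (c i).coeff t ∈ R i) (h0 : truncate n (∑ i, c i) = truncate n 0) :
    ∃ γ : ι → ι → WittVector p B, (∀ i j t, (γ i j).coeff t ∈ R i) ∧
      (∀ i j, γ j i = -γ i j) ∧ (∀ i, γ i i = 0) ∧
      ∀ i, truncate n (c i) = truncate n (∑ j, γ i j) := by
  induction n generalizing c with
  | zero => exact ⟨0, fun i j t => by
      rw [Pi.zero_apply, Pi.zero_apply, zero_coeff]; exact zero_mem _, fun i j => by simp,
      fun i => rfl, fun i => truncate_eq_iff.2 fun t ht => absurd ht (Nat.not_lt_zero t)⟩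
  | succ n ih =>
    have hcc : ∀ x : WittVector p B, WittVector.constantCoeff x = x.coeff 0 := fun x => rfl
    have hsum0 : ∑ i, (c i).coeff 0 = 0 := by
      have := truncate_eq_iff.1 h0 0 (by omega)
      rw [zero_coeff, ← hcc, map_sum] at this
      exact this
    -- The usual contraction: antisymmetric by form, and the zeroth components sum over j to c_i -
    -- P_i(∑ c_j) = c_i. The double sum vanishes exactly, so the remainders again sum to zero.
    let γ₀ : ι → ι → WittVector p B := fun i j =>
      teichmuller p (P j ((c i).coeff 0)) - teichmuller p (P i ((c j).coeff 0))
    have hγ₀ : ∀ i j t, (γ₀ i j).coeff t ∈ R i := fun i j =>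
      sub_mem (H := wittSubgroup _ (hR i))
        (teichmuller_mem_wittSubgroup (hR i) (hPR' j i _ (hc i 0)))
        (teichmuller_mem_wittSubgroup (hR i) (hPR i _))
    have hex : ∀ i, ∃ y, c i = ∑ j, γ₀ i j + verschiebung y := by
      intro i
      refine exists_eq_add_verschiebung ?_
      rw [← hcc (∑ j, γ₀ i j), map_sum]
      have h1 : ∀ j, WittVector.constantCoeff (γ₀ i j) =
          P j ((c i).coeff 0) - P i ((c j).coeff 0) := by
        intro j
        rw [map_sub, hcc, hcc, teichmuller_coeff_zero, teichmuller_coeff_zero]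
      simp only [h1]
      rw [Finset.sum_sub_distrib, hP, ← map_sum, hsum0, map_zero, sub_zero]
    choose y hy using hex
    have hymem : ∀ i t, (y i).coeff t ∈ R i := by
      intro i t
      have h1 : verschiebung (y i) ∈ wittSubgroup _ (hR i) := by
        have h2 : c i - ∑ j, γ₀ i j ∈ wittSubgroup _ (hR i) :=
          sub_mem (hc i) (sum_mem fun j _ => hγ₀ i j)
        rwa [hy i, add_sub_cancel_left] at h2
      have := h1 (t + 1)
      rwa [verschiebung_coeff_succ] at this
    have hanti : ∑ i, ∑ j, γ₀ i j = 0 := by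
      simp only [γ₀, Finset.sum_sub_distrib]
      rw [sub_eq_zero, Finset.sum_comm]
    obtain ⟨γ, hγ, hγa, hγ0, hγs⟩ := ih y hymem (by
      have h1 : ∑ i, c i = verschiebung (∑ i, y i) := by
        rw [Finset.sum_congr rfl fun i _ => hy i, Finset.sum_add_distrib, hanti, zero_add, map_sum]
      rw [h1, truncate_eq_iff] at h0
      rw [truncate_eq_iff]
      intro t ht
      have := h0 (t + 1) (by omega)
      rwa [verschiebung_coeff_succ, zero_coeff, ← zero_coeff p B t] at this)
    refine ⟨fun i j => γ₀ i j + verschiebung (γ i j), fun i j => ?_, fun i j => ?_, fun i => ?_,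
      fun i => ?_⟩
    · refine add_mem (S := AddSubgroup _) (s := wittSubgroup _ (hR i)) (hγ₀ i j) ?_
      rintro (_ | t)
      · rw [verschiebung_coeff_zero]
        exact zero_mem _
      · rw [verschiebung_coeff_succ]
        exact hγ i j t
    · simp only [γ₀, hγa i j, map_neg]
      ring
    · simp only [γ₀, hγ0 i, map_zero, sub_self, add_zero]
    · conv_lhs => rw [hy i]
      rw [map_add, truncate_verschiebung_congr (hγs i), ← map_add, Finset.sum_add_distrib,
        map_sum verschiebung]

end Cech
end QFS
end

open MvPolynomial AlgebraicGeometry CategoryTheory Opposite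
noncomputable section
namespace QFS

/-! ### The Čech data attached to f/ξ -/

section CechData

open WittVector

variable {p : ℕ} [Fact p.Prime] {k : Type*} [Field k] [CharP k p] [PerfectRing k p] {N m : ℕ}
  {q : Fin (N + 1) → ℕ} {M : Fin m → Fin (N + 1) →₀ ℕ}
  (hMq : ∀ i, Finsupp.weight q (M i) = ∑ i, q i) {f : MvPolynomial (Fin (N + 1)) k}

/-- Expand up to the term V^n, invisible in length n, with errors of length n+1. Only the first kind
of slot is then seen, and `isGoodSum_frobenius` removes the multiple of p. -/
theorem isGoodSum_frobenius_teichmuller_shiftPoly (hM : Function.Injective M) (hq : ∀ i, 0 < q i)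
    (hMq' : ∀ a, a ∈ Set.range M ↔ Finsupp.weight q a = ∑ i, q i)
    (hf : ∀ a, f.coeff a ≠ 0 → a ∈ Set.range M) {n : ℕ}
    (h0 : ∀ l < n, rowR p M f (l + 1) ⬝ᵥ coeffVec M f = 0) :
    IsGoodSum p (shiftPoly hMq f) (coord q) n (frobenius (teichmuller p (shiftPoly hMq f))) := by
  have h2p := (Fact.out : p.Prime).two_le
  obtain ⟨D, Dt, hD, hDt, hDtm, hDt0⟩ := exists_termwiseLift_delta_single (p := p)
    (shiftExp_injective hM hMq) (f := shiftPoly hMq f) fun a ha => coeff_shiftPoly_ne_zero hMq ha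
  have hrow := coeff_coreSeq hMq hM hMq' hf hDt0
  set f' := shiftPoly hMq f with hf'
  have hfil : ∀ i, f' ∈ expFil k (coord q i) (-1) := shiftPoly_mem_expFil hMq
  have hcore := frobenius_teichmuller_sub_mem hfil (exists_one_le_coord hq) (n + 1) hD hDt hDtm
    (j := n) (by omega) (by
      intro l hl
      have e : f' ^ (p - 1) * (coreSeq (termwiseLift p f') Dt l).coeff 0 =
          f' * (f' ^ (p - 2) * (coreSeq (termwiseLift p f') Dt l).coeff 0) := by
        rw [← mul_assoc, ← pow_succ']
        congr 2
        omega
      rw [e, coeff_zero_shiftPoly_mul, ← h0 l hl, dotProduct]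
      refine Finset.sum_congr rfl fun i _ => ?_
      rw [hrow, mul_comm]
      rfl)
  obtain ⟨y, z, hy, hz, hyz⟩ := exists_decomposition_of_mem_errGroup hfil hcore
  refine isGoodSum_frobenius hfil (exists_one_le_coord hq) (n := n) ⟨y, z, ?_, ?_, ?_⟩ le_rfl _ ?_
  · exact fun t => Ideal.mem_span_singleton.2 (hy t)
  · intro i t ht
    have := hz i t
    rwa [errSeq, if_pos (by omega)] at this
  · rw [← hyz, map_sub, map_mul]
    have : truncate n (verschiebung^[n] (teichmuller p f' ^ p *
        coreSeq (termwiseLift p f') Dt n)) = truncate n 0 := by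
      rw [truncate_eq_iff]
      intro t ht
      rw [coeff_iterate_verschiebung, if_neg (by omega), zero_coeff]
    rw [this, map_zero, mul_zero, sub_zero]
  · have := iterate_verschiebung_mem_wittDvd (p := p) f' one_ne_zero 1 0
    rwa [pow_one, mul_one] at this

/-- The part of a Laurent polynomial with exponents of a given index. -/
def indexPart {Λ ι : Type*} [DecidableEq ι] (k : Type*) [Field k] (idx : Λ → ι) (i : ι) :
    AddMonoidAlgebra k Λ →+ AddMonoidAlgebra k Λ :=
  ((AddMonoidAlgebra.coeffAddEquiv.symm : (Λ →₀ k) ≃+ AddMonoidAlgebra k Λ).toAddMonoidHom.comp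
    (Finsupp.filterAddHom fun a => idx a = i)).comp
      (AddMonoidAlgebra.coeffAddEquiv : AddMonoidAlgebra k Λ ≃+ (Λ →₀ k)).toAddMonoidHom

theorem coeff_indexPart {Λ ι : Type*} [DecidableEq ι] (idx : Λ → ι) (i : ι)
    (b : AddMonoidAlgebra k Λ) (a : Λ) :
    (indexPart k idx i b).coeff a = if idx a = i then b.coeff a else 0 :=
  Finsupp.filter_apply _ _ _

theorem sum_indexPart {Λ ι : Type*} [DecidableEq ι] [Fintype ι] (idx : Λ → ι) (b : AddMonoidAlgebra k Λ) :
    ∑ i, indexPart k idx i b = b := by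
  apply AddMonoidAlgebra.coeff_injective
  ext a
  rw [AddMonoidAlgebra.coeff_sum, Finsupp.finsetSum_apply]
  simp only [coeff_indexPart]
  simp

theorem admissible_expFil_zero {Λ : Type*} [AddCommMonoid Λ] (v : Λ →+ ℤ) :
    Admissible p fun _ : ℕ => expFil k v 0 := by
  have := admissible_expFil (p := p) (k := k) v 0
  simpa using this

/-- α splits [f'] into parts without poles along x_i, while β splits F[f'] into parts that also
vanish on X. The differences F α_i - β_i sum to zero in length n, so `exists_antisymm` makes them a
coboundary γ. -/
theorem exists_cech_data (hM : Function.Injective M) (hq : ∀ i, 0 < q i)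
    (hMq' : ∀ a, a ∈ Set.range M ↔ Finsupp.weight q a = ∑ i, q i)
    (hf : ∀ a, f.coeff a ≠ 0 → a ∈ Set.range M) {n : ℕ}
    (h0 : ∀ l < n, rowR p M f (l + 1) ⬝ᵥ coeffVec M f = 0) :
    ∃ (α β : Fin (N + 1) → WittVector p (AddMonoidAlgebra k (degZero q)))
      (γ : Fin (N + 1) → Fin (N + 1) → WittVector p (AddMonoidAlgebra k (degZero q))),
      (∀ i t, (α i).coeff t ∈ expFil k (coord q i) 0) ∧
      (∀ i t, (β i).coeff t ∈ mulFil (shiftPoly hMq f) (coord q i) 1 1) ∧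
      (∀ i j t, (γ i j).coeff t ∈ expFil k (coord q i) 0) ∧
      (∀ i j, γ j i = -γ i j) ∧ (∀ i, γ i i = 0) ∧
      truncate n (teichmuller p (shiftPoly hMq f)) = truncate n (∑ i, α i) ∧
      ∀ i, truncate n (frobenius (α i)) = truncate n (β i + ∑ j, γ i j) := by
  classical
  choose idx hidx using exists_zero_le_coord hq
  have hadm : ∀ i, Admissible p fun _ : ℕ => expFil k (coord q i) 0 :=
    fun i => admissible_expFil_zero (coord q i)
  have hPR : ∀ i b, indexPart k idx i b ∈ expFil k (coord q i) 0 := by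
    intro i b a ha
    rw [coeff_indexPart] at ha
    split_ifs at ha with h
    · rw [← h]
      exact hidx a
    · exact absurd rfl ha
  have hPR' : ∀ i j, ∀ b ∈ expFil k (coord q j) 0, indexPart k idx i b ∈ expFil k (coord q j) 0 := by
    intro i j b hb a ha
    rw [coeff_indexPart] at ha
    split_ifs at ha with h
    · exact hb a ha
    · exact absurd rfl ha
  obtain ⟨β, hβ, hFβ⟩ := isGoodSum_frobenius_teichmuller_shiftPoly hMq hM hq hMq' hf h0
  obtain ⟨α, hα, hαs⟩ := exists_truncate_eq_sum hadm (sum_indexPart idx) hPR n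
    (teichmuller p (shiftPoly hMq f))
  have hβ' : ∀ i t, (β i).coeff t ∈ expFil k (coord q i) 0 := by
    intro i t
    obtain ⟨e, he, h⟩ := mem_mulFil.1 (hβ i t)
    rw [← h, pow_one]
    exact mul_mem_expFil (shiftPoly_mem_expFil hMq i) he
  have hFα : ∀ i t, (frobenius (α i)).coeff t ∈ expFil k (coord q i) 0 := by
    intro i t
    rw [coeff_frobenius_charP]
    exact hadm i t (Submodule.pow_mem_pow _ (hα i t) p)
  obtain ⟨γ, hγ, hγa, hγ0, hγs⟩ := exists_antisymm hadm (sum_indexPart idx) hPR hPR' n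
    (fun i => frobenius (α i) - β i)
    (fun i => sub_mem (H := wittSubgroup _ (hadm i)) (hFα i) (hβ' i)) (by
      rw [Finset.sum_sub_distrib, ← map_sum WittVector.frobenius, map_sub, ← wittFrob_truncate, ← hαs,
        wittFrob_truncate, hFβ, sub_self, map_zero])
  refine ⟨α, β, γ, hα, hβ, hγ, hγa, hγ0, hαs, fun i => ?_⟩
  rw [map_add, ← hγs i, map_sub, add_sub_cancel]

end CechData
end QFS
end

open MvPolynomial AlgebraicGeometry CategoryTheory Opposite
noncomputable section
namespace QFS

/-! ### Pairs of a section on a basic open set and a fraction representing it -/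

section FracRing

universe u

variable {k : Type*} [Field k] {N : ℕ} {S : Type u} [CommRing S] [Algebra k S]
  {𝒮 : ℕ → Submodule k S} [GradedAlgebra 𝒮] (q : Fin (N + 1) → ℕ)
  (π : MvPolynomial (Fin (N + 1)) k →+* S)

/-- The pairs of a section `s` on `U` and a fraction `κ` such that both are represented by
`h / g ^ r` for a homogeneous `h` of degree `r * d`. -/
def fracRing (U : (Proj 𝒮).Opens) (g : MvPolynomial (Fin (N + 1)) k) (d : ℕ)
    (hg : g.IsWeightedHomogeneous q d) :
    Subring (Γ(Proj 𝒮, U) × FractionRing (MvPolynomial (Fin (N + 1)) k)) where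
  carrier := {x | ∃ (r : ℕ) (h : MvPolynomial (Fin (N + 1)) k), h.IsWeightedHomogeneous q (r * d) ∧
    x.2 * algebraMap _ _ g ^ r = algebraMap _ _ h ∧
    ∀ y hy, evalAt 𝒮 U y hy x.1 * algebraMap S (LocAt 𝒮 y) (π g) ^ r =
      algebraMap S (LocAt 𝒮 y) (π h)}
  zero_mem' := ⟨0, 0, isWeightedHomogeneous_zero k q _, by simp, fun y hy => by simp⟩
  one_mem' := ⟨0, 1, by rw [zero_mul]; exact isWeightedHomogeneous_one k q, by simp,
    fun y hy => by simp⟩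
  neg_mem' := by
    rintro x ⟨r, h, hh, h1, h2⟩
    refine ⟨r, -h, (weightedHomogeneousSubmodule k q _).neg_mem hh, ?_, fun y hy => ?_⟩
    · rw [Prod.snd_neg, neg_mul, h1, map_neg]
    · rw [Prod.fst_neg, map_neg, neg_mul, h2, map_neg, map_neg]
  add_mem' := by
    rintro x x' ⟨r, h, hh, h1, h2⟩ ⟨r', h', hh', h1', h2'⟩
    refine ⟨r + r', h * g ^ r' + g ^ r * h', ?_, ?_, fun y hy => ?_⟩
    · rw [add_mul]
      exact (hh.mul (hg.pow r')).add ((hg.pow r).mul hh')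
    · rw [Prod.snd_add, map_add, map_mul, map_mul, ← h1, ← h1', map_pow, map_pow]
      ring
    · rw [Prod.fst_add, map_add, map_add, map_add, map_mul, map_mul, map_mul, map_mul, ← h2 y hy,
        ← h2' y hy, map_pow, map_pow, map_pow, map_pow]
      ring
  mul_mem' := by
    rintro x x' ⟨r, h, hh, h1, h2⟩ ⟨r', h', hh', h1', h2'⟩
    refine ⟨r + r', h * h', ?_, ?_, fun y hy => ?_⟩
    · rw [add_mul]
      exact hh.mul hh'
    · rw [Prod.snd_mul, map_mul, ← h1, ← h1']
      ring
    · rw [Prod.fst_mul, map_mul, map_mul, map_mul, ← h2 y hy, ← h2' y hy]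
      ring

variable {q π} {U : (Proj 𝒮).Opens} {g : MvPolynomial (Fin (N + 1)) k} {d : ℕ}
  {hg : g.IsWeightedHomogeneous q d}

theorem isUnit_algebraMap_locAt {y : Proj 𝒮} {s : S} (h : s ∉ y.asHomogeneousIdeal) :
    IsUnit (algebraMap S (LocAt 𝒮 y) s) :=
  IsLocalization.map_units (LocAt 𝒮 y) (⟨s, h⟩ : y.asHomogeneousIdeal.toIdeal.primeCompl)

theorem exists_mem_fracRing (hπ : ∀ e a, a.IsWeightedHomogeneous q e → π a ∈ 𝒮 e)
    (hU : ∀ y ∈ U, π g ∉ y.asHomogeneousIdeal) {r : ℕ} {h : MvPolynomial (Fin (N + 1)) k}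
    (hh : h.IsWeightedHomogeneous q (r * d)) {κ : FractionRing (MvPolynomial (Fin (N + 1)) k)}
    (hκ : κ * algebraMap _ _ g ^ r = algebraMap _ _ h) :
    ∃ s : Γ(Proj 𝒮, U), (s, κ) ∈ fracRing q π U g d hg := by
  choose! u hu using fun (y : Proj 𝒮) (hy : y ∈ U) =>
    ((isUnit_algebraMap_locAt (hU y hy)).pow r).exists_right_inv
  have hval : ∀ y ∈ U, algebraMap S (LocAt 𝒮 y) (π (g ^ r)) *
      (algebraMap S (LocAt 𝒮 y) (π h) * u y) = algebraMap S (LocAt 𝒮 y) (π h) := by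
    intro y hy
    rw [map_pow, map_pow, mul_left_comm, hu y hy, mul_one]
  obtain ⟨s, hs⟩ := exists_section (𝒮 := 𝒮) (U := U)
    (fun y _ => algebraMap S (LocAt 𝒮 y) (π h) * u y) fun x hx =>
      ⟨U, hx, le_rfl, r * d, π h, π (g ^ r), hπ _ _ hh, hπ _ _ (hg.pow r), fun y hy => by
        rw [map_pow]
        exact fun h => hU y hy ((isPrime_asHomogeneousIdeal 𝒮 y).mem_of_pow_mem r h), hval⟩
  refine ⟨s, r, h, hh, hκ, fun y hy => ?_⟩
  have := hval y hy
  rw [map_pow, map_pow] at this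
  rw [hs, mul_comm]
  exact this

theorem fst_eq_zero_of_mem_fracRing (hU : ∀ y ∈ U, π g ∉ y.asHomogeneousIdeal)
    {s : Γ(Proj 𝒮, U)} (hs : (s, 0) ∈ fracRing q π U g d hg) : s = 0 := by
  obtain ⟨r, h, -, h1, h2⟩ := hs
  rw [zero_mul, eq_comm, map_eq_zero_iff _ (IsFractionRing.injective _ _)] at h1
  refine section_ext fun y hy => ?_
  have h3 := h2 y hy
  rw [h1, map_zero, map_zero, ((isUnit_algebraMap_locAt (hU y hy)).pow r).mul_left_eq_zero] at h3
  rw [map_zero]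
  exact h3

/-- The fraction determines the section, but not conversely: fractions live on the ambient space,
sections on Proj of the quotient. -/
theorem fracRing_snd_injective (hU : ∀ y ∈ U, π g ∉ y.asHomogeneousIdeal) :
    Function.Injective fun x : fracRing q π U g d hg => x.1.2 := by
  intro x x' h
  have h1 := sub_mem x.2 x'.2
  have h2 : x.1 - x'.1 = (x.1.1 - x'.1.1, 0) := Prod.ext rfl (sub_eq_zero.2 h)
  rw [h2] at h1
  exact Subtype.ext (Prod.ext (sub_eq_zero.1 (fst_eq_zero_of_mem_fracRing hU h1)) h)

theorem res_mem_fracRing {V : (Proj 𝒮).Opens} (hVU : V ≤ U)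
    {g₁ g' : MvPolynomial (Fin (N + 1)) k} {d₁ d' : ℕ} {hg' : g'.IsWeightedHomogeneous q d'}
    (hg₁ : g₁.IsWeightedHomogeneous q d₁) (e : g' = g * g₁) (he : d' = d + d₁)
    {x : Γ(Proj 𝒮, U) × FractionRing (MvPolynomial (Fin (N + 1)) k)}
    (hx : x ∈ fracRing q π U g d hg) :
    (((Proj 𝒮).presheaf.map (homOfLE hVU).op).hom x.1, x.2) ∈ fracRing q π V g' d' hg' := by
  obtain ⟨r, h, hh, h1, h2⟩ := hx
  refine ⟨r, h * g₁ ^ r, ?_, ?_, fun y hy => ?_⟩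
  · rw [he, mul_add]
    exact hh.mul (hg₁.pow r)
  · rw [map_mul, ← h1, map_pow, e, map_mul]
    ring
  · rw [evalAt_res, map_mul, map_mul, ← h2 y (hVU hy), e, map_mul, map_mul, map_pow, map_pow]
    ring

theorem evalAt_awayToSection {s : S} {e : ℕ} (hs : s ∈ 𝒮 e) (r : ℕ) (a : S) (ha : a ∈ 𝒮 (r • e))
    (y : Proj 𝒮) (hy : y ∈ Proj.basicOpen 𝒮 s) :
    evalAt 𝒮 (Proj.basicOpen 𝒮 s) y hy ((Proj.awayToSection 𝒮 s).hom
      (HomogeneousLocalization.Away.mk 𝒮 hs r a ha)) * algebraMap S (LocAt 𝒮 y) s ^ r =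
        algebraMap S (LocAt 𝒮 y) a := by
  have h1 : evalAt 𝒮 (Proj.basicOpen 𝒮 s) y hy ((Proj.awayToSection 𝒮 s).hom
      (HomogeneousLocalization.Away.mk 𝒮 hs r a ha)) = Localization.mk a
        (⟨s ^ r, y.asHomogeneousIdeal.toIdeal.primeCompl.pow_mem hy r⟩ :
          y.asHomogeneousIdeal.toIdeal.primeCompl) := rfl
  rw [h1, Localization.mk_eq_mk', ← map_pow]
  exact IsLocalization.mk'_spec (LocAt 𝒮 y) a
    (⟨s ^ r, y.asHomogeneousIdeal.toIdeal.primeCompl.pow_mem hy r⟩ :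
          y.asHomogeneousIdeal.toIdeal.primeCompl)

theorem awayToSection_bijective {s : S} {e : ℕ} (hs : s ∈ 𝒮 e) (he : 0 < e) :
    Function.Bijective (Proj.awayToSection 𝒮 s).hom := by
  have h := ConcreteCategory.bijective_of_isIso (Proj.basicOpenIsoAway 𝒮 s hs he).hom
  rwa [Proj.basicOpenIsoAway_hom] at h

theorem exists_mem_fracRing_of_section (hπ : ∀ e a, a.IsWeightedHomogeneous q e → π a ∈ 𝒮 e)
    (hπ' : ∀ e, ∀ s ∈ 𝒮 e, ∃ a : MvPolynomial (Fin (N + 1)) k,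
      a.IsWeightedHomogeneous q e ∧ π a = s) (hd : 0 < d) (hg0 : g ≠ 0)
    (s : Γ(Proj 𝒮, Proj.basicOpen 𝒮 (π g))) :
    ∃ κ, (s, κ) ∈ fracRing q π (Proj.basicOpen 𝒮 (π g)) g d hg := by
  obtain ⟨z, rfl⟩ := (awayToSection_bijective (hπ _ _ hg) hd).2 s
  obtain ⟨r, a, ha, rfl⟩ := HomogeneousLocalization.Away.mk_surjective 𝒮 (hπ _ _ hg) z
  obtain ⟨h, hh, rfl⟩ := hπ' _ a ha
  have hgK : algebraMap (MvPolynomial (Fin (N + 1)) k)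
      (FractionRing (MvPolynomial (Fin (N + 1)) k)) g ≠ 0 :=
    (map_ne_zero_iff _ (IsFractionRing.injective _ _)).2 hg0
  exact ⟨algebraMap _ _ h / algebraMap _ _ g ^ r, r, h, hh, div_mul_cancel₀ _ (pow_ne_zero r hgK),
    fun y hy => evalAt_awayToSection (hπ _ _ hg) r (π h) ha y hy⟩

/-- If h/g^r vanishes on the basic open set, a power of g annihilates the image of h, so f divides h
times that power. -/
theorem eventually_exists_of_mem_fracRing {f : MvPolynomial (Fin (N + 1)) k}
    (hπ : ∀ e a, a.IsWeightedHomogeneous q e → π a ∈ 𝒮 e) (hker : ∀ a, π a = 0 ↔ f ∣ a)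
    (hd : 0 < d) {κ : FractionRing (MvPolynomial (Fin (N + 1)) k)}
    (hκ : (0, κ) ∈ fracRing q π (Proj.basicOpen 𝒮 (π g)) g d hg) :
    ∀ᶠ s : ℕ in Filter.atTop, ∃ h, κ * algebraMap _ _ g ^ s = algebraMap _ _ (f * h) := by
  obtain ⟨r, h, hh, h1, h2⟩ := hκ
  have hz : (Proj.awayToSection 𝒮 (π g)).hom
      (HomogeneousLocalization.Away.mk 𝒮 (hπ _ _ hg) r (π h) (hπ _ _ hh)) = 0 := by
    refine section_ext fun y hy => ?_
    have h3 := evalAt_awayToSection (hπ _ _ hg) r (π h) (hπ _ _ hh) y hy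
    rw [← h2 y hy] at h3
    exact ((isUnit_algebraMap_locAt hy).pow r).mul_right_cancel h3
  rw [map_eq_zero_iff _ (awayToSection_bijective (hπ _ _ hg) hd).1] at hz
  have h3 := congrArg HomogeneousLocalization.val hz
  rw [HomogeneousLocalization.Away.val_mk, HomogeneousLocalization.val_zero,
    Localization.mk_eq_mk', IsLocalization.mk'_eq_zero_iff] at h3
  obtain ⟨⟨_, l, rfl⟩, hl⟩ := h3
  change π g ^ l * π h = 0 at hl
  rw [← map_pow, ← map_mul, hker] at hl
  obtain ⟨h', hh'⟩ := hl
  filter_upwards [Filter.eventually_ge_atTop (r + l)] with s hs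
  obtain ⟨s, rfl⟩ := Nat.exists_eq_add_of_le hs
  refine ⟨h' * g ^ s, ?_⟩
  rw [← mul_assoc, ← hh', pow_add, pow_add, ← mul_assoc, ← mul_assoc, h1, map_mul, map_mul, map_pow,
    map_pow]
  ring

end FracRing
end QFS
end

open MvPolynomial AlgebraicGeometry CategoryTheory Opposite
noncomputable section
namespace QFS

/-! ### Charts on which a set of variables is inverted -/

section Chart

universe u

variable {k : Type*} [Field k] {N : ℕ} {S : Type u} [CommRing S] [Algebra k S]
  {𝒮 : ℕ → Submodule k S} [GradedAlgebra 𝒮] (q : Fin (N + 1) → ℕ)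

/-- The product of the variables in `J`. -/
def coordProd (k : Type*) [Field k] (J : Finset (Fin (N + 1))) : MvPolynomial (Fin (N + 1)) k :=
  ∏ l ∈ J, X l

theorem isWeightedHomogeneous_coordProd (J : Finset (Fin (N + 1))) :
    (coordProd k J).IsWeightedHomogeneous q (∑ l ∈ J, q l) :=
  IsWeightedHomogeneous.prod _ _ _ fun l _ => isWeightedHomogeneous_X k q l

theorem coordProd_ne_zero (J : Finset (Fin (N + 1))) : coordProd k J ≠ 0 :=
  Finset.prod_ne_zero_iff.2 fun l _ => X_ne_zero l

variable (𝒮) in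
/-- The open set where the variables in `J` do not vanish. -/
def chart (π : MvPolynomial (Fin (N + 1)) k →+* S) (J : Finset (Fin (N + 1))) : (Proj 𝒮).Opens :=
  Proj.basicOpen 𝒮 (π (coordProd k J))

variable (𝒮) in
/-- The pairs of a section on a chart and a fraction representing it. -/
def chartRing (π : MvPolynomial (Fin (N + 1)) k →+* S) (J : Finset (Fin (N + 1))) :
    Subring (Γ(Proj 𝒮, chart 𝒮 π J) × FractionRing (MvPolynomial (Fin (N + 1)) k)) :=
  fracRing q π (chart 𝒮 π J) (coordProd k J) (∑ l ∈ J, q l) (isWeightedHomogeneous_coordProd q J)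

variable {q} {π : MvPolynomial (Fin (N + 1)) k →+* S} {J : Finset (Fin (N + 1))}

variable (𝒮 q π J) in
/-- The section of a pair. -/
def chartFst : chartRing 𝒮 q π J →+* Γ(Proj 𝒮, chart 𝒮 π J) :=
  (RingHom.fst _ _).comp (chartRing 𝒮 q π J).subtype

variable (𝒮 q π J) in
/-- The fraction of a pair. -/
def chartSnd : chartRing 𝒮 q π J →+* FractionRing (MvPolynomial (Fin (N + 1)) k) :=
  (RingHom.snd _ _).comp (chartRing 𝒮 q π J).subtype

theorem mem_chartRing (x : chartRing 𝒮 q π J) :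
    (chartFst 𝒮 q π J x, chartSnd 𝒮 q π J x) ∈ chartRing 𝒮 q π J := x.2

theorem chartSnd_injective : Function.Injective (chartSnd 𝒮 q π J) :=
  fracRing_snd_injective fun _ hy => hy

theorem chart_le {J' : Finset (Fin (N + 1))} (h : J ⊆ J') : chart 𝒮 π J' ≤ chart 𝒮 π J :=
  Proj.basicOpen_mono 𝒮 _ _ (map_dvd π (Finset.prod_dvd_prod_of_subset _ _ _ h))

theorem res_mem_chartRing {J' : Finset (Fin (N + 1))} (h : J ⊆ J')
    {s : Γ(Proj 𝒮, chart 𝒮 π J)} {κ : FractionRing (MvPolynomial (Fin (N + 1)) k)}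
    (hs : (s, κ) ∈ chartRing 𝒮 q π J) :
    (((Proj 𝒮).presheaf.map (homOfLE (chart_le h)).op).hom s, κ) ∈ chartRing 𝒮 q π J' :=
  res_mem_fracRing (chart_le h) (isWeightedHomogeneous_coordProd q (J' \ J))
    (by rw [coordProd, coordProd, coordProd, mul_comm, Finset.prod_sdiff h])
    (by rw [add_comm (∑ l ∈ J, q l), Finset.sum_sdiff h]) hs

theorem algebraMap_X_ne_zero (i : Fin (N + 1)) : algebraMap (MvPolynomial (Fin (N + 1)) k)
    (FractionRing (MvPolynomial (Fin (N + 1)) k)) (X i) ≠ 0 :=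
  (map_ne_zero_iff _ (IsFractionRing.injective _ _)).2 (X_ne_zero i)

variable (k q) in
/-- The embedding of Laurent polynomials of degree zero into the field of fractions. -/
def laurentToFrac :
    AddMonoidAlgebra k (degZero q) →ₐ[k] FractionRing (MvPolynomial (Fin (N + 1)) k) :=
  laurentEval q (fun j => algebraMap _ _ (X j)) algebraMap_X_ne_zero

theorem eventually_exists_numerator {b : AddMonoidAlgebra k (degZero q)}
    (hb : ∀ i ∉ J, b ∈ expFil k (coord q i) 0) :
    ∀ᶠ s : ℕ in Filter.atTop, ∃ h : MvPolynomial (Fin (N + 1)) k,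
      h.IsWeightedHomogeneous q (s * ∑ l ∈ J, q l) ∧
      laurentToFrac k q b * algebraMap _ _ (coordProd k J) ^ s = algebraMap _ _ h := by
  classical
  filter_upwards [eventually_mem_expFil b] with s hs
  have hterm : ∀ a ∈ b.coeff.support, ∃ h : MvPolynomial (Fin (N + 1)) k,
      h.IsWeightedHomogeneous q (s * ∑ l ∈ J, q l) ∧
      laurentToFrac k q (AddMonoidAlgebra.single a (b.coeff a)) *
        algebraMap _ _ (coordProd k J) ^ s = algebraMap _ _ h := by
    intro a ha
    have h1 : ∀ j, 0 ≤ (a : Fin (N + 1) → ℤ) j + (if j ∈ J then s else 0 : ℕ) := fun j => by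
      have h2 := hs j a (Finsupp.mem_support_iff.1 ha)
      rw [coord_apply] at h2
      split_ifs with hj
      · omega
      · have h3 := hb j hj a (Finsupp.mem_support_iff.1 ha)
        rw [coord_apply] at h3
        simpa using h3
    choose c hc using fun j => Int.eq_ofNat_of_zero_le (h1 j)
    refine ⟨C (b.coeff a) * ∏ j, X j ^ c j, ?_, ?_⟩
    · have h2 := (isWeightedHomogeneous_C q (b.coeff a)).mul (IsWeightedHomogeneous.prod
        Finset.univ (fun j => (X j : MvPolynomial (Fin (N + 1)) k) ^ c j) (fun j => c j * q j)
        fun j _ => (isWeightedHomogeneous_X k q j).pow (c j))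
      have h3 : 0 + ∑ j, c j * q j = s * ∑ l ∈ J, q l := by
        have h4 : ((∑ j, c j * q j : ℕ) : ℤ) = ((s * ∑ l ∈ J, q l : ℕ) : ℤ) := by
          push_cast
          have h5 : ∀ j, (c j : ℤ) * q j =
              (q j : ℤ) * (a : Fin (N + 1) → ℤ) j + if j ∈ J then (s : ℤ) * q j else 0 := by
            intro j
            rw [← hc j]
            split_ifs
            · ring
            · push_cast
              ring
          rw [Finset.sum_congr rfl fun j _ => h5 j, Finset.sum_add_distrib, mem_degZero.1 a.2,
            zero_add, Finset.sum_ite_mem, Finset.univ_inter, Finset.mul_sum]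
        rw [zero_add]
        exact_mod_cast h4
      rwa [h3] at h2
    · have h2 : coordProd k J ^ s = ∏ j, X j ^ (if j ∈ J then s else 0) := by
        rw [coordProd, ← Finset.prod_pow, ← Finset.prod_subset (Finset.subset_univ J)]
        · exact Finset.prod_congr rfl fun j hj => by rw [if_pos hj]
        · intro j _ hj
          rw [if_neg hj, pow_zero]
      rw [← map_pow, h2, laurentToFrac, laurentEval_single, map_mul, map_prod, map_prod, mul_assoc,
        ← Finset.prod_mul_distrib]
      congr 1
      refine Finset.prod_congr rfl fun j _ => ?_
      rw [map_pow, map_pow, ← zpow_natCast, ← zpow_natCast,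
        ← zpow_add₀ (algebraMap_X_ne_zero j), hc j]
  choose! h hh hh' using hterm
  refine ⟨∑ a ∈ b.coeff.support, h a, IsWeightedHomogeneous.sum _ _ _ hh, ?_⟩
  conv_lhs => rw [← AddMonoidAlgebra.sum_coeff_single b, Finsupp.sum]
  rw [map_sum, Finset.sum_mul, map_sum]
  exact Finset.sum_congr rfl hh'

theorem exists_mem_chartRing (hπ : ∀ e a, a.IsWeightedHomogeneous q e → π a ∈ 𝒮 e)
    {b : AddMonoidAlgebra k (degZero q)} (hb : ∀ i ∉ J, b ∈ expFil k (coord q i) 0) :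
    ∃ x : chartRing 𝒮 q π J, chartSnd 𝒮 q π J x = laurentToFrac k q b := by
  obtain ⟨s, h, hh, e⟩ := (eventually_exists_numerator hb).exists
  obtain ⟨y, hy⟩ := exists_mem_fracRing (hg := isWeightedHomogeneous_coordProd q J) hπ
    (U := chart 𝒮 π J) (fun _ h => h) hh e
  exact ⟨⟨_, hy⟩, rfl⟩

theorem laurentToFrac_shiftPoly {m : ℕ} {M : Fin m → Fin (N + 1) →₀ ℕ}
    (hMq : ∀ i, Finsupp.weight q (M i) = ∑ i, q i) (hM : Function.Injective M)
    {f : MvPolynomial (Fin (N + 1)) k} (hf : ∀ a, f.coeff a ≠ 0 → a ∈ Set.range M) :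
    algebraMap (MvPolynomial (Fin (N + 1)) k) (FractionRing (MvPolynomial (Fin (N + 1)) k))
      (∏ j, X j) *
      laurentToFrac k q (shiftPoly hMq f) = algebraMap _ _ f := by
  rw [map_prod]
  exact laurentEval_shiftPoly hMq hM hf algebraMap_X_ne_zero

theorem mul_coordProd_erase (i : Fin (N + 1)) :
    X i * coordProd k (Finset.univ.erase i) = ∏ j, X j :=
  Finset.mul_prod_erase Finset.univ _ (Finset.mem_univ i)

/-- Here b = f' ε = f · (ε/ξ), and the positive exponent of ε along x_i cancels the pole of 1/ξ
there. So b is f times a function whose denominators are invertible on the chart. -/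
theorem chartFst_eq_zero {m : ℕ} {M : Fin m → Fin (N + 1) →₀ ℕ}
    (hMq : ∀ i, Finsupp.weight q (M i) = ∑ i, q i) (hM : Function.Injective M)
    {f : MvPolynomial (Fin (N + 1)) k} (hf : ∀ a, f.coeff a ≠ 0 → a ∈ Set.range M)
    (hker : π f = 0) {i : Fin (N + 1)}
    {b : AddMonoidAlgebra k (degZero q)} (hb : b ∈ mulFil (shiftPoly hMq f) (coord q i) 1 1)
    (x : chartRing 𝒮 q π (Finset.univ.erase i))
    (hx : chartSnd 𝒮 q π (Finset.univ.erase i) x = laurentToFrac k q b) :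
    chartFst 𝒮 q π (Finset.univ.erase i) x = 0 := by
  obtain ⟨ε, hε, rfl⟩ := mem_mulFil.1 hb
  obtain ⟨r, h, hh, h1, h2⟩ := x.2
  obtain ⟨s, hs⟩ := (eventually_mem_expFil ε).exists
  obtain ⟨h', hh'⟩ := exists_eq_prod_pow_mul_laurentEval algebraMap_X_ne_zero hs i hε (r := s + 1)
    (by push_cast; rfl)
  have hX := algebraMap_X_ne_zero (k := k) i
  set ξ : MvPolynomial (Fin (N + 1)) k := ∏ j, X j with hξ
  set g := coordProd k (Finset.univ.erase i) with hg
  have hξg : X i * g = ξ := mul_coordProd_erase i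
  have h3 : laurentToFrac k q (shiftPoly hMq f ^ 1 * ε) * algebraMap _ _ g ^ (s + 1) =
      algebraMap _ _ (f * h') := by
    apply mul_left_cancel₀ (pow_ne_zero (s + 1) hX)
    have h4 : algebraMap _ (FractionRing (MvPolynomial (Fin (N + 1)) k)) ξ ^ s *
        laurentToFrac k q ε = algebraMap _ _ (X i ^ (s + 1) * h') := by
      rw [hξ, map_prod]
      exact hh'
    have h5 := laurentToFrac_shiftPoly hMq hM hf
    rw [← hξ] at h5
    calc _ = laurentToFrac k q (shiftPoly hMq f ^ 1 * ε) *
        algebraMap _ (FractionRing (MvPolynomial (Fin (N + 1)) k)) ξ ^ (s + 1) := by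
          rw [← hξg, map_mul (algebraMap _ _) (X i) g]; ring
      _ = (algebraMap _ _ ξ * laurentToFrac k q (shiftPoly hMq f)) *
          (algebraMap _ _ ξ ^ s * laurentToFrac k q ε) := by rw [map_mul, pow_one]; ring
      _ = _ := by rw [h4, h5, map_mul, map_mul, map_pow]; ring
  have h4 : h * g ^ (s + 1) = f * (h' * g ^ r) := by
    apply IsFractionRing.injective (MvPolynomial (Fin (N + 1)) k)
      (FractionRing (MvPolynomial (Fin (N + 1)) k))
    have h5 : x.1.2 = laurentToFrac k q (shiftPoly hMq f ^ 1 * ε) := hx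
    rw [← mul_assoc, map_mul, map_mul _ (f * h'), ← h3, ← h1, h5, map_pow, map_pow]
    ring
  refine section_ext fun y hy => ?_
  have h5 := h2 y hy
  have hu : IsUnit (algebraMap S (LocAt 𝒮 y) (π g)) := isUnit_algebraMap_locAt hy
  have h6 : algebraMap S (LocAt 𝒮 y) (π h) = 0 := by
    have := congrArg (fun z => algebraMap S (LocAt 𝒮 y) (π z)) h4
    simp only [map_mul, map_pow, hker, map_zero, zero_mul] at this
    exact ((hu.pow (s + 1)).mul_left_eq_zero).1 this
  rw [h6, (hu.pow r).mul_left_eq_zero] at h5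
  rw [map_zero]
  exact h5

end Chart
end QFS
end

open MvPolynomial AlgebraicGeometry CategoryTheory Opposite
noncomputable section
namespace QFS

/-! ### Functoriality of truncated Witt vectors -/

section WittMap

variable {p : ℕ} [Fact p.Prime] {n : ℕ} {R R' R'' : Type*} [CommRing R] [CommRing R'] [CommRing R'']

theorem wittMap_injective {g : R →+* R'} (hg : Function.Injective g) :
    Function.Injective (wittMap p g : TruncatedWittVector p n R → TruncatedWittVector p n R') :=
  fun a b h => TruncatedWittVector.ext fun i => hg (by rw [← coeff_wittMap, h, coeff_wittMap])

theorem exists_wittMap_eq {g : R →+* R'} {a : TruncatedWittVector p n R'}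
    (h : ∀ i, ∃ x, g x = a.coeff i) : ∃ c, wittMap p g c = a := by
  choose x hx using h
  exact ⟨TruncatedWittVector.mk p x, TruncatedWittVector.ext fun i => by
    rw [coeff_wittMap, TruncatedWittVector.coeff_mk, hx]⟩

theorem wittMap_wittMap (g : R →+* R') (g' : R' →+* R'') (a : TruncatedWittVector p n R) :
    wittMap p g' (wittMap p g a) = wittMap p (g'.comp g) a :=
  TruncatedWittVector.ext fun i => by
    rw [coeff_wittMap, coeff_wittMap, coeff_wittMap, RingHom.comp_apply]

theorem wittMap_sum {ι : Type*} (s : Finset ι) (g : R →+* R') (a : ι → TruncatedWittVector p n R) :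
    wittMap p g (∑ i ∈ s, a i) = ∑ i ∈ s, wittMap p g (a i) :=
  map_sum (AddMonoidHom.mk' (wittMap p g) (wittMap_add g)) a s

theorem wittMap_neg (g : R →+* R') (a : TruncatedWittVector p n R) :
    wittMap p g (-a) = -wittMap p g a :=
  map_neg (AddMonoidHom.mk' (wittMap p g) (wittMap_add g)) a

theorem wittMap_zero (g : R →+* R') : wittMap p g (0 : TruncatedWittVector p n R) = 0 :=
  map_zero (AddMonoidHom.mk' (wittMap p g) (wittMap_add g))

end WittMap

/-! ### Representing values of a splitting by fractions -/

section Obstruction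

open WittVector

universe u

variable {p : ℕ} [Fact p.Prime] {k : Type*} [Field k] [CharP k p] [PerfectRing k p] {N n : ℕ}
  {S : Type u} [CommRing S] [Algebra k S]
  {𝒮 : ℕ → Submodule k S} [GradedAlgebra 𝒮] {q : Fin (N + 1) → ℕ}
  {π : MvPolynomial (Fin (N + 1)) k →+* S} {J J' : Finset (Fin (N + 1))}

variable (𝒮 q π) in
/-- Restriction of pairs to a smaller chart. -/
def chartRes (h : J ⊆ J') : chartRing 𝒮 q π J →+* chartRing 𝒮 q π J' :=
  (((((Proj 𝒮).presheaf.map (homOfLE (chart_le h)).op).hom).comp (chartFst 𝒮 q π J)).prod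
    (chartSnd 𝒮 q π J)).codRestrict _ fun x => res_mem_chartRing h (mem_chartRing x)

theorem chartFst_comp_chartRes (h : J ⊆ J') : (chartFst 𝒮 q π J').comp (chartRes 𝒮 q π h) =
    (((Proj 𝒮).presheaf.map (homOfLE (chart_le h)).op).hom).comp (chartFst 𝒮 q π J) := rfl

theorem chartSnd_comp_chartRes (h : J ⊆ J') : (chartSnd 𝒮 q π J').comp (chartRes 𝒮 q π h) =
    chartSnd 𝒮 q π J := rfl

variable (p n q) in
/-- The truncated Witt vector of fractions of a Witt vector of Laurent polynomials. -/
def wittToFrac (x : WittVector p (AddMonoidAlgebra k (degZero q))) :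
    TruncatedWittVector p n (FractionRing (MvPolynomial (Fin (N + 1)) k)) :=
  truncate n (WittVector.map (laurentToFrac k q : _ →+* _) x)

theorem coeff_wittToFrac (x : WittVector p (AddMonoidAlgebra k (degZero q))) (t : Fin n) :
    (wittToFrac p n q x).coeff t = laurentToFrac k q (x.coeff t) := by
  rw [wittToFrac, coeff_truncate, map_coeff]
  rfl

theorem exists_wittMap_chartSnd (hπ : ∀ e a, a.IsWeightedHomogeneous q e → π a ∈ 𝒮 e)
    {x : WittVector p (AddMonoidAlgebra k (degZero q))}
    (hx : ∀ i ∉ J, ∀ t, x.coeff t ∈ expFil k (coord q i) 0) :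
    ∃ c, wittMap p (chartSnd 𝒮 q π J) c = wittToFrac p n q x :=
  exists_wittMap_eq fun t => by
    rw [coeff_wittToFrac]
    exact exists_mem_chartRing hπ fun i hi => hx i hi t

theorem eq_single_zero_of_mem_expFil (hq : ∀ i, 0 < q i) {b : AddMonoidAlgebra k (degZero q)}
    (hb : ∀ i, b ∈ expFil k (coord q i) 0) : b = AddMonoidAlgebra.single 0 (b.coeff 0) := by
  classical
  apply AddMonoidAlgebra.coeff_injective
  rw [AddMonoidAlgebra.coeff_single]
  ext a
  rw [Finsupp.single_apply]
  split_ifs with h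
  · rw [h]
  · by_contra h1
    obtain ⟨i, hi⟩ := exists_one_le_coord hq (-a) (by simpa using Ne.symm h)
    have h2 := hb i a h1
    rw [map_neg] at hi
    omega

theorem exists_mem_chartRing_apply (hq : ∀ i, 0 < q i)
    (hπ : ∀ e a, a.IsWeightedHomogeneous q e → π a ∈ 𝒮 e)
    (hπ' : ∀ e, ∀ s ∈ 𝒮 e, ∃ a : MvPolynomial (Fin (N + 1)) k,
      a.IsWeightedHomogeneous q e ∧ π a = s) (hn : 0 < n)
    {φ : ∀ U : (Proj 𝒮).Opens, TruncatedWittVector p n Γ(Proj 𝒮, U) →+ Γ(Proj 𝒮, U)}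
    (hφ : ∀ (U : (Proj 𝒮).Opens) (a : TruncatedWittVector p n Γ(Proj 𝒮, U)),
      φ U (wittFrob p a) = a.coeff ⟨0, hn⟩)
    {x : WittVector p (AddMonoidAlgebra k (degZero q))}
    (hx : ∀ i ∉ J, ∀ t, x.coeff t ∈ expFil k (coord q i) 0) :
    ∃ c κ, wittMap p (chartSnd 𝒮 q π J) c = wittToFrac p n q x ∧
      (φ _ (wittMap p (chartFst 𝒮 q π J) c), κ) ∈ chartRing 𝒮 q π J := by
  obtain ⟨c, hc⟩ := exists_wittMap_chartSnd (n := n) hπ hx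
  rcases J.eq_empty_or_nonempty with rfl | hJ
  -- No variable is inverted, so there is no denominator of positive degree to describe sections.
  -- But the components of x are then constants, x is a Frobenius image because k is perfect, and
  -- the value of φ is known.
  · have h1 : ∀ t : Fin n, ∃ e : chartRing 𝒮 q π ∅, chartSnd 𝒮 q π ∅ e =
        laurentToFrac k q (AddMonoidAlgebra.single 0
          ((frobeniusEquiv k p).symm ((x.coeff t).coeff 0))) := fun t =>
      exists_mem_chartRing hπ fun i _ => single_mem_expFil (by rw [map_zero]) _
    choose e he using h1
    have h2 : c = wittFrob p (TruncatedWittVector.mk p e) := by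
      refine wittMap_injective chartSnd_injective (TruncatedWittVector.ext fun t => ?_)
      rw [hc, coeff_wittToFrac, coeff_wittMap, wittFrob, TruncatedWittVector.coeff_mk,
        TruncatedWittVector.coeff_mk, map_pow, he, ← map_pow, AddMonoidAlgebra.single_pow, smul_zero,
        frobeniusEquiv_symm_pow_p]
      exact congrArg _ (eq_single_zero_of_mem_expFil hq fun i => hx i (Finset.notMem_empty i) t)
    refine ⟨c, chartSnd 𝒮 q π ∅ (e ⟨0, hn⟩), hc, ?_⟩
    rw [h2, wittMap_wittFrob, hφ, coeff_wittMap, TruncatedWittVector.coeff_mk]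
    exact mem_chartRing _
  · obtain ⟨κ, hκ⟩ := exists_mem_fracRing_of_section (hg := isWeightedHomogeneous_coordProd q J)
      hπ hπ' (Finset.sum_pos (fun i _ => hq i) hJ) (coordProd_ne_zero J)
      (φ (chart 𝒮 π J) (wittMap p (chartFst 𝒮 q π J) c))
    exact ⟨c, κ, hc, hκ⟩

theorem exists_forall_mem_chartRing (hq : ∀ i, 0 < q i)
    (hπ : ∀ e a, a.IsWeightedHomogeneous q e → π a ∈ 𝒮 e)
    (hπ' : ∀ e, ∀ s ∈ 𝒮 e, ∃ a : MvPolynomial (Fin (N + 1)) k,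
      a.IsWeightedHomogeneous q e ∧ π a = s) (hn : 0 < n)
    {φ : ∀ U : (Proj 𝒮).Opens, TruncatedWittVector p n Γ(Proj 𝒮, U) →+ Γ(Proj 𝒮, U)}
    (hφ : ∀ (U : (Proj 𝒮).Opens) (a : TruncatedWittVector p n Γ(Proj 𝒮, U)),
      φ U (wittFrob p a) = a.coeff ⟨0, hn⟩)
    (hres : ∀ (U V : (Proj 𝒮).Opens) (h : V ≤ U) (a : TruncatedWittVector p n Γ(Proj 𝒮, U)),
      φ V (wittMap p ((Proj 𝒮).presheaf.map (homOfLE h).op).hom a) =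
        ((Proj 𝒮).presheaf.map (homOfLE h).op).hom (φ U a))
    {x : WittVector p (AddMonoidAlgebra k (degZero q))}
    (hx : ∀ i ∉ J, ∀ t, x.coeff t ∈ expFil k (coord q i) 0) :
    ∃ κ, ∀ J', J ⊆ J' → ∀ c, wittMap p (chartSnd 𝒮 q π J') c = wittToFrac p n q x →
      (φ _ (wittMap p (chartFst 𝒮 q π J') c), κ) ∈ chartRing 𝒮 q π J' := by
  obtain ⟨c₀, κ, hc₀, hκ⟩ := exists_mem_chartRing_apply hq hπ hπ' hn hφ hx
  refine ⟨κ, fun J' hJ c hc => ?_⟩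
  have h1 : c = wittMap p (chartRes 𝒮 q π hJ) c₀ := by
    apply wittMap_injective chartSnd_injective
    rw [hc, wittMap_wittMap, chartSnd_comp_chartRes, hc₀]
  rw [h1, wittMap_wittMap, chartFst_comp_chartRes, ← wittMap_wittMap, hres]
  exact res_mem_chartRing hJ hκ

end Obstruction
end QFS
end

open MvPolynomial AlgebraicGeometry CategoryTheory Opposite
noncomputable section
namespace QFS

/-! ### Obstruction to splitting the hypersurface -/

section ProjObstruction

open WittVector

universe u

variable {p : ℕ} [Fact p.Prime] {k : Type*} [Field k] [CharP k p] [PerfectRing k p] {N n : ℕ}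
  {S : Type u} [CommRing S] [Algebra k S]
  {𝒮 : ℕ → Submodule k S} [GradedAlgebra 𝒮] {q : Fin (N + 1) → ℕ}
  {π : MvPolynomial (Fin (N + 1)) k →+* S}

theorem wittToFrac_eq_wittMap (x : WittVector p (AddMonoidAlgebra k (degZero q))) :
    wittToFrac p n q x = wittMap p (laurentToFrac k q : _ →+* _) (truncate n x) :=
  (wittMap_truncate _ x).symm

theorem exists_cech_cocycle (hq : ∀ i, 0 < q i)
    (hπ : ∀ e a, a.IsWeightedHomogeneous q e → π a ∈ 𝒮 e)
    (hπ' : ∀ e, ∀ s ∈ 𝒮 e, ∃ a : MvPolynomial (Fin (N + 1)) k,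
      a.IsWeightedHomogeneous q e ∧ π a = s) (hn : 0 < n)
    {φ : ∀ U : (Proj 𝒮).Opens, TruncatedWittVector p n Γ(Proj 𝒮, U) →+ Γ(Proj 𝒮, U)}
    (hφ : ∀ (U : (Proj 𝒮).Opens) (a : TruncatedWittVector p n Γ(Proj 𝒮, U)),
      φ U (wittFrob p a) = a.coeff ⟨0, hn⟩)
    (hres : ∀ (U V : (Proj 𝒮).Opens) (h : V ≤ U) (a : TruncatedWittVector p n Γ(Proj 𝒮, U)),
      φ V (wittMap p ((Proj 𝒮).presheaf.map (homOfLE h).op).hom a) =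
        ((Proj 𝒮).presheaf.map (homOfLE h).op).hom (φ U a))
    {γ : Fin (N + 1) → Fin (N + 1) → WittVector p (AddMonoidAlgebra k (degZero q))}
    (hγ : ∀ i j t, (γ i j).coeff t ∈ expFil k (coord q i) 0) (hγ' : ∀ i j, γ j i = -γ i j)
    (hγ0 : ∀ i, γ i i = 0) :
    ∃ κ : Fin (N + 1) → Fin (N + 1) → FractionRing (MvPolynomial (Fin (N + 1)) k),
      ∑ i, ∑ j, κ i j = 0 ∧ ∀ i j c,
        wittMap p (chartSnd 𝒮 q π (Finset.univ.erase i)) c = wittToFrac p n q (γ i j) →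
          (φ _ (wittMap p (chartFst 𝒮 q π (Finset.univ.erase i)) c), κ i j) ∈
            chartRing 𝒮 q π (Finset.univ.erase i) := by
  have hγj : ∀ i j t, (γ i j).coeff t ∈ expFil k (coord q j) 0 := by
    intro i j
    rw [hγ' j i]
    exact mem_wittSubgroup.1 (neg_mem (mem_wittSubgroup (hJ := admissible_expFil_zero (coord q j)).2
      (hγ j i)))
  have hex : ∀ i j, ∃ κ, ∀ J', (Finset.univ.erase i).erase j ⊆ J' → ∀ c,
      wittMap p (chartSnd 𝒮 q π J') c = wittToFrac p n q (γ i j) →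
      (φ _ (wittMap p (chartFst 𝒮 q π J') c), κ) ∈ chartRing 𝒮 q π J' := by
    intro i j
    refine exists_forall_mem_chartRing hq hπ hπ' hn hφ hres fun l hl => ?_
    have : l = j ∨ l = i := by
      by_contra! h
      exact hl (Finset.mem_erase.2 ⟨h.1, Finset.mem_erase.2 ⟨h.2, Finset.mem_univ l⟩⟩)
    rcases this with rfl | rfl
    · exact hγj i l
    · exact hγ l j
  choose κ₀ hκ₀ using hex
  -- A section has many representing fractions, so κ₀ j i need not be -κ₀ i j. Keeping only i < j
  -- and antisymmetrizing makes the double sum vanish exactly.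
  set μ : Fin (N + 1) → Fin (N + 1) → FractionRing (MvPolynomial (Fin (N + 1)) k) :=
    fun i j => if i < j then κ₀ i j else 0 with hμ
  refine ⟨fun i j => μ i j - μ j i, ?_, fun i j c hc => ?_⟩
  · simp only [Finset.sum_sub_distrib]
    rw [Finset.sum_comm, sub_self]
  · rcases lt_trichotomy i j with h | rfl | h
    · have e : μ i j - μ j i = κ₀ i j := by
        simp only [hμ]
        rw [if_pos h, if_neg h.le.not_gt, sub_zero]
      simp only [e]
      exact hκ₀ i j _ (Finset.erase_subset _ _) c hc
    · have e : c = 0 := by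
        apply wittMap_injective chartSnd_injective
        rw [hc, hγ0, wittToFrac_eq_wittMap, map_zero, wittMap_zero, wittMap_zero]
      rw [e, wittMap_zero, map_zero]
      simp only [sub_self]
      exact zero_mem _
    · have e : μ i j - μ j i = -κ₀ j i := by
        simp only [hμ]
        rw [if_pos h, if_neg h.le.not_gt, zero_sub]
      simp only [e]
      have h1 := hκ₀ j i (Finset.univ.erase i) (by
        rw [Finset.erase_right_comm]
        exact Finset.erase_subset _ _) (-c) (by
          rw [wittMap_neg, hc, hγ' i j, wittToFrac_eq_wittMap, wittToFrac_eq_wittMap, map_neg,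
            wittMap_neg])
      rw [wittMap_neg, map_neg] at h1
      have h2 := neg_mem h1
      rwa [Prod.neg_mk, neg_neg] at h2

theorem sum_coeff_zero {R ι : Type*} [CommRing R] (s : Finset ι) (x : ι → WittVector p R) :
    (∑ i ∈ s, x i).coeff 0 = ∑ i ∈ s, (x i).coeff 0 :=
  map_sum (constantCoeff : WittVector p R →+* R) x s

/-- Applying φ to F α_i = β_i + ∑_j γ_ij gives (α_i)_0 = ∑_j κ_ij on X over the i-th chart, since
β_i vanishes there. Hence (α_i)_0 - ∑_j κ_ij is f times a fraction with denominators only in the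
x_l, l ≠ i. Summing over i removes the κ_ij and leaves f'; multiplying by a power of ξ contradicts
`prod_X_pow_ne_sum`. For N > 0 the denominators of the charts have positive degree. -/
theorem not_isQuasiFSplit_proj (hN : 0 < N) {m : ℕ} {M : Fin m → Fin (N + 1) →₀ ℕ}
    (hM : Function.Injective M) (hq : ∀ i, 0 < q i)
    (hMq : ∀ a, a ∈ Set.range M ↔ Finsupp.weight q a = ∑ i, q i)
    {f : MvPolynomial (Fin (N + 1)) k} (hf0 : f ≠ 0) (hf : ∀ a, f.coeff a ≠ 0 → a ∈ Set.range M)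
    (hπ : ∀ e a, a.IsWeightedHomogeneous q e → π a ∈ 𝒮 e)
    (hπ' : ∀ e, ∀ s ∈ 𝒮 e, ∃ a : MvPolynomial (Fin (N + 1)) k,
      a.IsWeightedHomogeneous q e ∧ π a = s) (hker : ∀ a, π a = 0 ↔ f ∣ a)
    (h0 : ∀ l < n, rowR p M f (l + 1) ⬝ᵥ coeffVec M f = 0) :
    ¬ IsQuasiFSplit p (Proj 𝒮) n := by
  rintro ⟨hn, φ, hres, -, hφ⟩
  have hMq' : ∀ i, Finsupp.weight q (M i) = ∑ i, q i := fun i => (hMq _).1 ⟨i, rfl⟩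
  obtain ⟨α, β, γ, hα, hβ, hγ, hγ', hγ0, hsum, heq⟩ := exists_cech_data hMq' hM hq hMq hf h0
  obtain ⟨κ, hκ, hκ'⟩ := exists_cech_cocycle (π := π) hq hπ hπ' hn hφ hres hγ hγ' hγ0
  have hlift : ∀ (i : Fin (N + 1)) (x : WittVector p (AddMonoidAlgebra k (degZero q))),
      (∀ t, x.coeff t ∈ expFil k (coord q i) 0) →
      ∃ c, wittMap p (chartSnd 𝒮 q π (Finset.univ.erase i)) c = wittToFrac p n q x := by
    intro i x hx
    refine exists_wittMap_chartSnd hπ fun l hl => ?_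
    have : l = i := by
      by_contra h
      exact hl (Finset.mem_erase.2 ⟨h, Finset.mem_univ l⟩)
    rwa [this]
  choose a ha using fun i => hlift i (α i) (hα i)
  choose b hb using fun i => hlift i (β i) fun t => by
    obtain ⟨e, he, he'⟩ := mem_mulFil.1 (hβ i t)
    rw [← he', pow_one]
    exact mul_mem_expFil (shiftPoly_mem_expFil hMq' i) he
  choose c hc using fun i j => hlift i (γ i j) (hγ i j)
  have hrel : ∀ i, wittFrob p (a i) = b i + ∑ j, c i j := by
    intro i
    apply wittMap_injective chartSnd_injective
    rw [wittMap_wittFrob, ha, wittMap_add, wittMap_sum, hb, wittToFrac_eq_wittMap,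
      wittToFrac_eq_wittMap, ← wittMap_wittFrob, wittFrob_truncate, heq i, map_add, map_sum,
      wittMap_add, wittMap_sum]
    exact congrArg _ (Finset.sum_congr rfl fun j _ => by rw [hc, wittToFrac_eq_wittMap])
  have hmem : ∀ i, ((0, laurentToFrac k q ((α i).coeff 0) - ∑ j, κ i j) :
      Γ(Proj 𝒮, chart 𝒮 π (Finset.univ.erase i)) × _) ∈
        chartRing 𝒮 q π (Finset.univ.erase i) := by
    intro i
    have h1 : wittMap p (chartFst 𝒮 q π (Finset.univ.erase i)) (b i) = 0 := by
      refine TruncatedWittVector.ext fun t => ?_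
      rw [coeff_wittMap, TruncatedWittVector.coeff_zero]
      refine chartFst_eq_zero hMq' hM hf ((hker f).2 dvd_rfl) (hβ i t) _ ?_
      rw [← coeff_wittMap, hb, coeff_wittToFrac]
    have h2 := congrArg (fun x => φ _ (wittMap p (chartFst 𝒮 q π (Finset.univ.erase i)) x)) (hrel i)
    simp only [wittMap_wittFrob, wittMap_add, wittMap_sum, map_add, map_sum, h1, map_zero, zero_add,
      hφ, coeff_wittMap] at h2
    have h3 := sub_mem (mem_chartRing ((a i).coeff ⟨0, hn⟩))
      (sum_mem (S := chartRing 𝒮 q π (Finset.univ.erase i)) (t := Finset.univ)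
        fun j _ => hκ' i j (c i j) (hc i j))
    have h4 : chartSnd 𝒮 q π (Finset.univ.erase i) ((a i).coeff ⟨0, hn⟩) =
        laurentToFrac k q ((α i).coeff 0) := by
      rw [← coeff_wittMap, ha, coeff_wittToFrac]
    convert h3 using 1
    refine Prod.ext ?_ ?_
    · rw [Prod.fst_sub, Prod.fst_sum, h2, sub_self]
    · rw [Prod.snd_sub, Prod.snd_sum, h4]
  have hev := Filter.eventually_all.2 fun i => eventually_exists_of_mem_fracRing hπ hker
    (Finset.sum_pos (fun l _ => hq l) (by
      rw [← Finset.card_pos, Finset.card_erase_of_mem (Finset.mem_univ i), Finset.card_univ,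
        Fintype.card_fin]
      omega)) (hmem i)
  -- A common exponent s = l + 1 for all charts. One factor ξ turns f' into f, leaving f ξ^l = ∑
  -- x_i^(l+1) f h_i.
  obtain ⟨s, hs⟩ := (hev.and (Filter.eventually_ge_atTop 1)).exists
  obtain ⟨l, rfl⟩ : ∃ l, s = l + 1 := ⟨s - 1, by omega⟩
  choose h hh using hs.1
  refine prod_X_pow_ne_sum (k := k) (N := N) (l := l) h (mul_left_cancel₀ hf0 ?_)
  apply IsFractionRing.injective (MvPolynomial (Fin (N + 1)) k)
    (FractionRing (MvPolynomial (Fin (N + 1)) k))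
  have hval : laurentToFrac k q (shiftPoly hMq' f) =
      ∑ i, (laurentToFrac k q ((α i).coeff 0) - ∑ j, κ i j) := by
    have h1 := truncate_eq_iff.1 hsum 0 hn
    rw [teichmuller_coeff_zero, sum_coeff_zero] at h1
    rw [Finset.sum_sub_distrib, hκ, sub_zero, h1, map_sum]
  rw [map_mul, ← laurentToFrac_shiftPoly hMq' hM hf, hval, map_pow, Finset.mul_sum, Finset.sum_mul,
    Finset.mul_sum, map_sum]
  refine Finset.sum_congr rfl fun i _ => ?_
  rw [mul_left_comm, map_mul, map_pow, ← hh i, ← mul_coordProd_erase i, map_mul]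
  ring

/-- With one variable, zero is the only exponent of degree zero, so nothing nonzero has positive
exponent and F[f] would have zeroth component 0. -/
theorem not_isGoodSum_of_eq_zero {f : AddMonoidAlgebra k (degZero q)} (hN : N = 0)
    (hq : ∀ i, 0 < q i) (hf0 : f ≠ 0) (hn : 0 < n) :
    ¬ IsGoodSum p f (coord q) n (frobenius (teichmuller p f)) := by
  rintro ⟨z, hz, hsum⟩
  subst hN
  have h1 := truncate_eq_iff.1 hsum 0 hn
  rw [frobenius_teichmuller, ← map_pow, teichmuller_coeff_zero, sum_coeff_zero] at h1
  refine pow_ne_zero p hf0 (h1.trans (Finset.sum_eq_zero fun i _ => ?_))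
  obtain ⟨e, he, he'⟩ := mem_mulFil.1 (hz i 0)
  have h2 : e = 0 := by
    apply AddMonoidAlgebra.coeff_injective
    ext a
    by_contra h3
    have h4 := he a h3
    obtain ⟨j, hj⟩ := exists_one_le_coord hq (-a) (by
      intro h5
      rw [neg_eq_zero.1 h5, map_zero] at h4
      omega)
    rw [map_neg, (Fin.ext (by omega) : j = i)] at hj
    omega
  rw [← he', h2, mul_zero]

theorem not_isQuasiFSplit_hypersurface {m : ℕ} {M : Fin m → Fin (N + 1) →₀ ℕ}
    (hM : Function.Injective M) (hq : ∀ i, 0 < q i)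
    (hMq : ∀ a, a ∈ Set.range M ↔ Finsupp.weight q a = ∑ i, q i)
    {f : MvPolynomial (Fin (N + 1)) k} (hf0 : f ≠ 0) (hf : f.IsWeightedHomogeneous q (∑ i, q i))
    (h0 : ∀ l < n, rowR p M f (l + 1) ⬝ᵥ coeffVec M f = 0) :
    ¬ IsQuasiFSplit p (hypersurface q f (∑ i, q i) hf) n := by
  have hf' : ∀ a, f.coeff a ≠ 0 → a ∈ Set.range M := fun a ha => (hMq a).2 (hf ha)
  rcases N.eq_zero_or_pos with hN | hN
  -- Here X is empty, so its splitting carries no information; it is the vanishing of the R_l v_f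
  -- that is contradictory.
  · rintro ⟨hn, -⟩
    have hMq' : ∀ i, Finsupp.weight q (M i) = ∑ i, q i := fun i => (hMq _).1 ⟨i, rfl⟩
    exact not_isGoodSum_of_eq_zero hN hq (shiftPoly_ne_zero hMq' hM hf' hf0) hn
      (isGoodSum_frobenius_teichmuller_shiftPoly hMq' hM hq hMq hf' h0)
  · let _ := weightedGradedAlgebra k q
    let _ := quotGradedAlgebra (weightedHomogeneousSubmodule k q) (Ideal.span {f})
      (isHomogeneous_span q hf)
    exact not_isQuasiFSplit_proj (𝒮 := quotGrading (weightedHomogeneousSubmodule k q)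
      (Ideal.span {f})) hN hM hq hMq hf0 hf' (π := Ideal.Quotient.mk (Ideal.span {f}))
      (fun e a ha => mk_mem_quotGrading ha)
      (fun e s hs => exists_isWeightedHomogeneous_of_mem_quotGrading hs)
      (fun a => Ideal.Quotient.eq_zero_iff_mem.trans Ideal.mem_span_singleton) h0

end ProjObstruction
end QFS
end

open MvPolynomial AlgebraicGeometry CategoryTheory Opposite
noncomputable section
namespace QFS

/-- Only the first index where Q holds matters, so P and Q need to agree only as long as Q has
failed before. P is not assumed monotone. -/
theorem leastIndex_eq {P Q : ℕ → Prop}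
    (h : ∀ n, (∀ l < n, ¬ Q (l + 1)) → (P (n + 1) ↔ Q (n + 1))) :
    leastIndex P = leastIndex Q := by
  classical
  have key : ∀ n, Q (n + 1) → ∃ l ≤ n, Q (l + 1) ∧ P (l + 1) := fun n hn => by
    have hex : ∃ l, Q (l + 1) := ⟨n, hn⟩
    exact ⟨Nat.find hex, Nat.find_min' hex hn, Nat.find_spec hex,
      (h _ fun l hl => Nat.find_min hex hl).2 (Nat.find_spec hex)⟩
  refine le_antisymm (le_sInf ?_) (le_sInf ?_)
  · rintro _ ⟨n, hn, hQ, rfl⟩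
    obtain ⟨n, rfl⟩ := Nat.exists_eq_succ_of_ne_zero (by omega : n ≠ 0)
    obtain ⟨l, hl, -, hP⟩ := key n hQ
    have h1 : leastIndex P ≤ (l + 1 : ℕ) := sInf_le ⟨l + 1, by omega, hP, rfl⟩
    exact h1.trans (Nat.cast_le.2 (Nat.succ_le_succ hl))
  · rintro _ ⟨n, hn, hP, rfl⟩
    obtain ⟨n, rfl⟩ := Nat.exists_eq_succ_of_ne_zero (by omega : n ≠ 0)
    by_cases hQ : ∃ l < n, Q (l + 1)
    · obtain ⟨l, hl, hQ⟩ := hQ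
      have h1 : leastIndex Q ≤ (l + 1 : ℕ) := sInf_le ⟨l + 1, by omega, hQ, rfl⟩
      exact h1.trans (Nat.cast_le.2 (Nat.succ_le_succ hl.le))
    · push Not at hQ
      exact sInf_le ⟨n + 1, by omega, (h n hQ).1 hP, rfl⟩

/-! ### Ranks of the row matrices -/

section Rank

variable {p : ℕ} [Fact p.Prime] {k : Type*} [Field k] [CharP k p] [PerfectRing k p] {N m n : ℕ}
  {M : Fin m → Fin (N + 1) →₀ ℕ} {f : MvPolynomial (Fin (N + 1)) k}

theorem coeffVec_sum_monomial (hM : Function.Injective M) (c : Fin m → k) :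
    coeffVec M (∑ i, monomial (M i) (c i)) = c := by
  classical
  funext j
  rw [coeffVec, MvPolynomial.coeff_sum]
  simp only [coeff_monomial, hM.eq_iff]
  simp

theorem linearIndependent_rowR_iff :
    LinearIndependent k (fun i : Fin n => rowR p M f (i + 1)) ↔ n ≤ (matR p M f n).rank := by
  rw [linearIndependent_iff_card_le_finrank_span, Fintype.card_fin, Matrix.rank_eq_finrank_span_row]
  rfl

theorem exists_rowR_eq_sum (h0 : n ≤ (matR p M f n).rank) (h1 : (matR p M f (n + 1)).rank ≤ n) :
    ∃ w : ℕ → k, rowR p M f (n + 1) = ∑ l ∈ Finset.range n, w l • rowR p M f (l + 1) := by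
  have h2 : ¬ LinearIndependent k (fun i : Fin (n + 1) => rowR p M f (i + 1)) := by
    rw [linearIndependent_rowR_iff]
    omega
  rw [linearIndependent_finSucc', not_and_not_right] at h2
  obtain ⟨w, hw⟩ := (Submodule.mem_span_range_iff_exists_fun k).1
    (h2 (linearIndependent_rowR_iff.2 h0))
  refine ⟨fun l => if h : l < n then w ⟨l, h⟩ else 0, ?_⟩
  rw [Finset.sum_range]
  refine Eq.trans hw.symm (Finset.sum_congr rfl fun i _ => ?_)
  simp only [dif_pos i.2]
  rfl

/-- Full row rank makes the matrix surjective on column vectors, and every column vector is the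
coefficient vector of a polynomial of degree d. -/
theorem exists_rowR_dotProduct (hM : Function.Injective M) {q : Fin (N + 1) → ℕ}
    (hMq : ∀ i, Finsupp.weight q (M i) = ∑ i, q i) (h : n ≤ (matR p M f n).rank)
    (i : Fin n) : ∃ c : MvPolynomial (Fin (N + 1)) k, c.IsWeightedHomogeneous q (∑ i, q i) ∧
      ∀ l : Fin n, rowR p M f (l + 1) ⬝ᵥ coeffVec M c = if l = i then 1 else 0 := by
  have h1 : LinearMap.range (matR p M f n).mulVecLin = ⊤ := by
    apply Submodule.eq_top_of_finrank_eq
    rw [Module.finrank_fin_fun]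
    refine le_antisymm ?_ h
    exact (matR p M f n).rank_le_height
  obtain ⟨c, hc⟩ := LinearMap.range_eq_top.1 h1 (Pi.single i 1)
  refine ⟨∑ i, monomial (M i) (c i), IsWeightedHomogeneous.sum _ _ _ fun i _ =>
    isWeightedHomogeneous_monomial _ _ _ (hMq i), fun l => ?_⟩
  rw [coeffVec_sum_monomial hM, ← Pi.single_apply, ← hc]
  rfl

theorem isQuasiFSplitPair_iff (hM : Function.Injective M) {q : Fin (N + 1) → ℕ}
    (hq : ∀ i, 0 < q i) (hMq : ∀ a, a ∈ Set.range M ↔ Finsupp.weight q a = ∑ i, q i)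
    (hf : f.IsWeightedHomogeneous q (∑ i, q i)) (hf0 : f ≠ 0)
    (h0 : ∀ l < n, rowR p M f (l + 1) ⬝ᵥ coeffVec M f = 0) (hr : n ≤ (matR p M f n).rank) :
    IsQuasiFSplitPair p (1 - 2 / (p : ℚ) ^ (n + 1)) f (n + 1) ↔
      n + 1 ≤ (matR p M f (n + 1)).rank := by
  have hMq' : ∀ i, Finsupp.weight q (M i) = ∑ i, q i := fun i => (hMq _).1 ⟨i, rfl⟩
  have hf' : ∀ a, f.coeff a ≠ 0 → a ∈ Set.range M := fun a ha => (hMq a).2 (hf ha)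
  refine ⟨fun h => ?_, fun h => ?_⟩
  · by_contra h1
    obtain ⟨w, hw⟩ := exists_rowR_eq_sum hr (by omega)
    exact not_isQuasiFSplitPair_of_mem_errGroup hMq' hM hf0 hf'
      (frobenius_teichmuller_shiftPoly_mem hMq' hM hq hMq hf' h0 w hw) h
  · obtain ⟨c, hc, hc'⟩ := exists_rowR_dotProduct hM hMq' h (Fin.last n)
    refine isQuasiFSplitPair_of_rowR hM hq hMq hf hf0 hc (fun l hl => ?_) ?_ fun hn => ?_
    · have := hc' ⟨l, by omega⟩
      rwa [if_neg (by rw [Fin.ext_iff]; exact hl.ne)] at this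
    · have := hc' (Fin.last n)
      rw [if_pos rfl] at this
      exact this ▸ one_ne_zero
    -- A second polynomial, dual to R_2, serves only to show that f is squarefree.
    · obtain ⟨c₁, hc₁, hc₁'⟩ := exists_rowR_dotProduct hM hMq' h ⟨1, by omega⟩
      refine ⟨c₁, hc₁, ?_, ?_⟩
      · have := hc₁' ⟨0, by omega⟩
        rwa [if_neg (by rw [Fin.ext_iff]; exact zero_ne_one)] at this
      · have := hc₁' ⟨1, by omega⟩
        rw [if_pos rfl] at this
        exact this ▸ one_ne_zero

end Rank
end QFS
end

theorem theorem3p12 (p : ℕ) [Fact p.Prime] {k : Type*} [Field k] [IsAlgClosed k] [CharP k p]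
    {N : ℕ} (q : Fin (N + 1) → ℕ) (hq : ∀ i, 0 < q i)
    {m : ℕ} (M : Fin m ≃ {α : Fin (N + 1) →₀ ℕ // Finsupp.weight q α = ∑ i, q i})
    (f : MvPolynomial (Fin (N + 1)) k) (hf : f.IsWeightedHomogeneous q (∑ i, q i))
    (hf0 : f ≠ 0) :
    QFS.quasiFSplitHeight p (QFS.hypersurface q f (∑ i, q i) hf) =
        QFS.leastIndex (fun n =>
          QFS.rowR p (fun i => (M i).1) f n ⬝ᵥ QFS.coeffVec (fun i => (M i).1) f ≠ 0) ∧
      ((∀ n : ℕ, 1 ≤ n →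
          QFS.rowR p (fun i => (M i).1) f n ⬝ᵥ QFS.coeffVec (fun i => (M i).1) f = 0) →
        QFS.nonSplittingIndex p f =
          QFS.leastIndex (fun n => (QFS.matR p (fun i => (M i).1) f n).rank ≤ n - 1)) := by
  have hM : Function.Injective fun i => (M i).1 := Subtype.val_injective.comp M.injective
  have hMq : ∀ a, a ∈ Set.range (fun i => (M i).1) ↔ Finsupp.weight q a = ∑ i, q i := by
    refine fun a => ⟨?_, fun ha => ⟨M.symm ⟨a, ha⟩, by simp⟩⟩
    rintro ⟨i, rfl⟩
    exact (M i).2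
  refine ⟨QFS.leastIndex_eq fun n h => ?_, fun h0 => QFS.leastIndex_eq fun n h => ?_⟩
  · have h' : ∀ l < n, QFS.rowR p (fun i => (M i).1) f (l + 1) ⬝ᵥ
        QFS.coeffVec (fun i => (M i).1) f = 0 := fun l hl => not_not.1 (h l hl)
    refine ⟨fun hs h1 => ?_, QFS.isQuasiFSplit_hypersurface_of_rowR hM hq hMq hf h'⟩
    refine QFS.not_isQuasiFSplit_hypersurface hM hq hMq hf0 hf (fun l hl => ?_) hs
    rcases Nat.lt_succ_iff_lt_or_eq.1 hl with hl | rfl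
    · exact h' l hl
    · exact h1
  -- The rank has not dropped at index n, so the first n rows are independent; for n = 0 there is
  -- nothing to know.
  · have hr : n ≤ (QFS.matR p (fun i => (M i).1) f n).rank := by
      rcases n with _ | n
      · exact Nat.zero_le _
      · have := h n n.lt_succ_self
        omega
    rw [QFS.isQuasiFSplitPair_iff hM hq hMq hf hf0 (fun l _ => h0 (l + 1) (by omega)) hr]
    omega
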